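/- **Corollary (learning LTFs under Gaussian nasty noise).** A linear threshold function (LTF) on $\mathbb{R}^n$ is a function $f(x)=\mathrm{sign}(v\cdot x+\theta)\in\{\pm1\}$ with $v\in\mathbb{R}^n$, $\theta\in\mathbb{R}$ arbitrary (with $\mathrm{sign}(0)=1$). In the nasty noise model at rate $\epsilon$ under $N(0,I)$, with target LTF $f$: $m$ points $x^{(1)},\dots,x^{(m)}$ are drawn independently from $N(0,I)$ on $\mathbb{R}^n$ and labeled by $f$; an adversary, who sees them and knows $f$ and the learning algorithm, replaces at most $\epsilon m$ of the labeled examples by arbitrary elements of $\mathbb{R}^n\times\{\pm1\}$ and presents the resulting $m$ labeled examples in an arbitrary order to the learner. There is a single (deterministic) algorithm on a real RAM (unit-cost exact arithmetic and comparisons on real numbers, with rational constants only) and there are absolute constants $a,k,b,l\in\mathbb{N}$ and $c\in\mathbb{R}$ such that the following holds for every $n\ge 1$ and every $0<\epsilon\le 1/2$. Given $n$, $\epsilon$ and a set of $m=\lceil a(n/\epsilon)^k\rceil$ labeled examples, the algorithm always halts within $b(n/\epsilon)^l$ steps and outputs an LTF $h$ (its coefficients). If the examples come from the nasty noise model at rate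 $\epsilon$ under $N(0,I)$ with target LTF $f$, then, for every LTF $f$ and with probability at least $9/10$ over the draw of the $m$ clean points, whatever the adversary does, $$\Pr_{x\sim N(0,I)}[h(x)\neq f(x)]\le c\,\epsilon\sqrt{\log(1/\epsilon)} .$$ -/

import Mathlib

/-! ### Linear threshold functions over Gaussian space -/

/-- Points of `ℝⁿ`. -/
abbrev Pt (n : ℕ) : Type := EuclideanSpace ℝ (Fin n)

/-- A linear threshold function on `ℝⁿ`, given by its coefficients: an arbitrary vector `v`
(not necessarily a unit vector, and possibly `0`, which gives the constant functions) and a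
real number `θ`. -/
structure LTF (n : ℕ) where
  v : Pt n
  θ : ℝ

open Classical in
/-- The `{±1}`-valued function `x ↦ sign (v ⬝ x + θ)`, with `sign 0 = 1`. -/
noncomputable def LTF.label {n : ℕ} (f : LTF n) (x : Pt n) : ℤˣ :=
  if 0 ≤ inner ℝ f.v x + f.θ then 1 else -1

/-- The error `Pr_{x ∼ N(0, I)} [h(x) ≠ f(x)]`. -/
noncomputable def LTF.err {n : ℕ} (h f : LTF n) : ℝ :=
  (ProbabilityTheory.stdGaussian (Pt n)).real {x | h.label x ≠ f.label x}

/-! ### The nasty noise model -/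

/-- A labeled example `(x, y)` with `x ∈ ℝⁿ` and `y ∈ {±1}`. -/
abbrev Example (n : ℕ) : Type := Pt n × ℤˣ

open Classical in
/-- `S` is a possible answer of the nasty adversary at noise rate `ε` to the clean points `X`
with target concept `f`: at most an `ε`-fraction of the `m` examples has been replaced by
arbitrary labeled examples, the others are labeled by `f`, and the adversary may present the
resulting sample in any order. -/
def IsNastySample {n m : ℕ} (ε : ℝ) (f : LTF n) (X : Fin m → Pt n) (S : Fin m → Example n) :
    Prop :=
  ∃ σ : Equiv.Perm (Fin m),
    ((Finset.univ.filter fun i => S i ≠ (X (σ i), f.label (X (σ i)))).card : ℝ) ≤ ε * m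

/-- The law of `m` independent points from `N(0, I)` on `ℝⁿ`. -/
noncomputable def cleanLaw (n m : ℕ) : MeasureTheory.Measure (Fin m → Pt n) :=
  MeasureTheory.Measure.pi fun _ => ProbabilityTheory.stdGaussian (Pt n)

/-! ### Real-number random access machines

A program uses finitely many index registers, holding natural numbers, and finitely many arrays
of real numbers, addressed by natural numbers.  The operations are exact arithmetic, comparisons
and structured control flow.  There are no roundings or conversions from real numbers to
integers, no transcendental functions, no random bits, and the only constants are rational.  One
program has to serve all dimensions and all accuracies. -/

namespace RealRAM

/-- A memory state: index register `r` holds `idx r`, and cell `i` of array `a` holds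
`mem a i`. -/
structure State where
  idx : ℕ → ℕ
  mem : ℕ → ℕ → ℝ

/-- Index expressions; subtraction is truncated. -/
inductive IExpr where
  | const (k : ℕ)
  | reg (r : ℕ)
  | add (a b : IExpr)
  | sub (a b : IExpr)
  | mul (a b : IExpr)

/-- Real expressions; `cell a i` reads cell `i` of array `a`, and `cast e` is the value of the
index expression `e` as a real number. Division by zero returns zero. -/
inductive RExpr where
  | const (q : ℚ)
  | cell (a : ℕ) (i : IExpr)
  | cast (e : IExpr)
  | add (a b : RExpr)
  | sub (a b : RExpr)
  | mul (a b : RExpr)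
  | div (a b : RExpr)

/-- Tests. -/
inductive Test where
  | ilt (a b : IExpr)
  | rlt (a b : RExpr)
  | neg (t : Test)

/-- Programs. -/
inductive Prog where
  | skip
  | setI (r : ℕ) (e : IExpr)
  | setR (a : ℕ) (i : IExpr) (e : RExpr)
  | seq (p q : Prog)
  | cond (t : Test) (p q : Prog)
  | loop (t : Test) (p : Prog)

def IExpr.eval (s : State) : IExpr → ℕ
  | const k => k
  | reg r => s.idx r
  | add a b => a.eval s + b.eval s
  | sub a b => a.eval s - b.eval s
  | mul a b => a.eval s * b.eval s

noncomputable def RExpr.eval (s : State) : RExpr → ℝ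
  | const q => (q : ℝ)
  | cell a i => s.mem a (i.eval s)
  | cast e => (e.eval s : ℝ)
  | add a b => a.eval s + b.eval s
  | sub a b => a.eval s - b.eval s
  | mul a b => a.eval s * b.eval s
  | div a b => a.eval s / b.eval s

def Test.Holds (s : State) : Test → Prop
  | ilt a b => a.eval s < b.eval s
  | rlt a b => a.eval s < b.eval s
  | neg t => ¬ t.Holds s

/-- The cost of an evaluation is the number of nodes of the expression. -/
def IExpr.cost : IExpr → ℕ
  | const _ => 1
  | reg _ => 1
  | add a b => a.cost + b.cost + 1
  | sub a b => a.cost + b.cost + 1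
  | mul a b => a.cost + b.cost + 1

def RExpr.cost : RExpr → ℕ
  | const _ => 1
  | cell _ i => i.cost + 1
  | cast e => e.cost + 1
  | add a b => a.cost + b.cost + 1
  | sub a b => a.cost + b.cost + 1
  | mul a b => a.cost + b.cost + 1
  | div a b => a.cost + b.cost + 1

def Test.cost : Test → ℕ
  | ilt a b => a.cost + b.cost + 1
  | rlt a b => a.cost + b.cost + 1
  | neg t => t.cost + 1

/-- Assignment to an index register. -/
def State.setI (s : State) (r k : ℕ) : State :=
  { s with idx := Function.update s.idx r k }

/-- Assignment to an array cell. -/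
def State.setR (s : State) (a i : ℕ) (x : ℝ) : State :=
  { s with mem := Function.update s.mem a (Function.update (s.mem a) i x) }

/-- `Exec p s t s'`: started in state `s`, the program `p` halts after exactly `t` elementary
steps, in state `s'`. -/
inductive Exec : Prog → State → ℕ → State → Prop
  | skip (s : State) : Exec .skip s 1 s
  | setI (s : State) (r : ℕ) (e : IExpr) :
      Exec (.setI r e) s (e.cost + 1) (s.setI r (e.eval s))
  | setR (s : State) (a : ℕ) (i : IExpr) (e : RExpr) :
      Exec (.setR a i e) s (i.cost + e.cost + 1) (s.setR a (i.eval s) (e.eval s))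
  | seq {p q : Prog} {s s' s'' : State} {t t' : ℕ} (h : Exec p s t s') (h' : Exec q s' t' s'') :
      Exec (.seq p q) s (t + t') s''
  | condTrue {b : Test} {p q : Prog} {s s' : State} {t : ℕ} (hb : b.Holds s)
      (h : Exec p s t s') : Exec (.cond b p q) s (b.cost + t) s'
  | condFalse {b : Test} {p q : Prog} {s s' : State} {t : ℕ} (hb : ¬ b.Holds s)
      (h : Exec q s t s') : Exec (.cond b p q) s (b.cost + t) s'
  | loopTrue {b : Test} {p : Prog} {s s' s'' : State} {t t' : ℕ} (hb : b.Holds s)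
      (h : Exec p s t s') (h' : Exec (.loop b p) s' t' s'') :
      Exec (.loop b p) s (b.cost + t + t') s''
  | loopFalse {b : Test} {p : Prog} {s : State} (hb : ¬ b.Holds s) :
      Exec (.loop b p) s b.cost s

/-- Execution is deterministic. -/
theorem Exec.det {p : Prog} {s s₁ s₂ : State} {t₁ t₂ : ℕ} (h₁ : Exec p s t₁ s₁)
    (h₂ : Exec p s t₂ s₂) : t₁ = t₂ ∧ s₁ = s₂ := by
  induction h₁ generalizing t₂ s₂ with
  | skip | setI | setR => cases h₂; exact ⟨rfl, rfl⟩
  | seq _ _ ih ih' =>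
    cases h₂ with
    | seq k k' =>
      obtain ⟨rfl, rfl⟩ := ih k
      obtain ⟨rfl, rfl⟩ := ih' k'
      exact ⟨rfl, rfl⟩
  | condTrue hb _ ih =>
    cases h₂ with
    | condTrue _ k => obtain ⟨rfl, rfl⟩ := ih k; exact ⟨rfl, rfl⟩
    | condFalse hb' _ => exact absurd hb hb'
  | condFalse hb _ ih =>
    cases h₂ with
    | condTrue hb' _ => exact absurd hb' hb
    | condFalse _ k => obtain ⟨rfl, rfl⟩ := ih k; exact ⟨rfl, rfl⟩
  | loopTrue hb _ _ ih ih' =>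
    cases h₂ with
    | loopTrue _ k k' =>
      obtain ⟨rfl, rfl⟩ := ih k
      obtain ⟨rfl, rfl⟩ := ih' k'
      exact ⟨rfl, rfl⟩
    | loopFalse hb' => exact absurd hb hb'
  | loopFalse hb =>
    cases h₂ with
    | loopTrue hb' _ _ => exact absurd hb' hb
    | loopFalse _ => exact ⟨rfl, rfl⟩

/-- The initial state on a labeled sample: registers 0 and 1 hold the dimension `n` and the
sample size `m`, array 0 holds the noise rate in cell 0, array 1 holds the coordinates of the
points (coordinate `j` of point `i` in cell `n * i + j`), and array 2 holds the labels.
Everything else is `0`. -/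
noncomputable def input {n m : ℕ} (ε : ℝ) (S : Fin m → Example n) : State where
  idx r := if r = 0 then n else if r = 1 then m else 0
  mem a k :=
    if a = 0 then (if k = 0 then ε else 0)
    else if a = 1 then
      (if h : k < m * n then
        (S (finProdFinEquiv.symm ⟨k, h⟩).1).1 (finProdFinEquiv.symm ⟨k, h⟩).2 else 0)
    else if a = 2 then (if h : k < m then (((S ⟨k, h⟩).2 : ℤ) : ℝ) else 0)
    else 0

/-- The hypothesis written in a final state: its vector in array 3 and its threshold in cell 0 of
array 4. -/
noncomputable def output (n : ℕ) (s : State) : LTF n where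
  v := WithLp.toLp 2 fun j => s.mem 3 j
  θ := s.mem 4 0

/-- On noise rate `ε` and labeled sample `S`, the program `p` halts after exactly `t` steps with
hypothesis `h`. -/
def Returns (p : Prog) {n m : ℕ} (ε : ℝ) (S : Fin m → Example n) (t : ℕ) (h : LTF n) : Prop :=
  ∃ s : State, Exec p (input ε S) t s ∧ output n s = h

end RealRAM

/-- The sample size `⌈a (n / ε) ^ k⌉`. -/
noncomputable def sampleSize (a k n : ℕ) (ε : ℝ) : ℕ := ⌈(a : ℝ) * (n / ε) ^ k⌉₊

/-! Write φ and Φ for the density and the distribution function of N(0,1). For an LTF with unit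
normal v and threshold θ, that is f(x) = 1 iff ⟨v,x⟩ ≥ θ, the degree-one Chow vector E[f(x)x] equals
2φ(θ)v (`LTF.chow_eq`), and p = Pr[f = -1] equals Φ(θ). It is therefore enough to estimate the Chow
vector up to δ = O(ε√log(1/ε)) and p up to O(ε) from the corrupted sample.

Estimating the Chow vector. Corrupted points can spoil a mean of y·x only if they create a direction
of large second moment. The learner keeps weights on the points and tests whether the weighted
moment matrix A has an eigenvalue well above m. It needs no eigenvectors: it compares tr A^(2K+1)
with tr A^(2K) for K = m. If the first is at most (1+η)m times the second, every eigenvalue is at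
most (1+2η)m (`le_of_sum_pow_succ_le`). Otherwise the scores ‖A^K x_i‖², cut off at 6L‖A^K‖²
(Frobenius norm) with L about log₂(1/ε), put more weighted mass on corrupted than on clean points
(`sum_mul_trunc_lt`). Reducing the weights in proportion to these truncated scores thus removes more
bad than good weight, and it kills at least one point, so m rounds suffice (`FilterReach.good`).
With a small moment matrix and at most 2εm of clean mass lost, Cauchy-Schwarz bounds the error of
the weighted mean by O(ε√L) (`abs_sum_sub_sum_le`).

Estimating the threshold. The machine cannot evaluate the inverse of Φ, but the first coordinates of
the clean points are samples of N(0,1). The empirical quantile τ of the first coordinate, taken at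
the frequency of the label -1, satisfies |Φ(τ) - p| ≤ 4ε (`IsQuantile.abs_normalCDF_sub_le`). The
norm of the estimated vector comes from Newton's iteration, which approaches the square root from
above.

From the estimates to the error. Normalizing a Chow vector of length 2φ(θ) known up to δ gives a
direction up to ρ = O(δ/φ(θ)), but tilting a halfspace at distance |θ| from the origin by ρ changes
it only on a set of measure O(φ(θ)ρ) (`gauss_tilted_halfspaces`), so the factor φ(θ) cancels. If
φ(θ) is too small for this, then f is nearly constant; so is the hypothesis, because an
overestimated norm only moves its threshold further from 0 (`LTF.err_le`).

All that is used of the clean points is a list of moment, tail and frequency estimates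
(`CleanSample`), which hold with probability at least 9/10 by Chebyshev's inequality and by a
Chernoff bound over a grid of directions. They do not involve the adversary, so his choice may
depend on the whole sample. -/

namespace RealRAM

/-! ### A program logic for the real RAM -/

/-- `p` does not assign to index register `r`. -/
def Prog.keepsI (r : ℕ) : Prog → Bool
  | .skip => true
  | .setI r' _ => r != r'
  | .setR _ _ _ => true
  | .seq p q => p.keepsI r && q.keepsI r
  | .cond _ p q => p.keepsI r && q.keepsI r
  | .loop _ p => p.keepsI r

/-- `p` does not assign to array `a`. -/
def Prog.keepsR (a : ℕ) : Prog → Bool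
  | .skip => true
  | .setI _ _ => true
  | .setR a' _ _ => a != a'
  | .seq p q => p.keepsR a && q.keepsR a
  | .cond _ p q => p.keepsR a && q.keepsR a
  | .loop _ p => p.keepsR a

/-- The states `s` and `s'` agree on everything to which `p` does not assign. -/
def Frame (p : Prog) (s s' : State) : Prop :=
  (∀ r, p.keepsI r = true → s'.idx r = s.idx r) ∧ ∀ a, p.keepsR a = true → s'.mem a = s.mem a

/-- The set of written registers and arrays is syntactic and computable, so for concrete programs
every later "this is untouched" is proved by `rfl`. -/
theorem Exec.frame {p : Prog} {s s' : State} {t : ℕ} (h : Exec p s t s') : Frame p s s' := by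
  induction h with
  | skip => exact ⟨fun _ _ => rfl, fun _ _ => rfl⟩
  | setI s r e =>
    refine ⟨fun q hq => ?_, fun _ _ => rfl⟩
    simp only [Prog.keepsI, bne_iff_ne] at hq
    simp [State.setI, hq]
  | setR s a i e =>
    refine ⟨fun _ _ => rfl, fun q hq => ?_⟩
    simp only [Prog.keepsR, bne_iff_ne] at hq
    simp [State.setR, hq]
  | seq _ _ ih ih' =>
    refine ⟨fun q hq => ?_, fun q hq => ?_⟩
    · simp only [Prog.keepsI, Bool.and_eq_true] at hq
      rw [ih'.1 q hq.2, ih.1 q hq.1]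
    · simp only [Prog.keepsR, Bool.and_eq_true] at hq
      rw [ih'.2 q hq.2, ih.2 q hq.1]
  | condTrue _ _ ih =>
    refine ⟨fun q hq => ?_, fun q hq => ?_⟩
    · simp only [Prog.keepsI, Bool.and_eq_true] at hq
      exact ih.1 q hq.1
    · simp only [Prog.keepsR, Bool.and_eq_true] at hq
      exact ih.2 q hq.1
  | condFalse _ _ ih =>
    refine ⟨fun q hq => ?_, fun q hq => ?_⟩
    · simp only [Prog.keepsI, Bool.and_eq_true] at hq
      exact ih.1 q hq.2
    · simp only [Prog.keepsR, Bool.and_eq_true] at hq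
      exact ih.2 q hq.2
  | loopTrue _ _ _ ih ih' =>
    refine ⟨fun q hq => ?_, fun q hq => ?_⟩
    · rw [ih'.1 q hq, ih.1 q hq]
    · rw [ih'.2 q hq, ih.2 q hq]
  | loopFalse => exact ⟨fun _ _ => rfl, fun _ _ => rfl⟩

/-- Started in `s`, the program `p` halts within `c * N ^ d` steps in a state with property `Q`. -/
def Runs (N c d : ℕ) (p : Prog) (s : State) (Q : State → Prop) : Prop :=
  ∃ t ≤ c * N ^ d, ∃ s', Exec p s t s' ∧ Q s'

section rules

variable {N c c' d d' : ℕ} {p q : Prog} {s : State} {Q Q' : State → Prop}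

/-- The frame is handed to the continuation for free, so specifications need only mention what a
program changes. -/
theorem Runs.conseq (h : Runs N c d p s Q) (hQ : ∀ s', Frame p s s' → Q s' → Q' s') :
    Runs N c d p s Q' := by
  obtain ⟨t, ht, s', he, hq⟩ := h
  exact ⟨t, ht, s', he, hQ s' he.frame hq⟩

theorem Runs.mono (h : Runs N c d p s Q) (hN : 1 ≤ N) (hc : c ≤ c') (hd : d ≤ d') :
    Runs N c' d' p s Q := by
  obtain ⟨t, ht, s', he, hq⟩ := h
  exact ⟨t, ht.trans (Nat.mul_le_mul hc (Nat.pow_le_pow_right hN hd)), s', he, hq⟩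

theorem Runs.skip (hN : 1 ≤ N) (h : Q s) : Runs N 1 d .skip s Q :=
  ⟨1, by simpa using Nat.one_le_pow d N hN, s, .skip s, h⟩

theorem Runs.setR {a : ℕ} {i : IExpr} {e : RExpr} (hN : 1 ≤ N)
    (h : Q (s.setR a (i.eval s) (e.eval s))) :
    Runs N (i.cost + e.cost + 1) d (.setR a i e) s Q :=
  ⟨_, Nat.le_mul_of_pos_right _ (Nat.one_le_pow d N hN), _, .setR s a i e, h⟩

theorem Runs.seq (h : Runs N c d p s fun s' => Runs N c' d q s' Q) :
    Runs N (c + c') d (.seq p q) s Q := by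
  obtain ⟨t, ht, s', he, t', ht', s'', he', hq⟩ := h
  exact ⟨t + t', by rw [add_mul]; exact add_le_add ht ht', s'', .seq he he', hq⟩

theorem Runs.cond {b : Test} (hN : 1 ≤ N) (h : b.Holds s → Runs N c d p s Q)
    (h' : ¬ b.Holds s → Runs N c d q s Q) : Runs N (b.cost + c) d (.cond b p q) s Q := by
  have h1 : b.cost ≤ b.cost * N ^ d := Nat.le_mul_of_pos_right _ (Nat.one_le_pow d N hN)
  by_cases hb : b.Holds s
  · obtain ⟨t, ht, s', he, hq⟩ := h hb
    exact ⟨b.cost + t, by rw [add_mul]; exact add_le_add h1 ht, s', .condTrue hb he, hq⟩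
  · obtain ⟨t, ht, s', he, hq⟩ := h' hb
    exact ⟨b.cost + t, by rw [add_mul]; exact add_le_add h1 ht, s', .condFalse hb he, hq⟩

/-- `for r in 0, …, b - 1 do p`, where `b` is an index register. -/
def forP (r b : ℕ) (p : Prog) : Prog :=
  .seq (.setI r (.const 0))
    (.loop (.ilt (.reg r) (.reg b)) (.seq p (.setI r (.add (.reg r) (.const 1)))))

/-- The invariant rule for loops. The frame in `hstep` is relative to the state before the whole
loop, so invariants need not repeat what the loop leaves alone. Each nesting level costs one power
of `N`. -/
theorem Runs.forP {r b M : ℕ} (Inv : ℕ → State → Prop) (hN : 1 ≤ N) (hr : p.keepsI r = true)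
    (hb : p.keepsI b = true) (hrb : r ≠ b) (hM : s.idx b = M) (hMN : M ≤ N)
    (h0 : Inv 0 (s.setI r 0))
    (hstep : ∀ k < M, ∀ s1, Frame (forP r b p) s s1 → s1.idx r = k → Inv k s1 →
      Runs N c d p s1 fun s2 => Inv (k + 1) (s2.setI r (k + 1))) :
    Runs N (c + 12) (d + 1) (forP r b p) s (Inv M) := by
  -- Induction on the number `j` of remaining rounds. A round costs 3 for the test and 4 for the
  -- increment besides its body; the last 3 is the failing test.
  have key : ∀ j k, k + j = M → ∀ s1, Frame (RealRAM.forP r b p) s s1 → s1.idx r = k →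
      s1.idx b = M → Inv k s1 →
      ∃ t ≤ j * (c * N ^ d + 7) + 3, ∃ s', Exec (.loop (.ilt (.reg r) (.reg b))
        (.seq p (.setI r (.add (.reg r) (.const 1))))) s1 t s' ∧ Inv M s' := by
    intro j
    induction j with
    | zero =>
      intro k hk s1 _ hs1 hs1b hI
      refine ⟨3, by simp, s1, .loopFalse ?_, by rwa [← hk]⟩
      simp only [Test.Holds, IExpr.eval, hs1, hs1b]
      omega
    | succ j ih =>
      intro k hk s1 hf hs1 hs1b hI
      obtain ⟨t, ht, s2, he, hI'⟩ := hstep k (by omega) s1 hf hs1 hI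
      have hf2 := he.frame
      have hr2 : s2.idx r = k := by rw [hf2.1 r hr, hs1]
      have hb2 : s2.idx b = M := by rw [hf2.1 b hb, hs1b]
      have hf3 : Frame (RealRAM.forP r b p) s (s2.setI r (k + 1)) := by
        refine ⟨fun q hq => ?_, fun q hq => ?_⟩
        · have hq' := hq
          simp only [RealRAM.forP, Prog.keepsI, Bool.and_eq_true, bne_iff_ne] at hq'
          simp only [State.setI, Function.update_of_ne hq'.1]
          rw [hf2.1 q hq'.2.1, hf.1 q hq]
        · have hq' := hq
          simp only [RealRAM.forP, Prog.keepsR, Bool.true_and, Bool.and_true] at hq'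
          simp only [State.setI]
          rw [hf2.2 q hq', hf.2 q hq]
      obtain ⟨t', ht', s3, he', hI''⟩ := ih (k + 1) (by omega) (s2.setI r (k + 1)) hf3 (by
        simp [State.setI]) (by simp [State.setI, hrb.symm, hb2]) hI'
      have hset := Exec.setI s2 r (.add (.reg r) (.const 1))
      simp only [IExpr.eval, hr2, IExpr.cost] at hset
      refine ⟨3 + (t + 4) + t', ?_, s3, .loopTrue ?_ (he.seq hset) he', hI''⟩
      · rw [Nat.succ_mul]; omega
      · simp only [Test.Holds, IExpr.eval, hs1, hs1b]
        omega
  obtain ⟨t, ht, s', he, hI⟩ := key M 0 (by simp) (s.setI r 0) (by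
    refine ⟨fun q hq => ?_, fun q hq => rfl⟩
    simp only [RealRAM.forP, Prog.keepsI, Bool.and_eq_true, bne_iff_ne] at hq
    simp [State.setI, hq.1]) (by simp [State.setI]) (by simp [State.setI, hrb.symm, hM]) h0
  refine ⟨2 + t, ?_, s', .seq (.setI s r (.const 0)) he, hI⟩
  have h1 : 1 ≤ N ^ d := Nat.one_le_pow _ _ hN
  calc 2 + t ≤ M * (c * N ^ d + 7) + 5 := by omega
    _ ≤ N * (c * N ^ d + 7 * N ^ d) + 5 * (N * N ^ d) := by
        refine add_le_add (Nat.mul_le_mul hMN (by omega)) ?_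
        nlinarith
    _ = (c + 12) * N ^ (d + 1) := by ring

/-- `a[i] := ∑ r < b, e`. -/
def sumP (a : ℕ) (i : IExpr) (r b : ℕ) (e : RExpr) : Prog :=
  .seq (.setR a i (.const 0)) (forP r b (.setR a i (.add (.cell a i) e)))

/-- The accumulator is the cell itself, so `he` asks that the summand have the right value whatever
array `a` contains. -/
theorem Runs.sumP {a : ℕ} {i : IExpr} {r b M i0 : ℕ} {e : RExpr} (f : Fin M → ℝ) (hN : 1 ≤ N)
    (hrb : r ≠ b) (hM : s.idx b = M) (hMN : M ≤ N)
    (hi : ∀ s1 : State, (∀ q, q ≠ r → s1.idx q = s.idx q) → i.eval s1 = i0)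
    (he : ∀ (k : Fin M) (s1 : State), s1.idx r = k → (∀ q, q ≠ r → s1.idx q = s.idx q) →
      (∀ a', a' ≠ a → s1.mem a' = s.mem a') → e.eval s1 = f k) :
    Runs N (3 * i.cost + e.cost + 17) 1 (sumP a i r b e) s fun s' =>
      s'.mem a i0 = ∑ k, f k ∧ ∀ j, j ≠ i0 → s'.mem a j = s.mem a j := by
  have h1 : Runs N (i.cost + (RExpr.const 0).cost + 1) 1 (.setR a i (.const 0)) s
      fun s1 => Runs N ((i.cost + (RExpr.add (.cell a i) e).cost + 1) + 12) (0 + 1)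
        (RealRAM.forP r b (.setR a i (.add (.cell a i) e))) s1
        fun s' => (s'.mem a i0 = ∑ k, f k ∧ ∀ j, j ≠ i0 → s'.mem a j = s.mem a j) := by
    refine Runs.setR hN ?_
    refine (Runs.forP (M := M) (fun k s1 =>
      (s1.mem a i0 = ∑ j ∈ Finset.range k, (if h : j < M then f ⟨j, h⟩ else 0)) ∧
      ∀ j, j ≠ i0 → s1.mem a j = s.mem a j) hN rfl rfl hrb (by simpa [State.setR] using hM) hMN
      ?_ ?_).conseq ?_
    · rw [hi s fun _ _ => rfl]
      simp only [State.setR, State.setI, RExpr.eval]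
      refine ⟨by simp, fun j hj => by simp [hj]⟩
    · intro k hk s1 hf hs1 hI
      refine Runs.setR hN ?_
      have hidx : ∀ q, q ≠ r → s1.idx q = s.idx q := by
        intro q hq
        have := hf.1 q (by simp [RealRAM.forP, Prog.keepsI, hq])
        simpa [State.setR] using this
      have hmem : ∀ a', a' ≠ a → s1.mem a' = s.mem a' := by
        intro q hq
        have := hf.2 q (by simp [RealRAM.forP, Prog.keepsR, hq])
        simpa [State.setR, hq] using this
      simp only [RExpr.eval, hi s1 hidx, he ⟨k, hk⟩ s1 hs1 hidx hmem]
      simp only [State.setR, State.setI]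
      refine ⟨?_, fun j hj => ?_⟩
      · simp [Finset.sum_range_succ, hI.1, hk]
      · simp [hj, hI.2 j hj]
    · rintro s' - ⟨h1, h2⟩
      refine ⟨?_, h2⟩
      rw [h1, Finset.sum_range]
      exact Finset.sum_congr rfl fun k _ => by simp
  refine h1.seq.mono hN ?_ le_rfl
  simp only [RExpr.cost]
  omega

/-- `for r < b do a[r] := e`. -/
def mapP (a r b : ℕ) (e : RExpr) : Prog := forP r b (.setR a (.reg r) e)

/-- In contrast to sums, `e` may read the old content of the cell that is being overwritten; this
allows updates in place, such as that of the weights. -/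
theorem Runs.mapP {a r b M : ℕ} {e : RExpr} (f : Fin M → ℝ) (hN : 1 ≤ N)
    (hrb : r ≠ b) (hM : s.idx b = M) (hMN : M ≤ N)
    (he : ∀ (k : Fin M) (s1 : State), s1.idx r = k → (∀ q, q ≠ r → s1.idx q = s.idx q) →
      (∀ a', a' ≠ a → s1.mem a' = s.mem a') → s1.mem a k = s.mem a k → e.eval s1 = f k) :
    Runs N (e.cost + 14) 1 (mapP a r b e) s fun s' => ∀ k : Fin M, s'.mem a k = f k := by
  refine Runs.mono (c := (IExpr.cost (.reg r) + e.cost + 1) + 12) (d := 0 + 1) ?_ hN (by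
    simp only [IExpr.cost]; omega) le_rfl
  refine (Runs.forP (M := M) (fun k s1 => (∀ j : Fin M, (j : ℕ) < k → s1.mem a j = f j) ∧
    ∀ j : Fin M, k ≤ (j : ℕ) → s1.mem a j = s.mem a j) hN rfl rfl hrb hM hMN ?_ ?_).conseq ?_
  · exact ⟨fun j hj => absurd hj (by omega), fun j _ => rfl⟩
  · intro k hk s1 hf hs1 hI
    refine Runs.setR hN ?_
    have hidx : ∀ q, q ≠ r → s1.idx q = s.idx q := fun q hq =>
      hf.1 q (by simp [RealRAM.forP, Prog.keepsI, hq])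
    have hmem : ∀ a', a' ≠ a → s1.mem a' = s.mem a' := fun q hq =>
      hf.2 q (by simp [RealRAM.forP, Prog.keepsR, hq])
    rw [he ⟨k, hk⟩ s1 hs1 hidx hmem (hI.2 ⟨k, hk⟩ le_rfl)]
    simp only [State.setR, State.setI, IExpr.eval, hs1]
    refine ⟨fun j hj => ?_, fun j hj => ?_⟩
    · by_cases hjk : (j : ℕ) = k
      · have : j = ⟨k, hk⟩ := Fin.ext hjk
        subst this
        simp
      · simp [hjk, hI.1 j (by omega)]
    · have : (j : ℕ) ≠ k := by omega
      simp [this, hI.2 j (by omega)]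
  · rintro s' - h j
    exact h.1 j j.2

/-- `for r < b do a[r] := ∑ r' < b', e`. -/
def tabP (a r b r' b' : ℕ) (e : RExpr) : Prog := forP r b (sumP a (.reg r) r' b' e)

theorem Runs.tabP {a r b r' b' M M' : ℕ} {e : RExpr} (f : Fin M → Fin M' → ℝ) (hN : 1 ≤ N)
    (hrb : r ≠ b) (hrb' : r ≠ b') (hr'b : r' ≠ b) (hr'b' : r' ≠ b') (hrr' : r ≠ r')
    (hM : s.idx b = M) (hMN : M ≤ N) (hM' : s.idx b' = M') (hMN' : M' ≤ N)
    (he : ∀ (i : Fin M) (k : Fin M') (s1 : State), s1.idx r = i → s1.idx r' = k →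
      (∀ q, q ≠ r → q ≠ r' → s1.idx q = s.idx q) →
      (∀ a', a' ≠ a → s1.mem a' = s.mem a') → e.eval s1 = f i k) :
    Runs N (e.cost + 32) 2 (tabP a r b r' b' e) s
      fun s' => ∀ i : Fin M, s'.mem a i = ∑ k, f i k := by
  refine Runs.mono (c := (3 * IExpr.cost (.reg r) + e.cost + 17) + 12) (d := 1 + 1) ?_ hN (by
    simp only [IExpr.cost]; omega) le_rfl
  refine (Runs.forP (M := M) (fun k s1 => ∀ j : Fin M, (j : ℕ) < k → s1.mem a j = ∑ l, f j l)
    hN (by simp [RealRAM.sumP, RealRAM.forP, Prog.keepsI, hrr'])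
    (by simp [RealRAM.sumP, RealRAM.forP, Prog.keepsI, hr'b.symm]) hrb hM hMN ?_ ?_).conseq ?_
  · exact fun j hj => absurd hj (by omega)
  · intro k hk s1 hf hs1 hI
    have hidx : ∀ q, q ≠ r → q ≠ r' → s1.idx q = s.idx q := fun q hq hq' =>
      hf.1 q (by simp [RealRAM.forP, RealRAM.sumP, Prog.keepsI, hq, hq'])
    have hmem : ∀ a', a' ≠ a → s1.mem a' = s.mem a' := fun q hq =>
      hf.2 q (by simp [RealRAM.forP, RealRAM.sumP, Prog.keepsR, hq])
    refine (Runs.sumP (i0 := k) (f ⟨k, hk⟩) hN hr'b' (by rw [hidx _ hrb'.symm hr'b'.symm, hM'])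
      hMN' (fun s2 h2 => by simp [IExpr.eval, h2 r hrr', hs1])
      (fun l s2 h2 h3 h4 => he ⟨k, hk⟩ l s2 (by rw [h3 r hrr', hs1]) h2
        (fun q hq hq' => by rw [h3 q hq', hidx q hq hq'])
        (fun q hq => by rw [h4 q hq, hmem q hq]))).conseq ?_
    rintro s2 - ⟨h1, h2⟩ j hj
    simp only [State.setI]
    by_cases hjk : (j : ℕ) = k
    · have : j = ⟨k, hk⟩ := Fin.ext hjk
      subst this
      exact h1
    · rw [h2 _ hjk, hI j (by omega)]
  · rintro s' - h j
    exact h j j.2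

end rules

end RealRAM

/-! ### The filter -/

/-- The step of the loop that accumulates the scores column by column. -/
theorem sum_ite_lt_succ {n k : ℕ} (F : Fin n → ℝ) (hk : k < n) :
    (∑ j : Fin n, if (j : ℕ) < k + 1 then F j else 0) =
      (∑ j : Fin n, if (j : ℕ) < k then F j else 0) + F ⟨k, hk⟩ := by
  have h : F ⟨k, hk⟩ = ∑ j : Fin n, if j = ⟨k, hk⟩ then F j else 0 := by simp
  rw [h, ← Finset.sum_add_distrib]
  refine Finset.sum_congr rfl fun j _ => ?_
  rcases lt_trichotomy (j : ℕ) k with h1 | h1 | h1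
  · simp [h1, h1.trans (Nat.lt_succ_self k), Fin.ext_iff, h1.ne]
  · simp [h1, Fin.ext_iff]
  · simp [Fin.ext_iff, h1.ne', show ¬ (j : ℕ) < k + 1 by omega, h1.not_gt]

section filter

variable {n m : ℕ}

/-- The product of the matrix `∑ i, w i • x i (x i)ᵀ` with the vector `v`. -/
def momentApply (x : Fin m → Pt n) (w : Fin m → ℝ) (v : Fin n → ℝ) : Fin n → ℝ :=
  fun l => ∑ i, w i * (∑ l', x i l' * v l') * x i l

/-- Column `j` of the `K`-th power of `∑ i, w i • x i (x i)ᵀ`. -/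
def powerColumn (x : Fin m → Pt n) (w : Fin m → ℝ) (K : ℕ) (j : Fin n) : Fin n → ℝ :=
  (momentApply x w)^[K] (Pi.single j 1)

/-- The score of point `i`: its squared image under the `K`-th power of the moment matrix. -/
def score (x : Fin m → Pt n) (w : Fin m → ℝ) (K : ℕ) (i : Fin m) : ℝ :=
  ∑ j, (∑ l, x i l * powerColumn x w K j l) * (∑ l, x i l * powerColumn x w K j l)

/-- The squared Frobenius norm of the `K`-th power of the moment matrix. -/
def powerNormSq (x : Fin m → Pt n) (w : Fin m → ℝ) (K : ℕ) : ℝ :=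
  ∑ j, ∑ l, powerColumn x w K j l * powerColumn x w K j l

/-- The scores show that the moment matrix is too large. -/
def Violated (x : Fin m → Pt n) (K : ℕ) (η : ℝ) (w : Fin m → ℝ) : Prop :=
  (1 + η) * m * powerNormSq x w K < ∑ i, w i * score x w K i

/-- One round of the filter leads from the weights `w` to the weights `w'`. -/
def FilterStep (x : Fin m → Pt n) (K : ℕ) (T η : ℝ) (w w' : Fin m → ℝ) : Prop :=
  (¬ Violated x K η w → w' = w) ∧
  (Violated x K η w → ∃ M : ℝ,
    (∀ i, 0 < w i → max (score x w K i - T * powerNormSq x w K) 0 ≤ M) ∧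
    (M = 0 ∨ ∃ i, 0 < w i ∧ max (score x w K i - T * powerNormSq x w K) 0 = M) ∧
    ∀ i, w' i = w i - w i * max (score x w K i - T * powerNormSq x w K) 0 / M)

/-- The weights `w` are the result of the first `k` rounds of the filter. -/
def FilterReach (x : Fin m → Pt n) (K : ℕ) (T η : ℝ) : ℕ → (Fin m → ℝ) → Prop
  | 0, w => w = fun _ => 1
  | k + 1, w => ∃ w₀, FilterReach x K T η k w₀ ∧ FilterStep x K T η w₀ w

end filter

/-! ### Programs for the moment matrix and the scores. -/

namespace RealRAM

/-- The state `s` contains the input. -/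
structure Ctx {n m : ℕ} (ε : ℝ) (S : Fin m → Example n) (s : State) : Prop where
  hn : s.idx 0 = n
  hm : s.idx 1 = m
  he : s.mem 0 0 = ε
  hx : ∀ (i : Fin m) (l : Fin n), s.mem 1 (n * i + l) = (S i).1 l
  hy : ∀ i : Fin m, s.mem 2 i = ((S i).2 : ℤ)

theorem Ctx.frame {n m : ℕ} {ε : ℝ} {S : Fin m → Example n} {s s' : State} {p : Prog}
    (h : Ctx ε S s) (hf : Frame p s s')
    (hp : (p.keepsI 0 && p.keepsI 1 && p.keepsR 0 && p.keepsR 1 && p.keepsR 2) = true) :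
    Ctx ε S s' := by
  simp only [Bool.and_eq_true] at hp
  obtain ⟨⟨⟨⟨h1, h2⟩, h3⟩, h4⟩, h5⟩ := hp
  exact ⟨by rw [hf.1 _ h1, h.hn], by rw [hf.1 _ h2, h.hm], by rw [hf.2 _ h3, h.he],
    fun i l => by rw [hf.2 _ h4, h.hx], fun i => by rw [hf.2 _ h5, h.hy]⟩

/-- Coordinate `l` of point `i`, for the contents `i` and `l` of registers `ri` and `rl`. -/
def pointE (ri rl : ℕ) : RExpr := .cell 1 (.add (.mul (.reg 0) (.reg ri)) (.reg rl))

/-- Entry `r` of array `a`. -/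
def entryE (a r : ℕ) : RExpr := .cell a (.reg r)

/-- Entry `0` of array `a`. -/
def scalarE (a : ℕ) : RExpr := .cell a (.const 0)

/-- Multiplies the vector in array 6 by the moment matrix of the weights in array 5. -/
def momentP : Prog :=
  .seq (tabP 13 5 1 6 0 (.mul (pointE 5 6) (entryE 6 6)))
    (tabP 6 5 0 6 1 (.mul (.mul (entryE 5 6) (entryE 13 6)) (pointE 6 5)))

/-- Computes a column of the power of the moment matrix. -/
def columnP : Prog :=
  .seq (mapP 6 5 0 (.const 0)) (.seq (.setR 6 (.reg 3) (.const 1)) (forP 4 1 momentP))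

/-- Adds the contribution of one column to the scores. -/
def addScoreP : Prog :=
  .seq columnP (.seq (tabP 13 5 1 6 0 (.mul (pointE 5 6) (entryE 6 6)))
    (.seq (mapP 8 5 1 (.add (entryE 8 5) (.mul (entryE 13 5) (entryE 13 5))))
      (sumP 7 (.reg 3) 6 0 (.mul (entryE 6 6) (entryE 6 6)))))

/-- Computes the scores and their sums. -/
def scoreP : Prog :=
  .seq (mapP 8 5 1 (.const 0)) (.seq (forP 3 0 addScoreP)
    (.seq (sumP 12 (.const 0) 5 0 (entryE 7 5))
      (sumP 14 (.const 0) 5 1 (.mul (entryE 5 5) (entryE 8 5)))))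

section

variable {n m N : ℕ} {ε : ℝ} {S : Fin m → Example n} {s : State} {w : Fin m → ℝ}

/-- The matrix is never formed: one pass stores the inner products of the points with the vector, a
second pass recombines the points with these coefficients. -/
theorem runs_momentP (hN : 1 ≤ N) (hn : n ≤ N) (hm : m ≤ N) (hs : Ctx ε S s)
    (hw : ∀ i : Fin m, s.mem 5 i = w i) {v : Fin n → ℝ} (hv : ∀ l : Fin n, s.mem 6 l = v l) :
    Runs N 100 2 momentP s
      fun s' => ∀ l : Fin n, s'.mem 6 l = momentApply (fun i => (S i).1) w v l := by
  refine Runs.mono (c := (RExpr.cost (.mul (pointE 5 6) (entryE 6 6)) + 32) +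
    (RExpr.cost (.mul (.mul (entryE 5 6) (entryE 13 6)) (pointE 6 5)) + 32)) (d := 2) ?_ hN
    (by decide) le_rfl
  refine Runs.seq ((Runs.tabP (fun (i : Fin m) (l : Fin n) => (S i).1 l * v l) hN (by decide)
    (by decide) (by decide) (by decide) (by decide) hs.hm hm hs.hn hn ?_).conseq ?_)
  · intro i k s1 h1 h2 h3 h4
    simp [RExpr.eval, pointE, entryE, IExpr.eval, h1, h2, h3 0, h4 1, h4 6, hs.hn, hs.hx, hv]
  · intro s1 hf h1
    have hs1 := hs.frame hf rfl
    refine (Runs.tabP (fun (l : Fin n) (i : Fin m) =>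
      w i * (∑ l', (S i).1 l' * v l') * (S i).1 l) hN (by decide)
      (by decide) (by decide) (by decide) (by decide) hs1.hn hn hs1.hm hm ?_)
    intro i k s2 h2 h3 h4 h5
    simp [RExpr.eval, pointE, entryE, IExpr.eval, h1, h2, h3, h4 0, h5 1, h5 5, h5 13, hs1.hn,
      hs1.hx, hf.2 5 rfl, hw]

theorem runs_columnP (hN : 1 ≤ N) (hn : n ≤ N) (hm : m ≤ N) (hs : Ctx ε S s)
    (hw : ∀ i : Fin m, s.mem 5 i = w i) (j : Fin n) (hj : s.idx 3 = j) :
    Runs N 150 3 columnP s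
      fun s' => ∀ l : Fin n, s'.mem 6 l = powerColumn (fun i => (S i).1) w m j l := by
  refine Runs.mono (c := 15 + (3 + (100 + 12))) (d := 3) ?_ hN (by decide) le_rfl
  refine Runs.seq (((Runs.mapP (fun _ => 0) hN (by decide) hs.hn hn ?_).mono hN (by decide)
    (by decide)).conseq ?_)
  · intros
    simp [RExpr.eval]
  · intro s1 hf h1
    have hs1 := hs.frame hf rfl
    refine Runs.seq (Runs.mono (d := 3) (Runs.setR hN ?_) hN (by decide) le_rfl)
    have hf2 : Frame (.setR 6 (.reg 3) (.const 1)) s1 (s1.setR 6 ((IExpr.reg 3).eval s1)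
      ((RExpr.const 1).eval s1)) := (Exec.setR s1 6 (.reg 3) (.const 1)).frame
    have hs2 := hs1.frame hf2 rfl
    refine (Runs.forP (d := 2) (fun k s2 => ∀ l : Fin n, s2.mem 6 l =
      powerColumn (fun i => (S i).1) w k j l) hN rfl rfl (by decide) hs2.hm hm ?_ ?_)
    · intro l
      have h3 : s1.idx 3 = j := by rw [hf.1 3 rfl, hj]
      simp only [State.setI, State.setR, IExpr.eval, RExpr.eval, h3, powerColumn,
        Function.iterate_zero, id]
      by_cases hl : l = j
      · subst hl
        simp
      · simp [hl, h1 l, Fin.val_inj]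
    · intro k hk s2 hf3 hs2k hI
      refine (runs_momentP (w := w) hN hn hm (hs2.frame hf3 rfl) (fun i => ?_) hI).conseq ?_
      · rw [hf3.2 5 rfl, hf2.2 5 rfl, hf.2 5 rfl, hw]
      · intro s3 _ h3 l
        simp only [State.setI]
        rw [h3 l, powerColumn, powerColumn, Function.iterate_succ_apply']

theorem runs_scoreP (hN : 1 ≤ N) (hn : n ≤ N) (hm : m ≤ N) (hs : Ctx ε S s)
    (hw : ∀ i : Fin m, s.mem 5 i = w i) :
    Runs N 500 4 scoreP s
      fun s' => (∀ i : Fin m, s'.mem 8 i = score (fun i => (S i).1) w m i) ∧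
        s'.mem 12 0 = powerNormSq (fun i => (S i).1) w m ∧
        s'.mem 14 0 = ∑ i, w i * score (fun i => (S i).1) w m i := by
  set x : Fin m → Pt n := fun i => (S i).1 with hx
  refine Runs.mono (c := 15 + ((150 + (60 + (40 + 50)) + 12) + (50 + 50))) (d := 4) ?_ hN
    (by decide) le_rfl
  refine Runs.seq (((Runs.mapP (fun _ => 0) hN (by decide) hs.hm hm ?_).mono hN (by decide)
    (by decide)).conseq ?_)
  · intros
    simp [RExpr.eval]
  intro s1 hf h1
  have hs1 := hs.frame hf rfl
  -- Only one column of the power is in memory at a time. Array 8 accumulates the scores over the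
  -- columns, array 7 records the squared norm of each column.
  refine Runs.seq ((Runs.forP (d := 3) (fun k s2 =>
    (∀ i : Fin m, s2.mem 8 i = ∑ j : Fin n, if (j : ℕ) < k then
      (∑ l, x i l * powerColumn x w m j l) * (∑ l, x i l * powerColumn x w m j l) else 0) ∧
    ∀ j : Fin n, (j : ℕ) < k → s2.mem 7 j =
      ∑ l, powerColumn x w m j l * powerColumn x w m j l) hN rfl rfl (by decide) hs1.hn hn
      ?_ ?_).conseq ?_)
  · refine ⟨fun i => ?_, fun j hj => absurd hj (by omega)⟩
    simp [State.setI, h1]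
  · intro k hk s2 hf2 hs2k hI
    have hs2 := hs1.frame hf2 rfl
    refine Runs.seq ((runs_columnP (w := w) hN hn hm hs2 (fun i => ?_) ⟨k, hk⟩ hs2k).conseq ?_)
    · rw [hf2.2 5 rfl, hf.2 5 rfl, hw]
    intro s3 hf3 h3
    have hs3 := hs2.frame hf3 rfl
    refine Runs.seq (c := 60) (c' := 90) (((Runs.tabP (fun (i : Fin m) (l : Fin n) =>
      x i l * powerColumn x w m ⟨k, hk⟩ l) hN (by decide) (by decide) (by decide) (by decide)
      (by decide) hs3.hm hm hs3.hn hn ?_).mono hN (by decide) (by decide)).conseq ?_)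
    · intro i l s4 h4 h5 h6 h7
      simp [RExpr.eval, pointE, entryE, IExpr.eval, h4, h5, h6 0, h7 1, h7 6, hs3.hn, hs3.hx, h3,
        hx]
    intro s4 hf4 h4
    have hs4 := hs3.frame hf4 rfl
    refine Runs.seq (c := 40) (c' := 50) (((Runs.mapP (fun (i : Fin m) =>
      ∑ j : Fin n, if (j : ℕ) < k + 1 then
      (∑ l, x i l * powerColumn x w m j l) * (∑ l, x i l * powerColumn x w m j l) else 0)
      hN (by decide) hs4.hm hm ?_).mono hN (by decide) (by decide)).conseq ?_)
    · intro i s5 h5 h6 h7 h8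
      have h9 : s4.mem 8 i = s2.mem 8 i := by rw [hf4.2 8 rfl, hf3.2 8 rfl]
      simp only [RExpr.eval, entryE, IExpr.eval, h5, h8, h9, hI.1 i, h7 13 (by decide), h4]
      rw [sum_ite_lt_succ _ hk]
    intro s5 hf5 h5
    have hs5 := hs4.frame hf5 rfl
    refine (((Runs.sumP (i0 := k) (fun l =>
      powerColumn x w m ⟨k, hk⟩ l * powerColumn x w m ⟨k, hk⟩ l) hN (by decide) hs5.hn hn ?_
      ?_).mono hN (by decide) (by decide)).conseq ?_)
    · intro s6 h6
      simp [IExpr.eval, h6 3, hf5.1 3 rfl, hf4.1 3 rfl, hf3.1 3 rfl, hs2k]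
    · intro l s6 h6 h7 h8
      simp [RExpr.eval, entryE, IExpr.eval, h6, h8 6, hf5.2 6 rfl, hf4.2 6 rfl, h3, hx]
    · intro s6 hf6 h6
      simp only [State.setI]
      refine ⟨fun i => by rw [hf6.2 8 rfl, h5 i], fun j hj => ?_⟩
      by_cases hjk : (j : ℕ) = k
      · have : j = ⟨k, hk⟩ := Fin.ext hjk
        subst this
        exact h6.1
      · rw [h6.2 j hjk, hf5.2 7 rfl, hf4.2 7 rfl, hf3.2 7 rfl]
        exact hI.2 j (by omega)
  · rintro s2 hf2 ⟨h2, h2'⟩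
    have hs2 := hs1.frame hf2 rfl
    have h8 : ∀ i : Fin m, s2.mem 8 i = score x w m i := fun i => by rw [h2 i]; simp [score]
    refine Runs.seq (c := 50) (c' := 50) (((Runs.sumP (i0 := 0) (fun j : Fin n =>
      ∑ l, powerColumn x w m j l * powerColumn x w m j l) hN (by decide) hs2.hn hn ?_
      ?_).mono hN (by decide) (by decide)).conseq ?_)
    · intros; rfl
    · intro j s3 h3 h4 h5
      simp [RExpr.eval, entryE, IExpr.eval, h3, h5 7, h2']
    intro s3 hf3 h3
    have hs3 := hs2.frame hf3 rfl
    refine (((Runs.sumP (i0 := 0) (fun i : Fin m => w i * score x w m i) hN (by decide) hs3.hm hm ?_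
      ?_).mono hN (by decide) (by decide)).conseq ?_)
    · intros; rfl
    · intro j s4 h4 h5 h6
      simp [RExpr.eval, entryE, IExpr.eval, h4, h6 5, h6 8, hf3.2 5 rfl, hf2.2 5 rfl, hf.2 5 rfl,
        hw, hf3.2 8 rfl, h8]
    · intro s4 hf4 h4
      exact ⟨fun i => by rw [hf4.2 8 rfl, hf3.2 8 rfl, h8], by rw [hf4.2 12 rfl, h3.1]; rfl, h4.1⟩

end

end RealRAM

/-! ### The complete learning program, the form of its output and its running time. -/

/-- `k` Newton steps for the square root of `q`, started at `1 + q`. -/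
noncomputable def newtonSqrt (q : ℝ) (k : ℕ) : ℝ := (fun s => (s + q / s) / 2)^[k] (1 + q)

open Classical in
/-- The first coordinate of point `i` is an empirical quantile at the frequency of the negative
labels. -/
def IsQuantile {n m : ℕ} [NeZero n] (S : Fin m → Example n) (i : Fin m) : Prop :=
  ((Finset.univ.filter fun k => (S k).1 0 < (S i).1 0).card : ℝ) ≤
      (∑ k, (1 - (((S k).2 : ℤ) : ℝ)) / 2) ∧
    (∑ k, (1 - (((S k).2 : ℤ) : ℝ)) / 2) ≤
      (Finset.univ.filter fun k => (S k).1 0 ≤ (S i).1 0).card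

/-- The hypothesis `h` has the form that the learning algorithm produces. -/
def IsLearned {n m : ℕ} [NeZero n] (ε : ℝ) (S : Fin m → Example n) (h : LTF n) : Prop :=
  ∃ (L : ℕ) (w : Fin m → ℝ) (τ : ℝ),
    (L = m ∨ (1 / 2 : ℝ) ^ L ≤ ε) ∧ (∀ k < L, ε < (1 / 2 : ℝ) ^ k) ∧
    FilterReach (fun i => (S i).1) m (6 * L) (24 * L * ε) m w ∧
    (∀ l, h.v l = ∑ i, w i * ((S i).2 : ℤ) * (S i).1 l / m) ∧
    ((∃ i, IsQuantile S i) → ∃ i, IsQuantile S i ∧ τ = (S i).1 0) ∧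
    h.θ = -(newtonSqrt (∑ l, h.v l * h.v l) m * τ)

namespace RealRAM

/-- Cuts the scores off at the threshold, takes them to be nonnegative, and finds the largest score
of a point with positive weight. -/
def truncP : Prog :=
  .seq (mapP 8 5 1 (.sub (entryE 8 5) (.mul (.mul (.const 6) (scalarE 10)) (scalarE 12))))
    (.seq (.setR 15 (.const 0) (.const 0))
      (forP 5 1 (.seq (.cond (.rlt (entryE 8 5) (.const 0)) (.setR 8 (.reg 5) (.const 0)) .skip)
        (.cond (.rlt (.const 0) (entryE 5 5))
          (.cond (.rlt (scalarE 15) (entryE 8 5)) (.setR 15 (.const 0) (entryE 8 5)) .skip)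
          .skip))))

/-- One round of the filter. -/
def roundP : Prog :=
  .seq scoreP (.cond (.rlt (.mul (.mul (.add (.const 1) (.mul (.mul (.const 24) (scalarE 10))
      (scalarE 0))) (.cast (.reg 1))) (scalarE 12)) (scalarE 14))
    (.seq truncP (mapP 5 5 1 (.sub (entryE 5 5)
      (.div (.mul (entryE 5 5) (entryE 8 5)) (scalarE 15))))) .skip)

/-- The filter. -/
def filterP : Prog := .seq (mapP 5 5 1 (.const 1)) (forP 2 1 roundP)

/-- Computes an upper bound for the binary logarithm of the inverse noise rate. -/
def logP : Prog :=
  .seq (.setR 10 (.const 0) (.const 0)) (.seq (.setR 11 (.const 0) (.const 1))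
    (forP 5 1 (.cond (.rlt (scalarE 0) (scalarE 11))
      (.seq (.setR 11 (.const 0) (.div (scalarE 11) (.const 2)))
        (.setR 10 (.const 0) (.add (scalarE 10) (.const 1)))) .skip)))

/-- Computes an approximate square root. -/
def sqrtP : Prog :=
  .seq (sumP 16 (.const 0) 5 0 (.mul (entryE 3 5) (entryE 3 5)))
    (.seq (.setR 17 (.const 0) (.add (.const 1) (scalarE 16)))
      (forP 5 1 (.setR 17 (.const 0)
        (.div (.add (scalarE 17) (.div (scalarE 16) (scalarE 17))) (.const 2)))))

/-- Counts the `r` below the contents of register `b` that pass the test `t`. -/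
def countP (a r b : ℕ) (t : Test) : Prog :=
  .seq (.setR a (.const 0) (.const 0))
    (forP r b (.cond t (.setR a (.const 0) (.add (scalarE a) (.const 1))) .skip))

/-- The first coordinate of the point whose index is in register `r`. -/
def firstE (r : ℕ) : RExpr := .cell 1 (.mul (.reg 0) (.reg r))

/-- Finds an empirical quantile of the first coordinate. -/
def quantileP : Prog :=
  .seq (sumP 18 (.const 0) 5 1 (.div (.sub (.const 1) (entryE 2 5)) (.const 2)))
    (forP 5 1 (.seq (countP 19 6 1 (.rlt (firstE 6) (firstE 5)))
      (.seq (countP 20 6 1 (.neg (.rlt (firstE 5) (firstE 6))))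
        (.cond (.neg (.rlt (scalarE 18) (scalarE 19)))
          (.cond (.neg (.rlt (scalarE 20) (scalarE 18))) (.setR 21 (.const 0) (firstE 5)) .skip)
          .skip))))

/-- The learning algorithm. -/
def learnP : Prog :=
  .seq logP (.seq filterP
    (.seq (tabP 3 5 0 6 1 (.div (.mul (.mul (entryE 5 6) (entryE 2 6)) (pointE 6 5))
      (.cast (.reg 1))))
    (.seq sqrtP (.seq quantileP
      (.setR 4 (.const 0) (.sub (.const 0) (.mul (scalarE 17) (scalarE 21))))))))

variable {n m N : ℕ} {ε : ℝ} {S : Fin m → Example n} {s : State} {w : Fin m → ℝ}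

theorem runs_truncP (hN : 1 ≤ N) (hm : m ≤ N) (hs : Ctx ε S s)
    (hw : ∀ i : Fin m, s.mem 5 i = w i) {q : Fin m → ℝ} {A L : ℝ}
    (hq : ∀ i : Fin m, s.mem 8 i = q i) (hA : s.mem 12 0 = A) (hL : s.mem 10 0 = L) :
    Runs N 100 1 truncP s fun s' => (∀ i : Fin m, s'.mem 8 i = max (q i - 6 * L * A) 0) ∧
      (∀ i, 0 < w i → max (q i - 6 * L * A) 0 ≤ s'.mem 15 0) ∧
      (s'.mem 15 0 = 0 ∨ ∃ i, 0 < w i ∧ max (q i - 6 * L * A) 0 = s'.mem 15 0) := by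
  refine Runs.seq (c := 30) (c' := 70) (((Runs.mapP (fun i => q i - 6 * L * A) hN (by decide)
    hs.hm hm ?_).mono hN (by decide) le_rfl).conseq ?_)
  · intro i s1 h1 h2 h3 h4
    simp [RExpr.eval, entryE, scalarE, IExpr.eval, h1, h4, h3 10, h3 12, hq, hA, hL]
  intro s1 hf h1
  have hs1 := hs.frame hf rfl
  have hw1 : ∀ i : Fin m, s1.mem 5 i = w i := fun i => by rw [hf.2 5 rfl, hw]
  refine Runs.seq (c := 3) (c' := 67) (Runs.mono (d := 1) (Runs.setR hN ?_) hN (by decide) le_rfl)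
  have hf2 : Frame (.setR 15 (.const 0) (.const 0)) s1 _ :=
    (Exec.setR s1 15 (.const 0) (.const 0)).frame
  have hs2 := hs1.frame hf2 rfl
  refine Runs.mono (c := 40 + 12) (d := 0 + 1) ?_ hN (by decide) le_rfl
  -- Cells below `k` are already truncated at 0, the others still hold raw differences. The running
  -- maximum starts at 0 and skips points without weight, whence the alternative "0 or attained",
  -- which is what `FilterStep` asks for.
  refine (Runs.forP (fun k s2 =>
    (∀ i : Fin m, (i : ℕ) < k → s2.mem 8 i = max (q i - 6 * L * A) 0) ∧
    (∀ i : Fin m, k ≤ (i : ℕ) → s2.mem 8 i = q i - 6 * L * A) ∧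
    (∀ i : Fin m, (i : ℕ) < k → 0 < w i → max (q i - 6 * L * A) 0 ≤ s2.mem 15 0) ∧
    0 ≤ s2.mem 15 0 ∧
    (s2.mem 15 0 = 0 ∨ ∃ i, 0 < w i ∧ max (q i - 6 * L * A) 0 = s2.mem 15 0))
    hN rfl rfl (by decide) hs2.hm hm ?_ ?_).conseq ?_
  · refine ⟨fun i hi => absurd hi (by omega), fun i _ => ?_, fun i hi => absurd hi (by omega), ?_,
      Or.inl ?_⟩ <;> simp [State.setI, State.setR, h1, RExpr.eval, IExpr.eval]
  · intro k hk s2 hf3 hs2k hI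
    obtain ⟨hI1, hI2, hI3, hI4, hI5⟩ := hI
    set g : Fin m → ℝ := fun i => q i - 6 * L * A with hg
    have hw2 : s2.mem 5 k = w ⟨k, hk⟩ := by
      rw [hf3.2 5 rfl, hf2.2 5 rfl]; exact hw1 ⟨k, hk⟩
    refine Runs.seq (c := 20) (c' := 20) (Runs.conseq
      (Q := fun s3 => s3.mem 8 k = max (g ⟨k, hk⟩) 0 ∧ ∀ j, j ≠ k → s3.mem 8 j = s2.mem 8 j)
      (Runs.mono (c := _ + 7) (d := 0) (Runs.cond hN (fun hb => ?_) fun hb => ?_) hN (by decide)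
        le_rfl) ?_)
    · simp only [Test.Holds, entryE, RExpr.eval, IExpr.eval, hs2k] at hb
      rw [show s2.mem 8 k = g ⟨k, hk⟩ from hI2 ⟨k, hk⟩ le_rfl] at hb
      refine Runs.mono (d := 0) (Runs.setR hN ?_) hN (by decide) le_rfl
      refine ⟨?_, fun j hj => ?_⟩
      · simp [State.setR, IExpr.eval, RExpr.eval, hs2k, max_eq_right (show g ⟨k, hk⟩ ≤ 0 by
          exact_mod_cast hb.le)]
      · simp [State.setR, IExpr.eval, RExpr.eval, hs2k, hj]
    · simp only [Test.Holds, entryE, RExpr.eval, IExpr.eval, hs2k] at hb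
      rw [show s2.mem 8 k = g ⟨k, hk⟩ from hI2 ⟨k, hk⟩ le_rfl] at hb
      refine Runs.mono (d := 0) (Runs.skip hN ?_) hN (by decide) le_rfl
      refine ⟨?_, fun j hj => rfl⟩
      rw [hI2 ⟨k, hk⟩ le_rfl, max_eq_left]
      exact_mod_cast not_lt.1 hb
    · rintro s3 hf4 ⟨h3, h3'⟩
      have hs3k : s3.idx 5 = k := by rw [hf4.1 5 rfl, hs2k]
      have hM : s3.mem 15 0 = s2.mem 15 0 := by rw [hf4.2 15 rfl]
      have hw3 : s3.mem 5 k = w ⟨k, hk⟩ := by rw [hf4.2 5 rfl, hw2]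
      have h8lt : ∀ i : Fin m, (i : ℕ) < k + 1 → s3.mem 8 i = max (g i) 0 := by
        intro i hi
        by_cases hik : (i : ℕ) = k
        · have : i = ⟨k, hk⟩ := Fin.ext hik
          subst this
          exact h3
        · rw [h3' _ hik, hI1 i (by omega)]
      have h8ge : ∀ i : Fin m, k + 1 ≤ (i : ℕ) → s3.mem 8 i = g i := by
        intro i hi
        rw [h3' _ (by omega), hI2 i (by omega)]
      have keep : (0 < w ⟨k, hk⟩ → max (g ⟨k, hk⟩) 0 ≤ s3.mem 15 0) →
          (∀ i : Fin m, (i : ℕ) < k + 1 → s3.mem 8 i = max (g i) 0) ∧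
          (∀ i : Fin m, k + 1 ≤ (i : ℕ) → s3.mem 8 i = g i) ∧
          (∀ i : Fin m, (i : ℕ) < k + 1 → 0 < w i → max (g i) 0 ≤ s3.mem 15 0) ∧
          0 ≤ s3.mem 15 0 ∧ (s3.mem 15 0 = 0 ∨ ∃ i, 0 < w i ∧ max (g i) 0 = s3.mem 15 0) := by
        intro h
        refine ⟨h8lt, h8ge, fun i hi hwi => ?_, hM ▸ hI4, hM ▸ hI5⟩
        by_cases hik : (i : ℕ) = k
        · have : i = ⟨k, hk⟩ := Fin.ext hik
          subst this
          exact h hwi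
        · rw [hM]
          exact hI3 i (by omega) hwi
      refine Runs.mono (c := _ + (_ + 7)) (d := 0) (Runs.cond hN (fun hb => Runs.cond hN
        (fun hb' => ?_) fun hb' => ?_) fun hb => ?_) hN (by decide) le_rfl
      · simp only [Test.Holds, entryE, scalarE, RExpr.eval, IExpr.eval, hs3k, hw3, h3, hM]
          at hb hb'
        refine Runs.mono (d := 0) (Runs.setR hN ?_) hN (by decide) le_rfl
        simp only [State.setR, State.setI, entryE, IExpr.eval, RExpr.eval, hs3k, h3,
          Function.update_self, ne_eq, Nat.reduceEqDiff, not_false_eq_true,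
          Function.update_of_ne]
        refine ⟨h8lt, h8ge, fun i hi hwi => ?_, hI4.trans hb'.le, Or.inr ⟨⟨k, hk⟩, by simpa using hb,
          rfl⟩⟩
        by_cases hik : (i : ℕ) = k
        · have : i = ⟨k, hk⟩ := Fin.ext hik
          subst this
          exact le_rfl
        · exact (hI3 i (by omega) hwi).trans hb'.le
      · simp only [Test.Holds, entryE, scalarE, RExpr.eval, IExpr.eval, hs3k, h3] at hb'
        exact Runs.mono (d := 0) (Runs.skip hN (keep fun _ => not_lt.1 hb')) hN (by decide) le_rfl
      · simp only [Test.Holds, entryE, RExpr.eval, IExpr.eval, hs3k, hw3] at hb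
        exact Runs.mono (d := 0) (Runs.skip hN (keep fun h => absurd h (by simpa using hb))) hN
          (by decide) le_rfl
  · rintro s2 - ⟨h2, -, h3, -, h4⟩
    exact ⟨fun i => h2 i i.2, fun i => h3 i i.2, h4⟩

theorem runs_roundP (hN : 1 ≤ N) (hn : n ≤ N) (hm : m ≤ N) (hs : Ctx ε S s)
    (hw : ∀ i : Fin m, s.mem 5 i = w i) {L : ℝ} (hL : s.mem 10 0 = L) :
    Runs N 1000 4 roundP s fun s' => ∃ w' : Fin m → ℝ, (∀ i : Fin m, s'.mem 5 i = w' i) ∧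
      FilterStep (fun i => (S i).1) m (6 * L) (24 * L * ε) w w' := by
  set x : Fin m → Pt n := fun i => (S i).1 with hx
  refine Runs.seq (c := 500) (c' := 500) ((runs_scoreP hN hn hm hs hw).conseq ?_)
  rintro s1 hf ⟨h1, h2, h3⟩
  have hs1 := hs.frame hf rfl
  have hw1 : ∀ i : Fin m, s1.mem 5 i = w i := fun i => by rw [hf.2 5 rfl, hw]
  have hL1 : s1.mem 10 0 = L := by rw [hf.2 10 rfl, hL]
  have htest : (Test.rlt (.mul (.mul (.add (.const 1) (.mul (.mul (.const 24) (scalarE 10))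
      (scalarE 0))) (.cast (.reg 1))) (scalarE 12)) (scalarE 14)).Holds s1 ↔
      Violated x m (24 * L * ε) w := by
    simp [Test.Holds, RExpr.eval, scalarE, IExpr.eval, hL1, hs1.he, hs1.hm, h2, h3, Violated, hx]
  refine Runs.mono (c := _ + 200) (d := 4) (Runs.cond hN (fun hb => ?_) fun hb => ?_) hN
    (by decide) le_rfl
  · rw [htest] at hb
    refine Runs.mono (c := 200) (d := 1) (Runs.seq (c := 100) (c' := 100)
      ((runs_truncP hN hm hs1 hw1 h1 h2 hL1).conseq ?_)) hN (by decide) (by decide)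
    rintro s2 hf2 ⟨h4, h5, h6⟩
    have hs2 := hs1.frame hf2 rfl
    refine (Runs.mapP (fun i => w i - w i * max (score x w m i - 6 * L * powerNormSq x w m) 0 /
      s2.mem 15 0) hN (by decide) hs2.hm hm ?_).conseq ?_ |>.mono hN (by decide) le_rfl
    · intro i s3 h7 h8 h9 h10
      simp [RExpr.eval, entryE, scalarE, IExpr.eval, h7, h10, h9 8, h9 15, h4, hf2.2 5 rfl, hw1, hx]
    · intro s3 _ h7
      exact ⟨_, h7, fun h => absurd hb h, fun _ => ⟨_, h5, h6, fun i => rfl⟩⟩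
  · rw [htest] at hb
    exact Runs.mono (d := 4) (Runs.skip hN ⟨w, hw1, fun _ => rfl, fun h => absurd h hb⟩) hN
      (by decide) le_rfl

theorem runs_filterP (hN : 1 ≤ N) (hn : n ≤ N) (hm : m ≤ N) (hs : Ctx ε S s)
    {L : ℝ} (hL : s.mem 10 0 = L) :
    Runs N 1100 5 filterP s fun s' => ∃ w : Fin m → ℝ, (∀ i : Fin m, s'.mem 5 i = w i) ∧
      FilterReach (fun i => (S i).1) m (6 * L) (24 * L * ε) m w := by
  refine Runs.seq (c := 88) (c' := 1012) (((Runs.mapP (fun _ => 1) hN (by decide) hs.hm hm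
    ?_).mono hN (by decide) (by decide)).conseq ?_)
  · intros
    simp [RExpr.eval]
  intro s1 hf h1
  have hs1 := hs.frame hf rfl
  refine Runs.forP (c := 1000) (d := 4) (fun k s2 => ∃ w : Fin m → ℝ,
    (∀ i : Fin m, s2.mem 5 i = w i) ∧
    FilterReach (fun i => (S i).1) m (6 * L) (24 * L * ε) k w) hN rfl rfl (by decide) hs1.hm hm ?_ ?_
  · exact ⟨_, h1, rfl⟩
  · rintro k hk s2 hf2 - ⟨w, hw, hr⟩
    refine (runs_roundP hN hn hm (hs1.frame hf2 rfl) hw (L := L) ?_).conseq ?_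
    · rw [hf2.2 10 rfl, hf.2 10 rfl, hL]
    · rintro s3 - ⟨w', hw', hst⟩
      exact ⟨w', hw', w, hr, hst⟩

/-- Halves 1 until it is at most ε, but for at most `m` rounds, so that the program halts for every
ε; hence the case `L = m`, which is harmless for large samples. -/
theorem runs_logP (hN : 1 ≤ N) (hm : m ≤ N) (hs : Ctx ε S s) :
    Runs N 100 1 logP s fun s' => ∃ L : ℕ, s'.mem 10 0 = L ∧ (L = m ∨ (1 / 2 : ℝ) ^ L ≤ ε) ∧
      ∀ k < L, ε < (1 / 2 : ℝ) ^ k := by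
  refine Runs.seq (c := 3) (c' := 97) (Runs.mono (d := 1) (Runs.setR hN ?_) hN (by decide) le_rfl)
  refine Runs.seq (c := 3) (c' := 94) (Runs.mono (d := 1) (Runs.setR hN ?_) hN (by decide) le_rfl)
  set s1 := (s.setR 10 ((IExpr.const 0).eval s) ((RExpr.const 0).eval s)) with hs1d
  have hs2 : Ctx ε S (s1.setR 11 ((IExpr.const 0).eval s1) ((RExpr.const 1).eval s1)) :=
    (hs.frame (Exec.setR s 10 (.const 0) (.const 0)).frame rfl).frame
      (Exec.setR s1 11 (.const 0) (.const 1)).frame rfl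
  refine Runs.mono (c := 50 + 12) (d := 0 + 1) ?_ hN (by decide) le_rfl
  refine (Runs.forP (fun k s2 => ∃ L : ℕ, s2.mem 10 0 = L ∧ s2.mem 11 0 = (1 / 2 : ℝ) ^ L ∧
    (L = k ∨ (1 / 2 : ℝ) ^ L ≤ ε) ∧ ∀ k < L, ε < (1 / 2 : ℝ) ^ k) hN rfl rfl (by decide) hs2.hm hm
    ?_ ?_).conseq ?_
  · refine ⟨0, ?_, ?_, Or.inl rfl, fun k hk => absurd hk (by omega)⟩ <;>
      simp [hs1d, State.setI, State.setR, RExpr.eval, IExpr.eval]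
  · rintro k hk s3 hf3 - ⟨L, h1, h2, h3, h4⟩
    have hs3 := hs2.frame hf3 rfl
    refine Runs.mono (c := _ + 20) (d := 0) (Runs.cond hN (fun hb => ?_) fun hb => ?_) hN
      (by decide) le_rfl
    · simp only [Test.Holds, scalarE, RExpr.eval, IExpr.eval, hs3.he, h2] at hb
      refine Runs.seq (c := 10) (c' := 10) (Runs.mono (d := 0) (Runs.setR hN ?_) hN (by decide)
        le_rfl)
      refine Runs.mono (d := 0) (Runs.setR hN ?_) hN (by decide) le_rfl
      refine ⟨L + 1, ?_, ?_, Or.inl ?_, fun j hj => ?_⟩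
      · simp [State.setI, State.setR, RExpr.eval, IExpr.eval, scalarE, h1]
      · simp [State.setI, State.setR, RExpr.eval, IExpr.eval, scalarE, h2, pow_succ]
        ring
      · rcases h3 with h3 | h3
        · rw [h3]
        · exact absurd hb (not_lt.2 h3)
      · rcases Nat.lt_succ_iff_lt_or_eq.1 hj with h | h
        · exact h4 j h
        · rw [h]; exact hb
    · simp only [Test.Holds, scalarE, RExpr.eval, IExpr.eval, hs3.he, h2] at hb
      exact Runs.mono (d := 0) (Runs.skip hN ⟨L, h1, h2, Or.inr (not_lt.1 hb), h4⟩) hN (by decide)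
        le_rfl
  · rintro s3 - ⟨L, h1, -, h3, h4⟩
    exact ⟨L, h1, h3, h4⟩

theorem runs_sqrtP (hN : 1 ≤ N) (hn : n ≤ N) (hm : m ≤ N) (hs : Ctx ε S s) {v : Fin n → ℝ}
    (hv : ∀ l : Fin n, s.mem 3 l = v l) :
    Runs N 100 1 sqrtP s fun s' => s'.mem 17 0 = newtonSqrt (∑ l, v l * v l) m := by
  refine Runs.seq (c := 40) (c' := 60) (((Runs.sumP (i0 := 0) (fun l => v l * v l) hN (by decide)
    hs.hn hn ?_ ?_).mono hN (by decide) le_rfl).conseq ?_)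
  · intros; rfl
  · intro l s1 h1 h2 h3
    simp [RExpr.eval, entryE, IExpr.eval, h1, h3 3, hv]
  rintro s1 hf ⟨h1, -⟩
  have hs1 := hs.frame hf rfl
  refine Runs.seq (c := 10) (c' := 50) (Runs.mono (d := 1) (Runs.setR hN ?_) hN (by decide) le_rfl)
  have hf2 : Frame (.setR 17 (.const 0) (.add (.const 1) (scalarE 16))) s1 _ :=
    (Exec.setR s1 17 (.const 0) (.add (.const 1) (scalarE 16))).frame
  have hs2 := hs1.frame hf2 rfl
  refine Runs.mono (c := 20 + 12) (d := 0 + 1) ?_ hN (by decide) le_rfl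
  refine (Runs.forP (fun k s2 => s2.mem 17 0 = newtonSqrt (∑ l, v l * v l) k) hN rfl rfl
    (by decide) hs2.hm hm ?_ ?_)
  · simp [State.setI, State.setR, RExpr.eval, IExpr.eval, scalarE, h1, newtonSqrt]
  · rintro k hk s3 hf3 - hI
    refine Runs.mono (d := 0) (Runs.setR hN ?_) hN (by decide) le_rfl
    have h16 : s3.mem 16 0 = ∑ l, v l * v l := by
      rw [hf3.2 16 rfl, hf2.2 16 rfl, h1]
    simp only [State.setI, State.setR, RExpr.eval, IExpr.eval, scalarE, h16, hI,
      Function.update_self]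
    rw [newtonSqrt, newtonSqrt, Function.iterate_succ_apply']
    simp

open Classical in
theorem Runs.countP {a r b M : ℕ} {t : Test} (P : Fin M → Prop) (hN : 1 ≤ N)
    (hrb : r ≠ b) (hM : s.idx b = M) (hMN : M ≤ N)
    (ht : ∀ (k : Fin M) (s1 : State), s1.idx r = k → (∀ q, q ≠ r → s1.idx q = s.idx q) →
      (∀ a', a' ≠ a → s1.mem a' = s.mem a') → (t.Holds s1 ↔ P k)) :
    Runs N (t.cost + 22) 1 (countP a r b t) s fun s' =>
      s'.mem a 0 = (Finset.univ.filter P).card := by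
  refine Runs.mono (c := 3 + ((t.cost + 6) + 12)) (d := 1) ?_ hN (by omega) le_rfl
  refine Runs.seq (Runs.mono (d := 1) (Runs.setR hN ?_) hN (by decide) le_rfl)
  refine (Runs.forP (M := M) (d := 0) (fun k s1 => s1.mem a 0 =
    ∑ j ∈ Finset.range k, (if h : j < M then (if P ⟨j, h⟩ then (1 : ℝ) else 0) else 0)) hN rfl rfl
    hrb (by simpa [State.setR] using hM) hMN ?_ ?_).conseq ?_
  · simp [State.setI, State.setR, RExpr.eval, IExpr.eval]
  · intro k hk s1 hf hs1 hI
    have hidx : ∀ q, q ≠ r → s1.idx q = s.idx q := by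
      intro q hq
      have := hf.1 q (by simp [RealRAM.forP, Prog.keepsI, hq])
      simpa [State.setR] using this
    have hmem : ∀ a', a' ≠ a → s1.mem a' = s.mem a' := by
      intro q hq
      have := hf.2 q (by simp [RealRAM.forP, Prog.keepsR, hq])
      simpa [State.setR, hq] using this
    have ht' := ht ⟨k, hk⟩ s1 hs1 hidx hmem
    refine Runs.cond hN (fun hb => ?_) fun hb => ?_
    · rw [ht'] at hb
      refine Runs.mono (d := 0) (Runs.setR hN ?_) hN
        (by simp [IExpr.cost, RExpr.cost, scalarE]) le_rfl
      simp [State.setI, State.setR, RExpr.eval, IExpr.eval, scalarE, Finset.sum_range_succ, hI, hk,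
        hb]
    · rw [ht'] at hb
      refine Runs.mono (d := 0) (Runs.skip hN ?_) hN (by decide) le_rfl
      simp [State.setI, Finset.sum_range_succ, hI, hk, hb]
  · intro s1 _ h1
    rw [h1, Finset.sum_range, Finset.card_filter]
    simp

theorem runs_quantileP [NeZero n] (hN : 1 ≤ N) (hm : m ≤ N) (hs : Ctx ε S s) :
    Runs N 200 2 quantileP s fun s' =>
      (∃ i, IsQuantile S i) → ∃ i, IsQuantile S i ∧ s'.mem 21 0 = (S i).1 0 := by
  classical
  refine Runs.seq (c := 50) (c' := 150) (((Runs.sumP (i0 := 0)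
    (fun k : Fin m => (1 - (((S k).2 : ℤ) : ℝ)) / 2) hN (by decide)
    hs.hm hm ?_ ?_).mono hN (by decide) (by decide)).conseq ?_)
  · intros; rfl
  · intro l s1 h1 h2 h3
    simp [RExpr.eval, entryE, IExpr.eval, h1, h3 2, hs.hy]
  rintro s1 hf ⟨h1, -⟩
  have hs1 := hs.frame hf rfl
  refine Runs.mono (c := 120 + 12) (d := 1 + 1) ?_ hN (by decide) le_rfl
  -- The implication leaves cell 21 unspecified until a quantile has been seen; afterwards only
  -- another quantile can overwrite it.
  refine (Runs.forP (fun k s2 => (∃ i : Fin m, (i : ℕ) < k ∧ IsQuantile S i) →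
    ∃ i, IsQuantile S i ∧ s2.mem 21 0 = (S i).1 0) hN rfl rfl
    (by decide) hs1.hm hm ?_ ?_).conseq ?_
  · rintro ⟨i, hi, -⟩
    omega
  · rintro k hk s2 hf2 hs2k hI
    have hs2 := hs1.frame hf2 rfl
    have hfirst : ∀ i : Fin m, s2.mem 1 (n * i) = (S i).1 0 := fun i => by
      simpa using hs2.hx i 0
    refine Runs.seq (c := 35) (c' := 85) (((Runs.countP
      (fun k' : Fin m => (S k').1 0 < (S ⟨k, hk⟩).1 0) hN (by decide) hs2.hm hm ?_).mono hN
      (by decide) le_rfl).conseq ?_)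
    · intro i s3 h3 h4 h5
      simp only [Test.Holds, RExpr.eval, firstE, IExpr.eval, h3, h4 0 (by decide),
        h4 5 (by decide), h5 1 (by decide), hs2.hn, hs2k, hfirst]
      rw [← hfirst ⟨k, hk⟩]
    intro s3 hf3 h3
    have hs3 := hs2.frame hf3 rfl
    refine Runs.seq (c := 35) (c' := 50) (((Runs.countP
      (fun k' : Fin m => (S k').1 0 ≤ (S ⟨k, hk⟩).1 0) hN (by decide) hs3.hm hm ?_).mono hN
      (by decide) le_rfl).conseq ?_)
    · intro i s4 h4 h5 h6
      simp only [Test.Holds, RExpr.eval, firstE, IExpr.eval, h4, h5 0 (by decide),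
        h5 5 (by decide), h6 1 (by decide), hs3.hn, hf3.1 5 rfl, hf3.2 1 rfl, hs2k, hfirst]
      rw [← hfirst ⟨k, hk⟩, not_lt]
    intro s4 hf4 h4
    have hs4 := hs3.frame hf4 rfl
    have h18 : s4.mem 18 0 = ∑ k : Fin m, (1 - (((S k).2 : ℤ) : ℝ)) / 2 := by
      rw [hf4.2 18 rfl, hf3.2 18 rfl, hf2.2 18 rfl, h1]
    have h19 := h3
    rw [← hf4.2 19 rfl] at h19
    have h21 : s4.mem 21 0 = s2.mem 21 0 := by rw [hf4.2 21 rfl, hf3.2 21 rfl]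
    have keep : ¬ IsQuantile S ⟨k, hk⟩ → (∃ i : Fin m, (i : ℕ) < k + 1 ∧ IsQuantile S i) →
        ∃ i, IsQuantile S i ∧ (s4.setI 5 (k + 1)).mem 21 0 = (S i).1 0 := by
      rintro h ⟨i, hi, hq⟩
      have : (i : ℕ) ≠ k := by
        intro hik
        have : i = ⟨k, hk⟩ := Fin.ext hik
        exact h (this ▸ hq)
      simp only [State.setI, h21]
      exact hI ⟨i, by omega, hq⟩
    refine Runs.mono (c := _ + (_ + 20)) (d := 1) (Runs.cond hN (fun hb => Runs.cond hN
      (fun hb' => ?_) fun hb' => ?_) fun hb => ?_) hN (by decide) le_rfl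
    · simp only [Test.Holds, RExpr.eval, scalarE, IExpr.eval, h18, h19, h4, not_lt] at hb hb'
      refine Runs.mono (d := 1) (Runs.setR hN ?_) hN (by decide) le_rfl
      intro _
      refine ⟨⟨k, hk⟩, ⟨hb, hb'⟩, ?_⟩
      rw [← hfirst ⟨k, hk⟩]
      simp [State.setI, State.setR, RExpr.eval, IExpr.eval, firstE, hs4.hn, hf4.1 5 rfl,
        hf3.1 5 rfl, hs2k, hf4.2 1 rfl, hf3.2 1 rfl]
    · simp only [Test.Holds, RExpr.eval, scalarE, IExpr.eval, h18, h4] at hb'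
      exact Runs.mono (d := 1) (Runs.skip hN (keep fun h => hb' (not_lt.2 h.2))) hN (by decide)
        le_rfl
    · simp only [Test.Holds, RExpr.eval, scalarE, IExpr.eval, h18, h19] at hb
      exact Runs.mono (d := 1) (Runs.skip hN (keep fun h => hb (not_lt.2 h.1))) hN (by decide)
        le_rfl
  · rintro s2 - h2 ⟨i, hi⟩
    exact h2 ⟨i, i.2, hi⟩

theorem ctx_input (ε : ℝ) (S : Fin m → Example n) : Ctx ε S (input ε S) := by
  refine ⟨rfl, rfl, rfl, fun i l => ?_, fun i => ?_⟩
  · have h : n * (i : ℕ) + l < m * n := by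
      have := (finProdFinEquiv (i, l)).2
      simp only [finProdFinEquiv_apply_val] at this
      omega
    have h' : (⟨n * (i : ℕ) + l, h⟩ : Fin (m * n)) = finProdFinEquiv (i, l) := by
      ext
      simp [add_comm]
    have h'' : finProdFinEquiv.symm (⟨n * (i : ℕ) + l, h⟩ : Fin (m * n)) = (i, l) := by
      rw [h', Equiv.symm_apply_apply]
    simp only [input, one_ne_zero, if_false, if_true, h, dif_pos, h'']
  · simp [input]

/-- The learning algorithm always halts, in polynomial time. -/
theorem learnP_returns [NeZero n] (ε : ℝ) (S : Fin m → Example n) :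
    ∃ (t : ℕ) (h : LTF n), Returns learnP ε S t h ∧ t ≤ 2000 * (n + m) ^ 5 ∧ IsLearned ε S h := by
  have hN : 1 ≤ n + m := by have := NeZero.one_le (n := n); omega
  have hn : n ≤ n + m := by omega
  have hm : m ≤ n + m := by omega
  have key : Runs (n + m) 2000 5 learnP (input ε S) fun s => IsLearned ε S (output n s) := by
    refine Runs.seq (c := 100) (c' := 1900) (((runs_logP hN hm (ctx_input ε S)).mono hN
      (by decide) (by decide)).conseq ?_)
    rintro s1 hf1 ⟨L, hL, hL1, hL2⟩
    have hs1 := (ctx_input ε S).frame hf1 rfl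
    refine Runs.seq (c := 1100) (c' := 800) ((runs_filterP hN hn hm hs1 hL).conseq ?_)
    rintro s2 hf2 ⟨w, hw, hfil⟩
    have hs2 := hs1.frame hf2 rfl
    refine Runs.seq (c := 100) (c' := 700) (((Runs.tabP (fun (l : Fin n) (i : Fin m) =>
      w i * ((S i).2 : ℤ) * (S i).1 l / m) hN (by decide) (by decide) (by decide) (by decide)
      (by decide) hs2.hn hn hs2.hm hm ?_).mono hN (by decide) (by decide)).conseq ?_)
    · intro l i s3 h3 h4 h5 h6
      simp [RExpr.eval, entryE, pointE, IExpr.eval, h3, h4, h5 0, h5 1, h6 5, h6 2, h6 1, hw, hs2.hy,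
        hs2.hx, hs2.hn, hs2.hm]
    intro s3 hf3 h3
    have hs3 := hs2.frame hf3 rfl
    refine Runs.seq (c := 100) (c' := 600) (((runs_sqrtP hN hn hm hs3 h3).mono hN
      (by decide) (by decide)).conseq ?_)
    intro s4 hf4 h4
    have hs4 := hs3.frame hf4 rfl
    refine Runs.seq (c := 200) (c' := 400) (((runs_quantileP hN hm hs4).mono hN
      (by decide) (by decide)).conseq ?_)
    intro s5 hf5 h5
    refine Runs.mono (d := 5) (Runs.setR hN ?_) hN (by decide) le_rfl
    have hv : ∀ l : Fin n, s5.mem 3 l = ∑ i, w i * ((S i).2 : ℤ) * (S i).1 l / m := fun l => by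
      rw [hf5.2 3 rfl, hf4.2 3 rfl, h3]
    refine ⟨L, w, s5.mem 21 0, hL1, hL2, hfil, fun l => ?_, h5, ?_⟩
    · simpa [output, State.setR] using hv l
    · have h17 := (congrFun (hf5.2 17 rfl) 0).trans h4
      simp [output, State.setR, RExpr.eval, IExpr.eval, scalarE, h17, hv]
  obtain ⟨t, ht, s, he, hs⟩ := key
  exact ⟨t, _, ⟨s, he, rfl⟩, ht, hs⟩

end RealRAM

/-! ### The largest eigenvalue of the moment matrix -/

/-- Put ρ = (1+η)M. The hypothesis says that ∑ λ^(2K)(λ-ρ) ≤ 0, and each term is at least -ρ^(2K+1),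
so no single term can exceed card·ρ^(2K+1). An eigenvalue above (1+2η)M = (1+κ)ρ would contribute at
least (1+κ)^(2K)·κ·ρ^(2K+1), and by Bernoulli (1+κ)^(2K) ≥ (Kκ)², which is too much once K²κ³
exceeds the number of eigenvalues. -/
theorem le_of_sum_pow_succ_le {ι : Type*} [Fintype ι] {lam : ι → ℝ} (h0 : ∀ i, 0 ≤ lam i)
    {M η : ℝ} {K : ℕ} (hM : 0 < M) (hη : 0 < η)
    (hK : (Fintype.card ι : ℝ) < K ^ 2 * (η / (1 + η)) ^ 3)
    (h : ∑ i, lam i ^ (2 * K + 1) ≤ (1 + η) * M * ∑ i, lam i ^ (2 * K)) (i : ι) :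
    lam i ≤ (1 + 2 * η) * M := by
  by_contra! hi
  set ρ := (1 + η) * M with hρ
  have hρ0 : 0 < ρ := by positivity
  set κ := η / (1 + η) with hκ
  have hκ0 : 0 < κ := by positivity
  have hκη : κ * (1 + η) = η := by rw [hκ]; field_simp
  have h1 : ∀ j, -(ρ ^ (2 * K) * ρ) ≤ lam j ^ (2 * K) * (lam j - ρ) := by
    intro j
    rcases le_total ρ (lam j) with hj | hj
    · have : 0 ≤ lam j ^ (2 * K) * (lam j - ρ) :=
        mul_nonneg (pow_nonneg (h0 j) _) (by linarith)
      have : 0 < ρ ^ (2 * K) * ρ := by positivity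
      linarith
    · have h2 : lam j ^ (2 * K) ≤ ρ ^ (2 * K) := pow_le_pow_left₀ (h0 j) hj _
      have h3 : lam j ^ (2 * K) * (ρ - lam j) ≤ ρ ^ (2 * K) * ρ :=
        mul_le_mul h2 (by linarith [h0 j]) (by linarith) (by positivity)
      linarith
  have h2 : ∑ j, lam j ^ (2 * K) * (lam j - ρ) ≤ 0 := by
    have : ∑ j, lam j ^ (2 * K) * (lam j - ρ) =
        ∑ i, lam i ^ (2 * K + 1) - ρ * ∑ i, lam i ^ (2 * K) := by
      rw [Finset.mul_sum, ← Finset.sum_sub_distrib]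
      exact Finset.sum_congr rfl fun j _ => by ring
    linarith
  have h3 : lam i ^ (2 * K) * (lam i - ρ) + ρ ^ (2 * K) * ρ ≤
      ∑ j, (lam j ^ (2 * K) * (lam j - ρ) + ρ ^ (2 * K) * ρ) :=
    Finset.single_le_sum (f := fun j => lam j ^ (2 * K) * (lam j - ρ) + ρ ^ (2 * K) * ρ)
      (fun j _ => by linarith [h1 j]) (Finset.mem_univ i)
  rw [Finset.sum_add_distrib, Finset.sum_const, Finset.card_univ, nsmul_eq_mul] at h3
  have h4 : lam i ^ (2 * K) * (η * M) ≤ Fintype.card ι * (ρ ^ (2 * K) * ρ) := by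
    have : lam i ^ (2 * K) * (η * M) ≤ lam i ^ (2 * K) * (lam i - ρ) :=
      mul_le_mul_of_nonneg_left (by rw [hρ]; linarith) (pow_nonneg (h0 i) _)
    have : 0 < ρ ^ (2 * K) * ρ := by positivity
    linarith
  have h5 : (1 + κ) * ρ = (1 + 2 * η) * M := by
    rw [hρ]
    linear_combination M * hκη
  have h6 : ((1 + κ) * ρ) ^ (2 * K) ≤ lam i ^ (2 * K) :=
    pow_le_pow_left₀ (by positivity) (by rw [h5]; exact hi.le) _
  have h7 : (K * κ) ^ 2 ≤ (1 + κ) ^ (2 * K) := by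
    rw [mul_comm 2 K, pow_mul]
    refine pow_le_pow_left₀ (by positivity) ?_ 2
    have := one_add_mul_le_pow (a := κ) (by linarith) K
    linarith
  have h8 : (K * κ) ^ 2 * ρ ^ (2 * K) * (κ * ρ) ≤ Fintype.card ι * (ρ ^ (2 * K) * ρ) := by
    refine le_trans ?_ h4
    have h9 : κ * ρ = η * M := by rw [hρ, ← mul_assoc, hκη]
    rw [h9]
    refine mul_le_mul_of_nonneg_right ?_ (by positivity)
    refine le_trans ?_ h6
    rw [mul_pow (1 + κ)]
    exact mul_le_mul_of_nonneg_right h7 (by positivity)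
  have h9 : (0 : ℝ) < ρ ^ (2 * K) * ρ := by positivity
  have h10 : K ^ 2 * κ ^ 3 * (ρ ^ (2 * K) * ρ) ≤ Fintype.card ι * (ρ ^ (2 * K) * ρ) := by
    refine le_trans (le_of_eq ?_) h8
    ring
  exact absurd (le_of_mul_le_mul_right h10 h9) (not_le.2 hK)

section spectral

open Matrix

variable {ι : Type*} [Fintype ι] [DecidableEq ι] {A : Matrix ι ι ℝ}

theorem Matrix.IsHermitian.trace_pow_eq_sum (hA : A.IsHermitian) (k : ℕ) :
    (A ^ k).trace = ∑ i, hA.eigenvalues i ^ k := by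
  conv_lhs => rw [hA.spectral_theorem, ← map_pow, Unitary.conjStarAlgAut_apply, trace_mul_comm,
    ← mul_assoc]
  simp [Matrix.diagonal_pow, Matrix.trace_diagonal]

theorem Matrix.IsHermitian.dotProduct_mulVec_le (hA : A.IsHermitian) {c : ℝ}
    (hc : ∀ i, hA.eigenvalues i ≤ c) (u : ι → ℝ) : u ⬝ᵥ A *ᵥ u ≤ c * (u ⬝ᵥ u) := by
  set U : Matrix ι ι ℝ := (hA.eigenvectorUnitary : Matrix ι ι ℝ) with hU
  have hUU : U * star U = 1 := Unitary.mul_star_self_of_mem hA.eigenvectorUnitary.2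
  have h1 : A = U * diagonal hA.eigenvalues * star U := by
    conv_lhs => rw [hA.spectral_theorem, Unitary.conjStarAlgAut_apply]
    rfl
  have hst : star U = Uᵀ := by ext; simp [star_apply]
  set y := Uᵀ *ᵥ u with hy
  have h2 : u ⬝ᵥ A *ᵥ u = ∑ i, hA.eigenvalues i * (y i * y i) := by
    conv_lhs => rw [h1, hst, ← mulVec_mulVec, ← hy, ← mulVec_mulVec, dotProduct_mulVec,
      ← mulVec_transpose, ← hy]
    simp only [dotProduct, mulVec_diagonal]
    exact Finset.sum_congr rfl fun i _ => by ring
  have h3 : u ⬝ᵥ u = ∑ i, y i * y i := by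
    have : u ⬝ᵥ (U * Uᵀ) *ᵥ u = y ⬝ᵥ y := by
      rw [← mulVec_mulVec, ← hy, dotProduct_mulVec, ← mulVec_transpose, ← hy]
    rw [← hst, hUU, one_mulVec] at this
    rw [this]; rfl
  rw [h2, h3, Finset.mul_sum]
  exact Finset.sum_le_sum fun i _ => mul_le_mul_of_nonneg_right (hc i) (mul_self_nonneg _)

end spectral

/-! ### The filter's test as a comparison of traces of powers. -/

section moment

open Matrix

variable {n m : ℕ} {x : Fin m → Pt n} {w : Fin m → ℝ}

/-- The matrix `∑ i, w i • x i (x i)ᵀ`. -/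
def momentMatrix (x : Fin m → Pt n) (w : Fin m → ℝ) : Matrix (Fin n) (Fin n) ℝ :=
  Matrix.of fun l l' => ∑ i, w i * (x i l * x i l')

theorem momentApply_eq (v : Fin n → ℝ) : momentApply x w v = momentMatrix x w *ᵥ v := by
  ext l
  simp only [momentApply, momentMatrix, mulVec, dotProduct, of_apply, Finset.mul_sum,
    Finset.sum_mul]
  rw [Finset.sum_comm]
  exact Finset.sum_congr rfl fun i _ => Finset.sum_congr rfl fun i _ => by ring

theorem powerColumn_eq (K : ℕ) (j l : Fin n) :
    powerColumn x w K j l = (momentMatrix x w ^ K) l j := by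
  have : powerColumn x w K j = (momentMatrix x w ^ K) *ᵥ Pi.single j 1 := by
    induction K with
    | zero => rw [powerColumn, pow_zero, one_mulVec]; rfl
    | succ K ih =>
      rw [powerColumn, Function.iterate_succ_apply', ← powerColumn, ih, momentApply_eq,
        mulVec_mulVec, pow_succ']
  rw [this]
  simp

theorem momentMatrix_transpose : (momentMatrix x w)ᵀ = momentMatrix x w := by
  ext l l'
  simp [momentMatrix, mul_comm]

theorem dotProduct_momentMatrix (u : Fin n → ℝ) :
    u ⬝ᵥ momentMatrix x w *ᵥ u = ∑ i, w i * ((∑ l, x i l * u l) * ∑ l, x i l * u l) := by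
  have h : ∀ l, u l * momentApply x w u l =
      ∑ i, w i * ((u l * x i l) * ∑ l', x i l' * u l') := fun l => by
    rw [momentApply, Finset.mul_sum]
    exact Finset.sum_congr rfl fun i _ => by ring
  rw [← momentApply_eq, dotProduct]
  simp only [h]
  rw [Finset.sum_comm]
  refine Finset.sum_congr rfl fun i _ => ?_
  rw [← Finset.mul_sum, ← Finset.sum_mul]
  simp only [mul_comm (u _)]

theorem powerNormSq_eq (K : ℕ) : powerNormSq x w K = (momentMatrix x w ^ (2 * K)).trace := by
  have h : momentMatrix x w ^ (2 * K) = (momentMatrix x w ^ K)ᵀ * momentMatrix x w ^ K := by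
    rw [transpose_pow, momentMatrix_transpose, ← pow_add, two_mul]
  rw [h]
  simp only [powerNormSq, powerColumn_eq, trace, mul_apply, diag_apply, transpose_apply]

/-- Together with `powerNormSq_eq` this turns `Violated` into tr A^(2K+1) > (1+η)m·tr A^(2K), a
statement about eigenvalues only. -/
theorem sum_mul_score_eq (K : ℕ) :
    ∑ i, w i * score x w K i = (momentMatrix x w ^ (2 * K + 1)).trace := by
  have h : momentMatrix x w ^ (2 * K + 1) =
      (momentMatrix x w ^ K)ᵀ * (momentMatrix x w * momentMatrix x w ^ K) := by
    rw [transpose_pow, momentMatrix_transpose, ← pow_succ', ← pow_add]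
    congr 1
    omega
  have h2 : ∀ j, ((momentMatrix x w ^ K)ᵀ * (momentMatrix x w * momentMatrix x w ^ K)) j j =
      powerColumn x w K j ⬝ᵥ momentMatrix x w *ᵥ powerColumn x w K j := by
    intro j
    simp only [mul_apply, dotProduct, mulVec, powerColumn_eq, transpose_apply]
  rw [h, trace]
  simp only [diag_apply, h2, dotProduct_momentMatrix, score, Finset.mul_sum]
  rw [Finset.sum_comm]

/-- If the scores show no violation, the moment matrix is small. -/
theorem sum_mul_sq_le_of_not_violated {K : ℕ} {η : ℝ} (hm : 0 < m) (hw : ∀ i, 0 ≤ w i)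
    (hη : 0 < η) (hK : (n : ℝ) < K ^ 2 * (η / (1 + η)) ^ 3) (h : ¬ Violated x K η w)
    (u : Fin n → ℝ) :
    ∑ i, w i * ((∑ l, x i l * u l) * ∑ l, x i l * u l) ≤ (1 + 2 * η) * m * ∑ l, u l * u l := by
  have hA : (momentMatrix x w).IsHermitian := by
    rw [Matrix.IsHermitian, conjTranspose_eq_transpose_of_trivial, momentMatrix_transpose]
  have hpos : (momentMatrix x w).PosSemidef := by
    refine PosSemidef.of_dotProduct_mulVec_nonneg hA fun u => ?_
    rw [star_trivial, dotProduct_momentMatrix]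
    exact Finset.sum_nonneg fun i _ => mul_nonneg (hw i) (mul_self_nonneg _)
  rw [Violated, not_lt, sum_mul_score_eq, powerNormSq_eq, hA.trace_pow_eq_sum,
    hA.trace_pow_eq_sum] at h
  rw [← dotProduct_momentMatrix]
  exact hA.dotProduct_mulVec_le (le_of_sum_pow_succ_le hpos.eigenvalues_nonneg
    (by exact_mod_cast hm) hη (by simpa using hK) h) u

end moment

/-! ### The filter removes more bad than good weight -/

/-- The clean sample has nearly the identity as second moment matrix, and small tails, in all
directions. -/
structure CleanMoments {n m : ℕ} (ε : ℝ) (L : ℕ) (X : Fin m → Pt n) : Prop where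
  lower : ∀ u : Fin n → ℝ, (1 - ε) * m * ∑ l, u l * u l ≤
    ∑ i, (∑ l, X i l * u l) * ∑ l, X i l * u l
  upper : ∀ u : Fin n → ℝ, ∑ i, (∑ l, X i l * u l) * ∑ l, X i l * u l ≤
    (1 + ε) * m * ∑ l, u l * u l
  tail : ∀ u : Fin n → ℝ, ∑ i, max ((∑ l, X i l * u l) * (∑ l, X i l * u l) -
    6 * L * ∑ l, u l * u l) 0 ≤ 17 * ε * m * ∑ l, u l * u l

section filter

variable {n m : ℕ} {ε : ℝ} {L K : ℕ} {x X : Fin m → Pt n} {w w' : Fin m → ℝ} {B : Finset (Fin m)}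

/-- The weights that the filter may reach: less good than bad weight has been removed. -/
structure GoodWeights (B : Finset (Fin m)) (w : Fin m → ℝ) : Prop where
  nonneg : ∀ i, 0 ≤ w i
  le_one : ∀ i, w i ≤ 1
  removed : ∑ i ∈ Bᶜ, (1 - w i) ≤ ∑ i ∈ B, (1 - w i)

theorem powerNormSq_nonneg : 0 ≤ powerNormSq x w K :=
  Finset.sum_nonneg fun _ _ => Finset.sum_nonneg fun _ _ => mul_self_nonneg _

theorem score_nonneg (i : Fin m) : 0 ≤ score x w K i :=
  Finset.sum_nonneg fun _ _ => mul_self_nonneg _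

/-- Scores are sums of squares of linear forms, one for each column of the power, so the moment and
tail bounds apply column by column. With P the squared Frobenius norm, the good points have
truncated mass at most 17εmP and total score at most (1+ε)mP. By the violation the bad points have
score above (24L-1)εmP, and the cutoff takes at most 6LεmP from it. What remains exceeds (18L-1)εmP
≥ 17εmP; this is where 24 = 6 + 17 + 1 comes from. -/
theorem sum_mul_trunc_lt (hL : 1 ≤ L) (hε : 0 < ε) (hX : CleanMoments ε L X)
    (hxX : ∀ i ∉ B, x i = X i) (hB : (B.card : ℝ) ≤ ε * m) (hw : GoodWeights B w)
    (hv : Violated x K (24 * L * ε) w) :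
    ∑ i ∈ Bᶜ, w i * max (score x w K i - 6 * L * powerNormSq x w K) 0 <
      ∑ i ∈ B, w i * max (score x w K i - 6 * L * powerNormSq x w K) 0 := by
  set P := powerNormSq x w K with hP
  have hP0 : 0 ≤ P := powerNormSq_nonneg
  set a := powerColumn x w K with ha
  have hscore : ∀ i ∈ Bᶜ, score x w K i = ∑ j, (∑ l, X i l * a j l) * (∑ l, X i l * a j l) := by
    intro i hi
    rw [score, hxX i (Finset.mem_compl.1 hi)]
  have hgood : ∑ i ∈ Bᶜ, w i * max (score x w K i - 6 * L * P) 0 ≤ 17 * ε * m * P := by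
    calc ∑ i ∈ Bᶜ, w i * max (score x w K i - 6 * L * P) 0
        ≤ ∑ i ∈ Bᶜ, ∑ j, max ((∑ l, X i l * a j l) * (∑ l, X i l * a j l) -
            6 * L * ∑ l, a j l * a j l) 0 := by
          refine Finset.sum_le_sum fun i hi => ?_
          refine (mul_le_of_le_one_left (le_max_right _ _) (hw.le_one i)).trans ?_
          -- The positive part of a sum is at most the sum of the positive parts.
          refine max_le ?_ (Finset.sum_nonneg fun _ _ => le_max_right _ _)
          rw [hscore i hi, hP, powerNormSq, Finset.mul_sum, ← Finset.sum_sub_distrib]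
          exact Finset.sum_le_sum fun _ _ => le_max_left _ _
      _ ≤ ∑ i, ∑ j, max ((∑ l, X i l * a j l) * (∑ l, X i l * a j l) -
            6 * L * ∑ l, a j l * a j l) 0 :=
          Finset.sum_le_univ_sum_of_nonneg fun i => Finset.sum_nonneg fun _ _ => le_max_right _ _
      _ ≤ 17 * ε * m * P := by
          rw [Finset.sum_comm, hP, powerNormSq, Finset.mul_sum]
          exact Finset.sum_le_sum fun j _ => hX.tail (a j)
  have hgood2 : ∑ i ∈ Bᶜ, w i * score x w K i ≤ (1 + ε) * m * P := by
    calc ∑ i ∈ Bᶜ, w i * score x w K i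
        ≤ ∑ i ∈ Bᶜ, ∑ j, (∑ l, X i l * a j l) * (∑ l, X i l * a j l) := by
          refine Finset.sum_le_sum fun i hi => ?_
          rw [← hscore i hi]
          exact mul_le_of_le_one_left (score_nonneg i) (hw.le_one i)
      _ ≤ ∑ i, ∑ j, (∑ l, X i l * a j l) * (∑ l, X i l * a j l) :=
          Finset.sum_le_univ_sum_of_nonneg fun i => Finset.sum_nonneg fun _ _ => mul_self_nonneg _
      _ ≤ (1 + ε) * m * P := by
          rw [Finset.sum_comm, hP, powerNormSq, Finset.mul_sum]
          exact Finset.sum_le_sum fun j _ => hX.upper (a j)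
  have hbad : ∑ i ∈ B, w i * score x w K i - 6 * L * P * (ε * m) ≤
      ∑ i ∈ B, w i * max (score x w K i - 6 * L * P) 0 := by
    have h1 : ∑ i ∈ B, w i * (6 * L * P) ≤ 6 * L * P * (ε * m) := by
      calc ∑ i ∈ B, w i * (6 * L * P) ≤ ∑ i ∈ B, 6 * L * P :=
            Finset.sum_le_sum fun i _ => mul_le_of_le_one_left (by positivity) (hw.le_one i)
        _ = 6 * L * P * B.card := by rw [Finset.sum_const, nsmul_eq_mul, mul_comm]
        _ ≤ _ := mul_le_mul_of_nonneg_left hB (by positivity)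
    have h2 : ∑ i ∈ B, w i * score x w K i - ∑ i ∈ B, w i * (6 * L * P) ≤
        ∑ i ∈ B, w i * max (score x w K i - 6 * L * P) 0 := by
      rw [← Finset.sum_sub_distrib]
      refine Finset.sum_le_sum fun i _ => ?_
      rw [← mul_sub]
      exact mul_le_mul_of_nonneg_left (le_max_left _ _) (hw.nonneg i)
    linarith
  have hsum := Finset.sum_add_sum_compl B fun i => w i * score x w K i
  rw [Violated, ← hsum] at hv
  have hL' : (1 : ℝ) ≤ L := by exact_mod_cast hL
  have h3 : 0 ≤ (L - 1) * (ε * m * P) := mul_nonneg (by linarith) (by positivity)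
  linarith

/-- The removed weight is proportional to weight times truncated score, so the preceding inequality
keeps the balance. The divisor `M` is positive, as otherwise both sides of that strict inequality
would vanish, and a point that attains the maximum loses all its weight. -/
theorem GoodWeights.step (hL : 1 ≤ L) (hε : 0 < ε) (hX : CleanMoments ε L X)
    (hxX : ∀ i ∉ B, x i = X i) (hB : (B.card : ℝ) ≤ ε * m) (hw : GoodWeights B w)
    (hst : FilterStep x K (6 * L) (24 * L * ε) w w') (hv : Violated x K (24 * L * ε) w) :
    GoodWeights B w' ∧ (Finset.univ.filter fun i => 0 < w' i).card <
      (Finset.univ.filter fun i => 0 < w i).card := by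
  obtain ⟨M, hM1, hM2, hM3⟩ := hst.2 hv
  have hlt := sum_mul_trunc_lt hL hε hX hxX hB hw hv
  set g : Fin m → ℝ := fun i => max (score x w K i - 6 * L * powerNormSq x w K) 0 with hg
  have hg0 : ∀ i, 0 ≤ g i := fun i => le_max_right _ _
  have hMpos : 0 < M := by
    by_contra! h
    have hz : ∀ i, w i * g i = 0 := by
      intro i
      rcases (hw.nonneg i).lt_or_eq with h1 | h1
      · rw [show g i = 0 from le_antisymm ((hM1 i h1).trans h) (hg0 i), mul_zero]
      · rw [← h1, zero_mul]
    have h1 : ∑ i ∈ B, w i * g i = 0 := Finset.sum_eq_zero fun i _ => hz i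
    have h2 : ∑ i ∈ Bᶜ, w i * g i = 0 := Finset.sum_eq_zero fun i _ => hz i
    simp only [hg] at h1 h2
    linarith
  obtain ⟨i0, hi0, hgi0⟩ : ∃ i, 0 < w i ∧ g i = M := hM2.resolve_left hMpos.ne'
  have hnn : ∀ i, 0 ≤ w i * g i / M := fun i =>
    div_nonneg (mul_nonneg (hw.nonneg i) (hg0 i)) hMpos.le
  have hle : ∀ i, w i * g i / M ≤ w i := by
    intro i
    rw [div_le_iff₀ hMpos]
    rcases (hw.nonneg i).lt_or_eq with h1 | h1
    · exact mul_le_mul_of_nonneg_left (hM1 i h1) h1.le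
    · simp [← h1]
  have hw' : ∀ i, w' i = w i - w i * g i / M := hM3
  refine ⟨⟨fun i => ?_, fun i => ?_, ?_⟩, ?_⟩
  · rw [hw']; linarith [hle i]
  · rw [hw']; linarith [hnn i, hw.le_one i]
  · have h1 : ∀ s : Finset (Fin m), ∑ i ∈ s, (1 - w' i) =
        ∑ i ∈ s, (1 - w i) + (∑ i ∈ s, w i * g i) / M := by
      intro s
      rw [Finset.sum_div, ← Finset.sum_add_distrib]
      exact Finset.sum_congr rfl fun i _ => by rw [hw']; ring
    rw [h1, h1]
    exact add_le_add hw.removed (div_le_div_of_nonneg_right hlt.le hMpos.le)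
  · refine Finset.card_lt_card ⟨fun i hi => ?_, fun h => ?_⟩
    · simp only [Finset.mem_filter, Finset.mem_univ, true_and] at hi ⊢
      rw [hw'] at hi
      linarith [hnn i]
    · have := h (by simpa using hi0 : i0 ∈ Finset.univ.filter fun i => 0 < w i)
      simp only [Finset.mem_filter, Finset.mem_univ, true_and] at this
      rw [hw', hgi0, mul_div_assoc, div_self hMpos.ne', mul_one, sub_self] at this
      exact lt_irrefl _ this

/-- The filter ends with good weights and without violation. -/
theorem FilterReach.good (hL : 1 ≤ L) (hε : 0 < ε) (hX : CleanMoments ε L X)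
    (hxX : ∀ i ∉ B, x i = X i) (hB : (B.card : ℝ) ≤ ε * m)
    (hr : FilterReach x K (6 * L) (24 * L * ε) m w) :
    GoodWeights B w ∧ ¬ Violated x K (24 * L * ε) w := by
  -- The support shrinks in every violated round, and without violation the weights are stationary.
  have key : ∀ k w, FilterReach x K (6 * L) (24 * L * ε) k w → GoodWeights B w ∧
      (¬ Violated x K (24 * L * ε) w ∨ (Finset.univ.filter fun i => 0 < w i).card + k ≤ m) := by
    intro k
    induction k with
    | zero =>
      rintro w rfl
      refine ⟨⟨fun _ => zero_le_one, fun _ => le_rfl, by simp⟩, Or.inr ?_⟩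
      simp
    | succ k ih =>
      rintro w' ⟨w, hw, hst⟩
      obtain ⟨hgw, h⟩ := ih w hw
      by_cases hv : Violated x K (24 * L * ε) w
      · obtain ⟨h1, h2⟩ := hgw.step hL hε hX hxX hB hst hv
        refine ⟨h1, Or.inr ?_⟩
        have := h.resolve_left (not_not.2 hv)
        omega
      · rw [hst.1 hv]
        exact ⟨hgw, Or.inl hv⟩
  obtain ⟨h1, h2⟩ := key m w hr
  -- After `m` violated rounds all weights would be 0, and zero weights violate nothing.
  refine ⟨h1, h2.elim id fun h3 hv => ?_⟩
  have h4 : (Finset.univ.filter fun i => 0 < w i) = ∅ := Finset.card_eq_zero.1 (by omega)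
  have h5 : ∀ i, w i = 0 := by
    intro i
    by_contra h
    have : i ∈ Finset.univ.filter fun i => 0 < w i := by
      simpa using lt_of_le_of_ne (h1.nonneg i) (Ne.symm h)
    rw [h4] at this
    simp at this
  rw [Violated] at hv
  have : 0 ≤ (1 + 24 * L * ε) * m * powerNormSq x w K := by
    have := powerNormSq_nonneg (x := x) (w := w) (K := K)
    positivity
  simp only [h5, zero_mul, Finset.sum_const_zero] at hv
  linarith [this]

/-- The weighted mean of the labeled sample is close to the mean of the clean labeled sample. -/
theorem abs_sum_sub_sum_le (hL : 1 ≤ L) (hε : 0 < ε) (hX : CleanMoments ε L X)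
    (hxX : ∀ i ∉ B, x i = X i) (hB : (B.card : ℝ) ≤ ε * m) (hw : GoodWeights B w)
    {y Y : Fin m → ℝ} (hyY : ∀ i ∉ B, y i = Y i) (hy : ∀ i, |y i| = 1) (hY : ∀ i, |Y i| = 1)
    (u : Fin n → ℝ) (hu : ∑ i, w i * ((∑ l, x i l * u l) * ∑ l, x i l * u l) ≤
      (1 + 2 * (24 * L * ε)) * m * ∑ l, u l * u l) :
    |∑ i, w i * y i * (∑ l, x i l * u l) - ∑ i, Y i * ∑ l, X i l * u l| ≤
      17 * ε * √L * m * √(∑ l, u l * u l) := by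
  classical
  have hL' : (1 : ℝ) ≤ L := by exact_mod_cast hL
  set U := ∑ l, u l * u l with hU
  have hU0 : 0 ≤ U := Finset.sum_nonneg fun _ _ => mul_self_nonneg _
  set a : Fin m → ℝ := fun i => ∑ l, x i l * u l with ha
  set b : Fin m → ℝ := fun i => ∑ l, X i l * u l with hb
  have hab : ∀ i ∉ B, a i = b i := fun i hi => by simp only [ha, hb, hxX i hi]
  -- `D` is the clean mass missing from the weighted sample: all of each replaced point and the
  -- removed part of each surviving one. The balance of the weights bounds it by 2εm.
  set D : Fin m → ℝ := fun i => if i ∈ B then 1 else 1 - w i with hD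
  have hD0 : ∀ i, 0 ≤ D i := by
    intro i
    by_cases hi : i ∈ B
    · simp [hD, hi]
    · simp [hD, hi, hw.le_one i]
  have hDsum : ∑ i, D i ≤ 2 * ε * m := by
    have h1 : ∑ i ∈ B, (1 - w i) ≤ B.card := by
      rw [Finset.cast_card]
      exact Finset.sum_le_sum fun i _ => by linarith [hw.nonneg i]
    have h2 : ∑ i ∈ B, D i = B.card := by
      rw [Finset.cast_card]
      exact Finset.sum_congr rfl fun i hi => by simp [hD, hi]
    have h3 : ∑ i ∈ Bᶜ, D i = ∑ i ∈ Bᶜ, (1 - w i) :=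
      Finset.sum_congr rfl fun i hi => by simp [hD, Finset.mem_compl.1 hi]
    rw [← Finset.sum_add_sum_compl B, h2, h3]
    linarith [hw.removed]
  -- The part of b² below the cutoff 6LU is paid for by the total of `D`, the part above by the tail
  -- bound.
  have hDb : ∑ i, D i * (b i * b i) ≤ (12 * L + 17) * ε * m * U := by
    have h1 : ∀ i, D i * (b i * b i) ≤ D i * (6 * L * U) + max (b i * b i - 6 * L * U) 0 := by
      intro i
      have h2 : D i ≤ 1 := by
        by_cases hi : i ∈ B
        · simp [hD, hi]
        · simp [hD, hi, hw.nonneg i]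
      have h3 : D i * (b i * b i - 6 * L * U) ≤ D i * max (b i * b i - 6 * L * U) 0 :=
        mul_le_mul_of_nonneg_left (le_max_left _ _) (hD0 i)
      have h4 := mul_le_of_le_one_left (le_max_right (b i * b i - 6 * L * U) 0) h2
      linarith
    have h2 := Finset.sum_le_sum fun i (_ : i ∈ Finset.univ) => h1 i
    rw [Finset.sum_add_distrib, ← Finset.sum_mul] at h2
    have h3 := hX.tail u
    have h4 : (∑ i, D i) * (6 * L * U) ≤ 2 * ε * m * (6 * L * U) :=
      mul_le_mul_of_nonneg_right hDsum (by positivity)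
    refine h2.trans ((add_le_add h4 h3).trans (le_of_eq ?_))
    ring
  -- The surviving clean points already account for nearly mU of the weighted second moment, which
  -- is at most (1+48Lε)mU; only the difference is left for the bad points.
  have hbad : ∑ i ∈ B, w i * (a i * a i) ≤ (60 * L + 18) * ε * m * U := by
    have h1 := Finset.sum_add_sum_compl B fun i => w i * (a i * a i)
    have h2 : ∑ i ∈ Bᶜ, w i * (a i * a i) = ∑ i, (b i * b i) - ∑ i, D i * (b i * b i) := by
      rw [← Finset.sum_sub_distrib, ← Finset.sum_add_sum_compl B,
        Finset.sum_eq_zero (s := B), zero_add]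
      · refine Finset.sum_congr rfl fun i hi => ?_
        rw [hab i (Finset.mem_compl.1 hi)]
        simp only [hD, Finset.mem_compl.1 hi, if_false]
        ring
      · intro i hi
        simp [hD, hi]
    have h3 := hX.lower u
    have h4 : (1 - ε) * m * U ≤ ∑ i, b i * b i := h3
    have h5 : ∑ i, w i * (a i * a i) ≤ (1 + 2 * (24 * L * ε)) * m * U := hu
    linarith
  have hsplit : ∑ i, w i * y i * a i - ∑ i, Y i * b i =
      ∑ i ∈ B, w i * y i * a i - ∑ i, D i * (Y i * b i) := by
    rw [← Finset.sum_add_sum_compl B (fun i => w i * y i * a i), add_sub_assoc, sub_eq_add_neg]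
    congr 1
    rw [← Finset.sum_add_sum_compl B (fun i => Y i * b i),
      ← Finset.sum_add_sum_compl B (fun i => D i * (Y i * b i))]
    have h1 : ∑ i ∈ B, D i * (Y i * b i) = ∑ i ∈ B, Y i * b i :=
      Finset.sum_congr rfl fun i hi => by simp [hD, hi]
    have h2 : ∑ i ∈ Bᶜ, D i * (Y i * b i) = ∑ i ∈ Bᶜ, Y i * b i - ∑ i ∈ Bᶜ, w i * y i * a i := by
      rw [← Finset.sum_sub_distrib]
      refine Finset.sum_congr rfl fun i hi => ?_
      have hi' := Finset.mem_compl.1 hi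
      rw [hab i hi', hyY i hi']
      simp only [hD, hi', if_false]
      ring
    rw [h1, h2]
    ring
  have hy2 : ∀ i, y i ^ 2 = 1 := fun i => by rw [← sq_abs, hy, one_pow]
  have hY2 : ∀ i, Y i ^ 2 = 1 := fun i => by rw [← sq_abs, hY, one_pow]
  have hbadCS : (∑ i ∈ B, w i * y i * a i) ^ 2 ≤ 78 * L * (ε * m) ^ 2 * U := by
    calc (∑ i ∈ B, w i * y i * a i) ^ 2 = (∑ i ∈ B, y i * (w i * a i)) ^ 2 := by
          congr 1; exact Finset.sum_congr rfl fun i _ => by ring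
      _ ≤ (∑ i ∈ B, y i ^ 2) * ∑ i ∈ B, (w i * a i) ^ 2 := Finset.sum_mul_sq_le_sq_mul_sq _ _ _
      _ ≤ (ε * m) * ((60 * L + 18) * ε * m * U) := by
          have h1 : ∑ i ∈ B, y i ^ 2 = B.card := by simp [hy2]
          rw [h1]
          refine mul_le_mul hB (le_trans (Finset.sum_le_sum fun i _ => ?_) hbad)
            (Finset.sum_nonneg fun _ _ => sq_nonneg _) (by positivity)
          have h2 : w i * w i ≤ w i := mul_le_of_le_one_left (hw.nonneg i) (hw.le_one i)
          have h3 := mul_le_mul_of_nonneg_right h2 (mul_self_nonneg (a i))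
          linarith
      _ ≤ 78 * L * (ε * m) ^ 2 * U := by
          have : 0 ≤ (L - 1) * ((ε * m) ^ 2 * U) := mul_nonneg (by linarith) (by positivity)
          linarith
  have hDCS : (∑ i, D i * (Y i * b i)) ^ 2 ≤ 58 * L * (ε * m) ^ 2 * U := by
    calc (∑ i, D i * (Y i * b i)) ^ 2 ≤ (∑ i, D i) * ∑ i, D i * (b i * b i) := by
          refine Finset.sum_sq_le_sum_mul_sum_of_sq_le_mul _ (fun i _ => hD0 i)
            (fun i _ => mul_nonneg (hD0 i) (mul_self_nonneg _)) fun i _ => ?_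
          refine le_of_eq ?_
          linear_combination D i ^ 2 * b i ^ 2 * hY2 i
      _ ≤ (2 * ε * m) * ((12 * L + 17) * ε * m * U) :=
          mul_le_mul hDsum hDb (Finset.sum_nonneg fun i _ => mul_nonneg (hD0 i)
            (mul_self_nonneg _)) (by positivity)
      _ ≤ 58 * L * (ε * m) ^ 2 * U := by
          have : 0 ≤ (L - 1) * ((ε * m) ^ 2 * U) := mul_nonneg (by linarith) (by positivity)
          linarith
  set Z := √L * (ε * m) * √U with hZ
  have hZ0 : 0 ≤ Z := by positivity
  have hZ2 : Z ^ 2 = L * (ε * m) ^ 2 * U := by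
    rw [hZ, mul_pow, mul_pow, Real.sq_sqrt (by positivity), Real.sq_sqrt hU0]
  -- 78 ≤ 9² here and 58 ≤ 8² below, which gives the constant 17.
  have h1 : |∑ i ∈ B, w i * y i * a i| ≤ 9 * Z := by
    refine abs_le_of_sq_le_sq ?_ (by positivity)
    nlinarith [sq_nonneg Z]
  have h2 : |∑ i, D i * (Y i * b i)| ≤ 8 * Z := by
    refine abs_le_of_sq_le_sq ?_ (by positivity)
    nlinarith [sq_nonneg Z]
  calc |∑ i, w i * y i * a i - ∑ i, Y i * b i|
      = |∑ i ∈ B, w i * y i * a i - ∑ i, D i * (Y i * b i)| := by rw [hsplit]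
    _ ≤ _ := abs_sub _ _
    _ ≤ 9 * Z + 8 * Z := add_le_add h1 h2
    _ = 17 * ε * √L * m * √U := by rw [hZ]; ring

end filter

/-! ### The standard normal distribution on the line -/

section gaussian

open MeasureTheory ProbabilityTheory Set Filter Topology

/-- The density of the standard normal distribution. -/
noncomputable def normalPDF (t : ℝ) : ℝ := (√(2 * Real.pi))⁻¹ * Real.exp (-(t ^ 2 / 2))

/-- The standard normal distribution. -/
noncomputable abbrev normal : Measure ℝ := gaussianReal 0 1

/-- The distribution function of the standard normal distribution. -/
noncomputable def normalCDF (t : ℝ) : ℝ := normal.real (Iio t)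

theorem normalPDF_eq (t : ℝ) : gaussianPDFReal 0 1 t = normalPDF t := by
  simp [gaussianPDFReal_def, normalPDF, neg_div]

theorem normalPDF_pos (t : ℝ) : 0 < normalPDF t := by unfold normalPDF; positivity

theorem normalPDF_neg (t : ℝ) : normalPDF (-t) = normalPDF t := by simp [normalPDF]

theorem integral_normal (g : ℝ → ℝ) : ∫ z, g z ∂normal = ∫ z, normalPDF z * g z := by
  rw [integral_gaussianReal_eq_integral_smul one_ne_zero]
  simp [normalPDF_eq]

instance : NullSingletonClass normal := nullSingletonClass_gaussianReal one_ne_zero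

theorem normal_real_eq_integral (s : Set ℝ) : normal.real s = ∫ z in s, normalPDF z := by
  rw [measureReal_def, gaussianReal_apply_eq_integral 0 one_ne_zero s, ENNReal.toReal_ofReal]
  · simp [normalPDF_eq]
  · exact integral_nonneg fun z => gaussianPDFReal_nonneg _ _ _

theorem integrable_normalPDF : Integrable normalPDF := by
  have := integrable_gaussianPDFReal 0 1
  simpa only [funext normalPDF_eq] using this

theorem normalPDF_le_zero (t : ℝ) : normalPDF t ≤ normalPDF 0 := by
  unfold normalPDF
  refine mul_le_mul_of_nonneg_left (Real.exp_le_exp.2 ?_) (by positivity)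
  nlinarith [sq_nonneg t]

theorem normalPDF_zero_le : normalPDF 0 ≤ 1 / 2 := by
  have h : 2 ≤ √(2 * Real.pi) := by
    apply Real.le_sqrt_of_sq_le
    linarith [Real.pi_gt_three]
  simp only [normalPDF, ne_eq, OfNat.ofNat_ne_zero, not_false_eq_true, zero_pow, zero_div, neg_zero,
    Real.exp_zero, mul_one]
  rw [one_div]
  gcongr

theorem normalPDF_one_ge : 1 / 5 ≤ normalPDF 1 := by
  have h : √(2 * Real.pi) ≤ 3 := by
    rw [Real.sqrt_le_left (by norm_num)]
    linarith [Real.pi_lt_d2]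
  have h2 : (3 : ℝ) / 5 ≤ Real.exp (-(1 ^ 2 / 2)) := by
    have h3 : Real.exp (1 / 2) ≤ 5 / 3 := by
      have h4 : Real.exp (1 / 2) ^ 2 = Real.exp 1 := by rw [← Real.exp_nat_mul]; norm_num
      have := Real.exp_one_lt_d9
      nlinarith [Real.exp_pos (1 / 2)]
    rw [show -(1 ^ 2 / 2 : ℝ) = -(1 / 2) by norm_num, Real.exp_neg]
    calc (3 / 5 : ℝ) = (5 / 3)⁻¹ := by norm_num
      _ ≤ _ := by gcongr
  calc (1 / 5 : ℝ) = 3⁻¹ * (3 / 5) := by norm_num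
    _ ≤ _ := by unfold normalPDF; gcongr

theorem hasDerivAt_neg_normalPDF (t : ℝ) :
    HasDerivAt (fun t => -normalPDF t) (normalPDF t * t) t := by
  unfold normalPDF
  have h : HasDerivAt (fun t : ℝ => -(t ^ 2 / 2)) (-t) t := by
    have := ((hasDerivAt_pow 2 t).div_const 2).neg
    convert! this using 1
    simp
  convert! (h.exp.const_mul (√(2 * Real.pi))⁻¹).neg using 1
  ring

theorem tendsto_normalPDF : Tendsto normalPDF atTop (𝓝 0) := by
  unfold normalPDF
  rw [← mul_zero (√(2 * Real.pi))⁻¹]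
  refine Tendsto.const_mul _ (Real.tendsto_exp_neg_atTop_nhds_zero.comp ?_)
  exact (tendsto_pow_atTop two_ne_zero).atTop_div_const two_pos

theorem integrable_id_normal : Integrable (fun z : ℝ => z) normal :=
  (memLp_id_gaussianReal (μ := 0) (v := 1) 1).integrable (by simp)

theorem integrable_normalPDF_mul : Integrable fun z => normalPDF z * z := by
  have h := integrable_mul_exp_neg_mul_sq (b := 1 / 2) (by norm_num)
  refine (h.const_mul (√(2 * Real.pi))⁻¹).congr (ae_of_all _ fun z => ?_)
  simp only [normalPDF]
  rw [show -(1 / 2) * z ^ 2 = -(z ^ 2 / 2) by ring]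
  ring

/-- The mean of a standard normal variable above a threshold. -/
theorem integral_indicator_normal (t : ℝ) :
    ∫ z, (Ici t).indicator (fun z => z) z ∂normal = normalPDF t := by
  rw [integral_normal]
  have h : ∀ z, normalPDF z * (Ici t).indicator (fun z => z) z =
      (Ici t).indicator (fun z => normalPDF z * z) z := by
    intro z
    by_cases hz : z ∈ Ici t <;> simp [hz]
  simp only [h]
  rw [integral_indicator measurableSet_Ici, integral_Ici_eq_integral_Ioi,
    integral_Ioi_of_hasDerivAt_of_tendsto' (fun x _ => hasDerivAt_neg_normalPDF x)
      integrable_normalPDF_mul.integrableOn (by simpa using tendsto_normalPDF.neg)]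
  ring

/-- Markov's inequality in the form t·1[z ≥ t] ≤ z·1[z ≥ t], which is valid for negative t as well.
-/
theorem mul_normal_Ici_le (t : ℝ) : t * normal.real (Ici t) ≤ normalPDF t := by
  rw [← integral_indicator_normal]
  have h : t * normal.real (Ici t) = ∫ z, (Ici t).indicator (fun _ => t) z ∂normal := by
    rw [integral_indicator_const _ measurableSet_Ici, smul_eq_mul, mul_comm]
  rw [h]
  refine integral_mono ((integrable_const t).indicator measurableSet_Ici)
    (integrable_id_normal.indicator measurableSet_Ici) fun z => ?_
  by_cases hz : z ∈ Ici t
  · rw [indicator_of_mem hz, indicator_of_mem hz]; exact hz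
  · simp [hz]

theorem normal_Ioc_le {a b M : ℝ} (hab : a ≤ b) (hM : ∀ z, a < z → z ≤ b → normalPDF z ≤ M) :
    normal.real (Ioc a b) ≤ M * (b - a) := by
  rw [normal_real_eq_integral]
  calc ∫ z in Ioc a b, normalPDF z ≤ ∫ _ in Ioc a b, M :=
        setIntegral_mono_on integrable_normalPDF.integrableOn (by simp) measurableSet_Ioc
          fun z hz => hM z hz.1 hz.2
    _ = M * (b - a) := by simp [hab, mul_comm]

theorem normal_neg_preimage {s : Set ℝ} (hs : MeasurableSet s) :
    normal.real ((fun x => -x) ⁻¹' s) = normal.real s := by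
  have h : normal.map (fun x => -x) = normal := by
    rw [normal, gaussianReal_map_neg, neg_zero]
  conv_rhs => rw [← h]
  rw [map_measureReal_apply measurable_neg hs]

theorem normal_Ici_eq (t : ℝ) : normal.real (Ici t) = 1 - normalCDF t := by
  rw [normalCDF, ← compl_Iio, probReal_compl_eq_one_sub measurableSet_Iio]

theorem normalCDF_neg (t : ℝ) : normalCDF (-t) = 1 - normalCDF t := by
  rw [← normal_Ici_eq, normalCDF, measureReal_congr (Iio_ae_eq_Iic' (by simp)),
    ← normal_neg_preimage measurableSet_Ici]
  congr 1
  ext x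
  simp

theorem normalCDF_mono {a b : ℝ} (h : a ≤ b) : normalCDF a ≤ normalCDF b :=
  measureReal_mono (Iio_subset_Iio h)

theorem normalCDF_sub {a b : ℝ} (h : a ≤ b) : normalCDF b - normalCDF a = normal.real (Ico a b) := by
  rw [normalCDF, normalCDF, ← measureReal_sdiff (Iio_subset_Iio h) measurableSet_Iio]
  congr 1
  ext x
  simp

theorem normalCDF_sub_le {a b M : ℝ} (h : a ≤ b)
    (hM : ∀ z, a < z → z ≤ b → normalPDF z ≤ M) : normalCDF b - normalCDF a ≤ M * (b - a) := by
  rw [normalCDF_sub h]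
  have : normal.real (Ico a b) = normal.real (Ioc a b) := measureReal_congr Ico_ae_eq_Ioc
  rw [this]
  exact normal_Ioc_le h hM

theorem normalCDF_zero : normalCDF 0 = 1 / 2 := by
  have := normalCDF_neg 0
  rw [neg_zero] at this
  linarith

theorem continuous_normalCDF : Continuous normalCDF := by
  have h : LipschitzWith 1 normalCDF := by
    refine LipschitzWith.of_le_add fun a b => ?_
    rcases le_total a b with h | h
    · linarith [normalCDF_mono h, dist_nonneg (x := a) (y := b)]
    · have := normalCDF_sub_le h (M := 1) fun z _ _ =>
        (normalPDF_le_zero z).trans (normalPDF_zero_le.trans (by norm_num))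
      rw [Real.dist_eq, abs_of_nonneg (by linarith)]
      linarith
  exact h.continuous

theorem exists_normalCDF_eq {p : ℝ} (h0 : 0 < p) (h1 : p < 1) : ∃ t, normalCDF t = p := by
  have hc : ∀ t, normalCDF t = cdf normal t := fun t => by
    rw [cdf_eq_real, normalCDF]
    exact measureReal_congr Iio_ae_eq_Iic
  have hbot := tendsto_cdf_atBot normal
  have htop := tendsto_cdf_atTop normal
  obtain ⟨a, ha⟩ := (hbot.eventually (eventually_lt_nhds h0)).exists
  obtain ⟨b, hb⟩ := (htop.eventually (eventually_gt_nhds h1)).exists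
  exact mem_range_of_exists_le_of_exists_ge continuous_normalCDF ⟨a, by rw [hc]; exact ha.le⟩
    ⟨b, by rw [hc]; exact hb.le⟩

/-- From t = 1 on, the tail is at most φ(t); below, φ(t) ≥ φ(1) ≥ 1/5 and the tail is at most 1. -/
theorem normal_Ici_le_of_nonneg {t : ℝ} (ht : 0 ≤ t) : normal.real (Ici t) ≤ 5 * normalPDF t := by
  rcases le_total 1 t with h | h
  · have h1 := mul_normal_Ici_le t
    have h2 : normal.real (Ici t) ≤ t * normal.real (Ici t) :=
      le_mul_of_one_le_left measureReal_nonneg h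
    linarith [normalPDF_pos t]
  · have h1 : normalPDF 1 ≤ normalPDF t := by
      unfold normalPDF
      gcongr
    have h2 : normal.real (Ici t) ≤ 1 := measureReal_le_one
    linarith [normalPDF_one_ge]

/-- The smaller of the two tails at `t` is bounded by the density at `t`. -/
theorem min_normalCDF_le (t : ℝ) : min (normalCDF t) (1 - normalCDF t) ≤ 5 * normalPDF t := by
  rcases le_total 0 t with h | h
  · exact (min_le_right _ _).trans (by rw [← normal_Ici_eq]; exact normal_Ici_le_of_nonneg h)
  · refine (min_le_left _ _).trans ?_
    have h1 := normal_Ici_le_of_nonneg (t := -t) (by linarith)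
    rwa [normal_Ici_eq, normalCDF_neg, sub_sub_cancel, normalPDF_neg] at h1

theorem abs_mul_min_normalCDF_le (t : ℝ) :
    |t| * min (normalCDF t) (1 - normalCDF t) ≤ normalPDF t := by
  rcases le_total 0 t with h | h
  · have h1 := mul_normal_Ici_le t
    rw [normal_Ici_eq] at h1
    rw [abs_of_nonneg h]
    exact (mul_le_mul_of_nonneg_left (min_le_right _ _) h).trans h1
  · have h1 := mul_normal_Ici_le (-t)
    rw [normal_Ici_eq, normalCDF_neg, sub_sub_cancel, normalPDF_neg] at h1
    rw [abs_of_nonpos h]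
    exact (mul_le_mul_of_nonneg_left (min_le_left _ _) (by linarith)).trans h1

theorem abs_mul_normalPDF_le (t : ℝ) : |t| * normalPDF t ≤ 1 := by
  have h1 : |t| ≤ Real.exp (t ^ 2 / 2) := by
    have := Real.add_one_le_exp (t ^ 2 / 2)
    nlinarith [sq_nonneg (|t| - 1), sq_abs t]
  have h2 : (√(2 * Real.pi))⁻¹ ≤ 1 := by
    have := normalPDF_zero_le
    simp only [normalPDF, ne_eq, OfNat.ofNat_ne_zero, not_false_eq_true, zero_pow, zero_div,
      neg_zero, Real.exp_zero, mul_one] at this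
    linarith
  calc |t| * normalPDF t = (√(2 * Real.pi))⁻¹ * (|t| * Real.exp (-(t ^ 2 / 2))) := by
        unfold normalPDF; ring
    _ ≤ 1 * (Real.exp (t ^ 2 / 2) * Real.exp (-(t ^ 2 / 2))) := by gcongr
    _ = 1 := by rw [one_mul, ← Real.exp_add]; simp

/-- Enlarging a threshold by a factor close to one changes the distribution function little. -/
theorem abs_normalCDF_mul_sub_le {κ : ℝ} (hκ : 0 ≤ κ) (t : ℝ) :
    |normalCDF (t * (1 + κ)) - normalCDF t| ≤ κ := by
  have key : ∀ t : ℝ, 0 ≤ t → |normalCDF (t * (1 + κ)) - normalCDF t| ≤ κ := by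
    intro t ht
    have h : t ≤ t * (1 + κ) := le_mul_of_one_le_right ht (by linarith)
    rw [abs_of_nonneg (by linarith [normalCDF_mono h])]
    -- The interval has length tκ and density at most φ(t), and tφ(t) ≤ 1.
    refine (normalCDF_sub_le h (M := normalPDF t) fun z hz _ => ?_).trans ?_
    · unfold normalPDF
      gcongr
    · have := abs_mul_normalPDF_le t
      rw [abs_of_nonneg ht] at this
      nlinarith
  rcases le_total 0 t with h | h
  · exact key t h
  · have := key (-t) (by linarith)
    rw [neg_mul, normalCDF_neg, normalCDF_neg, abs_sub_comm] at this
    convert! this using 2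
    ring

/-- The distribution of the square has exponential tails. -/
theorem integral_exp_sq_normal : ∫ z, Real.exp (3 / 8 * z ^ 2) ∂normal = 2 := by
  rw [integral_normal]
  have h : ∀ z : ℝ, normalPDF z * Real.exp (3 / 8 * z ^ 2) =
      (√(2 * Real.pi))⁻¹ * Real.exp (-(1 / 8) * z ^ 2) := by
    intro z
    rw [normalPDF, mul_assoc, ← Real.exp_add]
    congr 2
    ring
  simp only [h]
  rw [integral_const_mul, integral_gaussian, show Real.pi / (1 / 8) = 2 ^ 2 * (2 * Real.pi) by ring,
    Real.sqrt_mul (by norm_num : (0 : ℝ) ≤ 2 ^ 2), Real.sqrt_sq (by norm_num), mul_left_comm,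
    inv_mul_cancel₀ (by positivity), mul_one]

theorem integrable_exp_sq_normal : Integrable (fun z : ℝ => Real.exp (3 / 8 * z ^ 2)) normal := by
  -- The Bochner integral of a non-integrable function is 0 by convention, whereas this one is 2.
  by_contra h
  have := integral_exp_sq_normal
  rw [integral_undef h] at this
  norm_num at this

end gaussian

/-! ### Halfspaces under the standard Gaussian distribution -/

section halfspace

open MeasureTheory ProbabilityTheory Set Filter Topology

variable {n : ℕ}

/-- The standard Gaussian distribution on `ℝⁿ`. -/
noncomputable abbrev gauss (n : ℕ) : Measure (Pt n) := stdGaussian (Pt n)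

theorem map_inner_gauss {u : Pt n} (hu : ‖u‖ = 1) : (gauss n).map (fun x => inner ℝ u x) = normal := by
  have h := IsGaussian.map_eq_gaussianReal (μ := gauss n) (innerSL ℝ u)
  rw [integral_strongDual_stdGaussian, variance_dual_stdGaussian, innerSL_apply_norm, hu] at h
  simpa using h

theorem measurable_inner_left (u : Pt n) : Measurable fun x : Pt n => inner ℝ u x := by fun_prop

theorem integral_comp_inner {u : Pt n} (hu : ‖u‖ = 1) {g : ℝ → ℝ}
    (hg : AEStronglyMeasurable g normal) :
    ∫ x, g (inner ℝ u x) ∂(gauss n) = ∫ z, g z ∂normal := by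
  rw [← map_inner_gauss hu] at hg ⊢
  rw [integral_map (measurable_inner_left u).aemeasurable hg]

theorem integrable_comp_inner {u : Pt n} (hu : ‖u‖ = 1) {g : ℝ → ℝ} (hg : Integrable g normal) :
    Integrable (fun x : Pt n => g (inner ℝ u x)) (gauss n) := by
  rw [← map_inner_gauss hu] at hg
  exact hg.comp_measurable (measurable_inner_left u)

theorem gauss_real_preimage {u : Pt n} (hu : ‖u‖ = 1) {s : Set ℝ} (hs : MeasurableSet s) :
    (gauss n).real {x | inner ℝ u x ∈ s} = normal.real s := by
  rw [← map_inner_gauss hu, map_measureReal_apply (measurable_inner_left u) hs]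
  rfl

theorem integrable_inner (w : Pt n) : Integrable (fun x : Pt n => inner ℝ w x) (gauss n) := by
  have := (IsGaussian.integrable_id (μ := gauss n))
  exact this.const_inner w

/-- The mean of a linear functional over a halfspace. -/
theorem integral_indicator_halfspace {u : Pt n} (hu : ‖u‖ = 1) (θ : ℝ) (w : Pt n) :
    ∫ x, {x | θ ≤ inner ℝ u x}.indicator (fun x => inner ℝ w x) x ∂(gauss n) =
      normalPDF θ * inner ℝ u w := by
  have hmeas : MeasurableSet {x : Pt n | θ ≤ inner ℝ u x} :=
    measurableSet_le measurable_const (measurable_inner_left u)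
  set w' : Pt n := w - (inner ℝ u w : ℝ) • u with hw'
  have horth : inner ℝ u w' = 0 := by
    rw [hw', inner_sub_right, inner_smul_right, real_inner_self_eq_norm_sq, hu]
    ring
  have h1 : ∫ x, {x | θ ≤ inner ℝ u x}.indicator (fun x => inner ℝ u x) x ∂(gauss n) =
      normalPDF θ := by
    rw [← integral_indicator_normal, ← integral_comp_inner hu
      (integrable_id_normal.indicator measurableSet_Ici).aestronglyMeasurable]
    rfl
  have h2 : ∫ x, {x | θ ≤ inner ℝ u x}.indicator (fun x => inner ℝ w' x) x ∂(gauss n) = 0 := by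
    -- The reflection in the line of `u` preserves the Gaussian measure and the halfspace and
    -- changes the sign of ⟨w',x⟩, so this integral is its own negative.
    set R := (ℝ ∙ u).reflection with hR
    have hRu : R u = u := Submodule.reflection_mem_subspace_eq_self
      (Submodule.mem_span_singleton_self u)
    have hRw : R w' = -w' := by
      refine Submodule.reflection_mem_subspace_orthogonalComplement_eq_neg ?_
      rw [Submodule.mem_orthogonal_singleton_iff_inner_right]
      exact horth
    have hin : ∀ a x : Pt n, inner ℝ a (R x) = inner ℝ (R a) x := by
      intro a x
      rw [← R.inner_map_map a (R x), hR, Submodule.reflection_reflection]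
    have hmap : (gauss n).map R = gauss n := stdGaussian_map R
    have h3 : ∫ x, {x | θ ≤ inner ℝ u x}.indicator (fun x => inner ℝ w' x) x ∂(gauss n) =
        ∫ x, -({x | θ ≤ inner ℝ u x}.indicator (fun x => inner ℝ w' x) x) ∂(gauss n) := by
      conv_lhs => rw [← hmap]
      rw [integral_map R.continuous.aemeasurable
        ((integrable_inner w').indicator hmeas |>.aestronglyMeasurable.mono_ac (by rw [hmap]))]
      refine integral_congr_ae (ae_of_all _ fun x => ?_)
      simp only [indicator, mem_ofPred_eq, hin, hRu, hRw, inner_neg_left]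
      split_ifs <;> simp
    rw [integral_neg] at h3
    linarith
  have hw : w = w' + (inner ℝ u w : ℝ) • u := by rw [hw', sub_add_cancel]
  have h4 : ∀ x, {x | θ ≤ inner ℝ u x}.indicator (fun x => inner ℝ w x) x =
      {x | θ ≤ inner ℝ u x}.indicator (fun x => inner ℝ w' x) x +
      inner ℝ u w * {x | θ ≤ inner ℝ u x}.indicator (fun x => inner ℝ u x) x := by
    intro x
    have h5 : inner ℝ w x = inner ℝ w' x + inner ℝ u w * inner ℝ u x := by
      conv_lhs => rw [hw]
      rw [inner_add_left, inner_smul_left]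
      rfl
    simp only [indicator]
    split_ifs
    · exact h5
    · simp
  simp only [h4]
  rw [integral_add ((integrable_inner w').indicator hmeas)
    (((integrable_inner u).indicator hmeas).const_mul _), integral_const_mul, h1, h2]
  ring

theorem gauss_halfspace {u : Pt n} (hu : ‖u‖ = 1) (θ : ℝ) :
    (gauss n).real {x | inner ℝ u x < θ} = normalCDF θ :=
  gauss_real_preimage hu measurableSet_Iio

theorem measurableSet_halfspace (u : Pt n) (θ : ℝ) : MeasurableSet {x : Pt n | inner ℝ u x < θ} :=
  measurableSet_lt (measurable_inner_left u) measurable_const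

theorem gauss_halfspace' {u : Pt n} (hu : ‖u‖ = 1) (θ : ℝ) :
    (gauss n).real {x | θ ≤ inner ℝ u x} = 1 - normalCDF θ := by
  rw [← gauss_halfspace hu, ← probReal_compl_eq_one_sub (measurableSet_halfspace u θ)]
  congr 1
  ext x
  simp

/-- Two parallel halfspaces differ by the difference of their probabilities. -/
theorem gauss_parallel_halfspaces {u : Pt n} (hu : ‖u‖ = 1) (s t : ℝ) :
    (gauss n).real {x | ¬ (s ≤ inner ℝ u x ↔ t ≤ inner ℝ u x)} ≤ |normalCDF s - normalCDF t| := by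
  wlog h : s ≤ t generalizing s t
  · rw [abs_sub_comm]
    convert this t s (by linarith) using 5
    exact iff_comm
  rw [abs_sub_comm, abs_of_nonneg (by linarith [normalCDF_mono h]), normalCDF_sub h,
    ← gauss_real_preimage hu measurableSet_Ico]
  refine measureReal_mono fun x hx => ?_
  simp only [mem_ofPred_eq, mem_Ico] at hx ⊢
  by_cases h1 : s ≤ inner ℝ u x
  · exact ⟨h1, not_le.1 fun h2 => hx (by simp [h1, h2])⟩
  · exact absurd (by simp [h1, not_le.2 ((not_le.1 h1).trans_le h)]) hx

/-- Since |θ(z-θ)| ≤ 1, z² is at least θ² - 2, which costs a factor e < 3. -/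
theorem normalPDF_le_of_near {θ ρ z : ℝ} (hz : |z - θ| ≤ ρ) (h : |θ| * ρ ≤ 1) :
    normalPDF z ≤ 3 * normalPDF θ := by
  have h1 : θ ^ 2 - 2 ≤ z ^ 2 := by
    have h2 : |θ * (z - θ)| ≤ 1 := by
      rw [abs_mul]
      exact (mul_le_mul_of_nonneg_left hz (abs_nonneg _)).trans h
    have h3 := (abs_le.1 h2).1
    nlinarith [sq_nonneg (z - θ)]
  calc normalPDF z ≤ (√(2 * Real.pi))⁻¹ * Real.exp (1 + -(θ ^ 2 / 2)) := by
        unfold normalPDF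
        gcongr
        linarith
    _ = Real.exp 1 * normalPDF θ := by rw [Real.exp_add, normalPDF]; ring
    _ ≤ 3 * normalPDF θ := by
        have := Real.exp_one_lt_d9
        have := normalPDF_pos θ
        gcongr
        linarith

/-- Two halfspaces at the same distance from the origin. -/
theorem gauss_tilted_halfspaces {u v : Pt n} (hu : ‖u‖ = 1) (hv : ‖v‖ = 1) (θ : ℝ) :
    (gauss n).real {x | ¬ (θ ≤ inner ℝ u x ↔ θ ≤ inner ℝ v x)} ≤ 7 * (normalPDF θ * ‖u - v‖) := by
  set ρ := ‖u - v‖ with hρ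
  have hφ := normalPDF_pos θ
  have hρ0 : 0 ≤ ρ := norm_nonneg _
  have hmu : MeasurableSet {x : Pt n | θ ≤ inner ℝ u x} :=
    measurableSet_le measurable_const (measurable_inner_left u)
  have hmv : MeasurableSet {x : Pt n | θ ≤ inner ℝ v x} :=
    measurableSet_le measurable_const (measurable_inner_left v)
  set E : Set (Pt n) := {x | ¬ (θ ≤ inner ℝ u x ↔ θ ≤ inner ℝ v x)} with hE
  -- If |θ|ρ > 1, the angle does not matter: the two smaller sides have measure at most φ(θ)/|θ| ≤
  -- φ(θ)ρ each.
  rcases lt_or_ge 1 (|θ| * ρ) with h | h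
  · have h1 : (gauss n).real E ≤ 2 * min (normalCDF θ) (1 - normalCDF θ) := by
      rw [mul_min_of_nonneg _ _ zero_le_two, le_min_iff]
      constructor
      · calc (gauss n).real E ≤ (gauss n).real ({x | inner ℝ u x < θ} ∪ {x | inner ℝ v x < θ}) := by
              refine measureReal_mono fun x hx => ?_
              simp only [hE, mem_ofPred_eq, mem_union, ← not_le] at hx ⊢
              tauto
          _ ≤ _ := measureReal_union_le _ _
          _ = 2 * normalCDF θ := by rw [gauss_halfspace hu, gauss_halfspace hv]; ring
      · calc (gauss n).real E ≤ (gauss n).real ({x | θ ≤ inner ℝ u x} ∪ {x | θ ≤ inner ℝ v x}) := by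
              refine measureReal_mono fun x hx => ?_
              simp only [hE, mem_ofPred_eq, mem_union] at hx ⊢
              tauto
          _ ≤ _ := measureReal_union_le _ _
          _ = 2 * (1 - normalCDF θ) := by rw [gauss_halfspace' hu, gauss_halfspace' hv]; ring
    have h2 := abs_mul_min_normalCDF_le θ
    have h3 : 0 ≤ min (normalCDF θ) (1 - normalCDF θ) :=
      le_min measureReal_nonneg (by rw [← normal_Ici_eq]; exact measureReal_nonneg)
    have h4 : min (normalCDF θ) (1 - normalCDF θ) ≤ normalPDF θ * ρ := by
      nlinarith [mul_le_mul_of_nonneg_right h2 hρ0]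
    nlinarith [mul_nonneg hφ.le hρ0]
  · rcases hρ0.eq_or_lt with h0 | h0
    · have : u = v := by rw [← sub_eq_zero, ← norm_eq_zero, ← hρ, ← h0]
      simp [hE, this, ← h0]
    -- `F` is |⟨v,x⟩ - θ| on the symmetric difference and 0 elsewhere. Both halfspaces have the same
    -- measure, so the θ-terms cancel and its integral is φ(θ)(1 - ⟨u,v⟩) = φ(θ)ρ²/2, quadratic in
    -- ρ.
    set F : Pt n → ℝ := fun x => {x : Pt n | θ ≤ inner ℝ v x}.indicator (fun x => inner ℝ v x) x -
      {x : Pt n | θ ≤ inner ℝ u x}.indicator (fun x => inner ℝ v x) x -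
      θ * ({x : Pt n | θ ≤ inner ℝ v x}.indicator (fun _ => 1) x -
      {x : Pt n | θ ≤ inner ℝ u x}.indicator (fun _ => 1) x) with hF
    have hFE : ∀ x, F x = E.indicator (fun x => |inner ℝ v x - θ|) x := by
      intro x
      simp only [hF, hE, indicator, mem_ofPred_eq]
      by_cases h1 : θ ≤ inner ℝ v x <;> by_cases h2 : θ ≤ inner ℝ u x
      · simp [h1, h2]
      · simp [h1, h2, abs_of_nonneg (sub_nonneg.2 h1)]
      · simp [h1, h2, abs_of_neg (sub_neg.2 (not_le.1 h1))]; ring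
      · simp [h1, h2]
    have i1 := (integrable_inner v).indicator hmv
    have i2 := (integrable_inner v).indicator hmu
    have i3 := (integrable_const (1 : ℝ) (μ := gauss n)).indicator hmv
    have i4 := (integrable_const (1 : ℝ) (μ := gauss n)).indicator hmu
    have hFint : Integrable F (gauss n) := (i1.sub i2).sub ((i3.sub i4).const_mul θ)
    have hFval : ∫ x, F x ∂(gauss n) = normalPDF θ * (ρ ^ 2 / 2) := by
      have h1 : inner ℝ u v = 1 - ρ ^ 2 / 2 := by
        have := norm_sub_sq_real u v
        rw [hu, hv, ← hρ] at this
        linarith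
      refine (integral_sub (i1.sub i2) ((i3.sub i4).const_mul θ)).trans ?_
      rw [integral_sub' i1 i2,
        integral_const_mul, integral_sub' i3 i4, integral_indicator_halfspace hv,
        integral_indicator_halfspace hu, integral_indicator_const _ hmv,
        integral_indicator_const _ hmu, gauss_halfspace' hu, gauss_halfspace' hv, h1,
        real_inner_self_eq_norm_sq, hv]
      simp
      ring
    have hmE : MeasurableSet E := by
      have : E = symmDiff {x : Pt n | θ ≤ inner ℝ u x} {x : Pt n | θ ≤ inner ℝ v x} := by
        ext x
        simp only [hE, mem_ofPred_eq, mem_symmDiff]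
        tauto
      rw [this]
      exact hmu.symmDiff hmv
    -- Markov's inequality for `F` handles the points at distance at least ρ from the boundary; the
    -- others lie in a slab of width 2ρ on which the density is at most 3φ(θ).
    set E1 : Set (Pt n) := E ∩ {x | ρ ≤ |inner ℝ v x - θ|} with hE1
    have hmE1 : MeasurableSet E1 :=
      hmE.inter (measurableSet_le measurable_const
        (((measurable_inner_left v).sub_const θ).norm))
    have hfar : (gauss n).real E1 ≤ normalPDF θ * (ρ / 2) := by
      have h1 : ρ * (gauss n).real E1 ≤ normalPDF θ * (ρ ^ 2 / 2) := by
        rw [← hFval]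
        calc ρ * (gauss n).real E1 = ∫ x, E1.indicator (fun _ => ρ) x ∂(gauss n) := by
              rw [integral_indicator_const _ hmE1, smul_eq_mul, mul_comm]
          _ ≤ ∫ x, F x ∂(gauss n) := by
              refine integral_mono ((integrable_const ρ).indicator hmE1) hFint fun x => ?_
              simp only [hFE]
              by_cases hx : x ∈ E1
              · rw [indicator_of_mem hx, indicator_of_mem hx.1]
                exact hx.2
              · rw [indicator_of_notMem hx]
                exact indicator_nonneg (fun _ _ => abs_nonneg _) _
      have h2 : ρ * (gauss n).real E1 ≤ ρ * (normalPDF θ * (ρ / 2)) := by linarith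
      exact le_of_mul_le_mul_left h2 h0
    have hnear : (gauss n).real {x | inner ℝ v x ∈ Ioc (θ - ρ) (θ + ρ)} ≤
        3 * normalPDF θ * (2 * ρ) := by
      rw [gauss_real_preimage hv measurableSet_Ioc]
      refine (normal_Ioc_le (by linarith) fun z hz1 hz2 => normalPDF_le_of_near (ρ := ρ)
        (abs_le.2 ⟨by linarith, by linarith⟩) h).trans (le_of_eq ?_)
      ring
    calc (gauss n).real E ≤ (gauss n).real (E1 ∪ {x | inner ℝ v x ∈ Ioc (θ - ρ) (θ + ρ)}) := by
          refine measureReal_mono fun x hx => ?_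
          by_cases h1 : ρ ≤ |inner ℝ v x - θ|
          · exact Or.inl ⟨hx, h1⟩
          · have h2 := abs_lt.1 (not_le.1 h1)
            exact Or.inr ⟨by linarith, by linarith⟩
      _ ≤ _ := measureReal_union_le _ _
      _ ≤ normalPDF θ * (ρ / 2) + 3 * normalPDF θ * (2 * ρ) := add_le_add hfar hnear
      _ ≤ 7 * (normalPDF θ * ρ) := by nlinarith [mul_nonneg hφ.le hρ0]

end halfspace

/-! ### Concentration of the clean sample -/

section concentration

open MeasureTheory ProbabilityTheory Set Filter Topology

variable {n m : ℕ}

instance : IsProbabilityMeasure (cleanLaw n m) := by unfold cleanLaw; infer_instance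

/-- Chebyshev's inequality for the sum of a function over the sample. -/
theorem cleanLaw_chebyshev {g : Pt n → ℝ} {V t : ℝ} (hg : Measurable g)
    (hi : Integrable (fun x => g x ^ 2) (gauss n)) (hV : ∫ x, g x ^ 2 ∂(gauss n) ≤ V)
    (ht : 0 < t) (hm : 0 < m) :
    (cleanLaw n m).real {X | t * m ≤ |∑ i, g (X i) - m * ∫ x, g x ∂(gauss n)|} ≤
      V / (m * t ^ 2) := by
  have hm' : (0 : ℝ) < m := by exact_mod_cast hm
  have hg2 : MemLp g 2 (gauss n) := (memLp_two_iff_integrable_sq hg.aestronglyMeasurable).2 hi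
  have hcomp : ∀ i : Fin m, MeasurePreserving (fun X : Fin m → Pt n => X i) (cleanLaw n m) (gauss n) :=
    fun i => measurePreserving_eval _ i
  have hgi : ∀ i : Fin m, MemLp (fun X : Fin m → Pt n => g (X i)) 2 (cleanLaw n m) :=
    fun i => hg2.comp_measurePreserving (hcomp i)
  have hS : MemLp (fun X : Fin m → Pt n => ∑ i, g (X i)) 2 (cleanLaw n m) :=
    memLp_finsetSum _ fun i _ => hgi i
  have hmean : ∫ X, ∑ i, g (X i) ∂(cleanLaw n m) = m * ∫ x, g x ∂(gauss n) := by
    rw [integral_finsetSum _ fun i _ => (hgi i).integrable one_le_two]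
    have : ∀ i : Fin m, ∫ X, g (X i) ∂(cleanLaw n m) = ∫ x, g x ∂(gauss n) := fun i => by
      rw [← (hcomp i).map_eq, integral_map (hcomp i).measurable.aemeasurable
        hg.aestronglyMeasurable]
    simp [this]
  have hvar : Var[fun X : Fin m → Pt n => ∑ i, g (X i); cleanLaw n m] ≤ m * V := by
    have h1 := variance_sum_pi (μ := fun _ : Fin m => gauss n) (X := fun _ => g) fun _ => hg2
    have h2 : (∑ i : Fin m, fun X : Fin m → Pt n => g (X i)) =
        fun X : Fin m → Pt n => ∑ i, g (X i) := by
      ext X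
      simp
    rw [h2] at h1
    have h3 : Var[g; gauss n] ≤ V :=
      (variance_le_expectation_sq hg.aestronglyMeasurable).trans (by simpa using hV)
    calc _ = ∑ _i : Fin m, Var[g; gauss n] := h1
      _ ≤ ∑ _i : Fin m, V := Finset.sum_le_sum fun _ _ => h3
      _ = m * V := by simp
  have h := meas_ge_le_variance_div_sq hS (c := t * m) (by positivity)
  rw [hmean] at h
  refine (ENNReal.toReal_mono ENNReal.ofReal_ne_top h).trans ?_
  rw [ENNReal.toReal_ofReal (div_nonneg (variance_nonneg _ _) (by positivity))]
  calc _ ≤ m * V / (t * m) ^ 2 := by gcongr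
    _ = V / (m * t ^ 2) := by field_simp

theorem integrable_pow_four_normal : Integrable (fun z : ℝ => z ^ 4) normal ∧
    ∫ z, z ^ 4 ∂normal ≤ 29 := by
  -- From exp x ≥ x²/2 at x = 3z²/8.
  have h : ∀ z : ℝ, z ^ 4 ≤ 128 / 9 * Real.exp (3 / 8 * z ^ 2) := by
    intro z
    have := Real.quadratic_le_exp_of_nonneg (x := 3 / 8 * z ^ 2) (by positivity)
    nlinarith [sq_nonneg z]
  have hi := integrable_exp_sq_normal.const_mul (128 / 9)
  have h1 : Integrable (fun z : ℝ => z ^ 4) normal := by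
    refine hi.mono' (by fun_prop) (ae_of_all _ fun z => ?_)
    rw [Real.norm_of_nonneg (by positivity)]
    exact h z
  refine ⟨h1, (integral_mono h1 hi h).trans ?_⟩
  rw [integral_const_mul, integral_exp_sq_normal]
  norm_num

theorem inner_basis (l : Fin n) (x : Pt n) :
    inner ℝ (EuclideanSpace.single l (1 : ℝ)) x = x l := by
  rw [EuclideanSpace.inner_single_left]
  simp

theorem integral_coord_mul (k l : Fin n) :
    ∫ x, x k * x l ∂(gauss n) = if k = l then 1 else 0 := by
  have h := covarianceBilin_apply (μ := gauss n) IsGaussian.memLp_two_id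
    (EuclideanSpace.single k (1 : ℝ)) (EuclideanSpace.single l (1 : ℝ))
  rw [covarianceBilin_stdGaussian] at h
  simp only [id, integral_id_stdGaussian, sub_zero, inner_basis] at h
  rw [← h, innerSL_apply_apply, inner_basis]
  simp

theorem integrable_coord_pow_four (l : Fin n) : Integrable (fun x : Pt n => x l ^ 4) (gauss n) ∧
    ∫ x, x l ^ 4 ∂(gauss n) ≤ 29 := by
  have hu : ‖EuclideanSpace.single l (1 : ℝ)‖ = 1 := by simp
  have h1 := integrable_comp_inner hu integrable_pow_four_normal.1
  have h2 := integral_comp_inner hu integrable_pow_four_normal.1.aestronglyMeasurable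
  simp only [inner_basis] at h1 h2
  exact ⟨h1, h2 ▸ integrable_pow_four_normal.2⟩

theorem measurable_coord (l : Fin n) : Measurable fun x : Pt n => x l := by fun_prop

theorem cleanLaw_coord_mul {t : ℝ} (ht : 0 < t) (hm : 0 < m) (k l : Fin n) :
    (cleanLaw n m).real {X | t * m ≤ |∑ i, X i k * X i l - m * if k = l then 1 else 0|} ≤
      29 / (m * t ^ 2) := by
  have h : ∀ x : Pt n, (x k * x l) ^ 2 ≤ (x k ^ 4 + x l ^ 4) / 2 := fun x => by
    nlinarith [sq_nonneg (x k ^ 2 - x l ^ 2)]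
  have hi : Integrable (fun x : Pt n => (x k ^ 4 + x l ^ 4) / 2) (gauss n) :=
    ((integrable_coord_pow_four k).1.add (integrable_coord_pow_four l).1).div_const 2
  have hmeas : Measurable fun x : Pt n => x k * x l := (measurable_coord k).mul (measurable_coord l)
  have hi2 : Integrable (fun x : Pt n => (x k * x l) ^ 2) (gauss n) := by
    refine hi.mono' (hmeas.pow_const 2).aestronglyMeasurable (ae_of_all _ fun x => ?_)
    rw [Real.norm_of_nonneg (sq_nonneg _)]
    exact h x
  have key := cleanLaw_chebyshev (g := fun x : Pt n => x k * x l) (V := 29) hmeas hi2 ?_ ht hm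
  · simpa only [integral_coord_mul] using key
  refine (integral_mono hi2 hi h).trans ?_
  rw [integral_div, integral_add (integrable_coord_pow_four k).1 (integrable_coord_pow_four l).1]
  linarith [(integrable_coord_pow_four k).2, (integrable_coord_pow_four l).2]

theorem cleanLaw_mul_coord {t : ℝ} (ht : 0 < t) (hm : 0 < m) {f : Pt n → ℝ} (hf : Measurable f)
    (hf1 : ∀ x, f x ^ 2 = 1) (l : Fin n) :
    (cleanLaw n m).real {X | t * m ≤ |∑ i, f (X i) * X i l - m * ∫ x, f x * x l ∂(gauss n)|} ≤
      1 / (m * t ^ 2) := by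
  have h : ∀ x : Pt n, (f x * x l) ^ 2 = x l * x l := fun x => by
    rw [mul_pow, hf1, one_mul, sq]
  have hi : Integrable (fun x : Pt n => x l * x l) (gauss n) := by
    by_contra h1
    have := integral_coord_mul l l
    rw [integral_undef h1] at this
    simp at this
  refine cleanLaw_chebyshev (g := fun x : Pt n => f x * x l) (V := 1) (hf.mul (measurable_coord l))
    ?_ ?_ ht hm
  · simpa only [h] using hi
  · simp only [h, integral_coord_mul]
    simp

theorem cleanLaw_bounded {t : ℝ} (ht : 0 < t) (hm : 0 < m) {g : Pt n → ℝ} (hg : Measurable g)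
    (hg1 : ∀ x, |g x| ≤ 1) :
    (cleanLaw n m).real {X | t * m ≤ |∑ i, g (X i) - m * ∫ x, g x ∂(gauss n)|} ≤
      1 / (m * t ^ 2) := by
  have h : ∀ x, g x ^ 2 ≤ 1 := fun x => by
    rw [← sq_abs]
    exact pow_le_one₀ (abs_nonneg _) (hg1 x)
  have hi : Integrable (fun x => g x ^ 2) (gauss n) := by
    refine (integrable_const (1 : ℝ)).mono' (by fun_prop) (ae_of_all _ fun x => ?_)
    rw [Real.norm_of_nonneg (sq_nonneg _)]
    exact h x
  refine cleanLaw_chebyshev hg hi ?_ ht hm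
  exact (integral_mono hi (integrable_const 1) h).trans (by simp)

/-- The Chernoff bound for the tail of the sample in one direction. -/
theorem cleanLaw_tail {ε : ℝ} {L : ℕ} (hL : (1 / 2 : ℝ) ^ L ≤ ε) {u : Pt n}
    (hu : ‖u‖ = 1) :
    (cleanLaw n m).real {X | 8 * ε * m ≤ ∑ i, max (inner ℝ u (X i) ^ 2 - 3 * L) 0} ≤
      Real.exp (-(ε * m)) := by
  set ψ : ℝ → ℝ := fun z => Real.exp (3 / 8 * max (z ^ 2 - 3 * L) 0) with hψ
  have hexpL : Real.exp (-(9 / 8 * L)) ≤ ε := by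
    refine le_trans ?_ hL
    have h1 : Real.exp (-1) ≤ 1 / 2 := by
      rw [Real.exp_neg, one_div]
      refine inv_anti₀ two_pos ?_
      have := Real.add_one_le_exp 1
      linarith
    calc Real.exp (-(9 / 8 * L)) ≤ Real.exp (L * (-1)) := by
          refine Real.exp_le_exp.2 ?_
          have : (0 : ℝ) ≤ L := by positivity
          linarith
      _ = Real.exp (-1) ^ L := Real.exp_nat_mul _ _
      _ ≤ _ := pow_le_pow_left₀ (Real.exp_pos _).le h1 _
  have hψle : ∀ z, ψ z ≤ 1 + Real.exp (-(9 / 8 * L)) * Real.exp (3 / 8 * z ^ 2) := by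
    intro z
    simp only [hψ]
    rw [← Real.exp_add]
    rcases le_total (z ^ 2 - 3 * L) 0 with h | h
    · rw [max_eq_right h, mul_zero, Real.exp_zero]
      linarith [Real.exp_pos (-(9 / 8 * L) + 3 / 8 * z ^ 2)]
    · rw [max_eq_left h]
      have : (3 / 8 * (z ^ 2 - 3 * L) : ℝ) = -(9 / 8 * L) + 3 / 8 * z ^ 2 := by ring
      rw [this]
      linarith
  have hbi : Integrable (fun z => 1 + Real.exp (-(9 / 8 * L)) * Real.exp (3 / 8 * z ^ 2)) normal :=
    (integrable_const 1).add (integrable_exp_sq_normal.const_mul _)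
  have hψi : Integrable ψ normal := by
    refine hbi.mono' (by fun_prop) (ae_of_all _ fun z => ?_)
    rw [Real.norm_of_nonneg (Real.exp_pos _).le]
    exact hψle z
  -- The cutoff 3L contributes the factor exp(-9L/8) ≤ 2^(-L) ≤ ε, so the integral is at most 1 +
  -- 2ε.
  have hψint : ∫ z, ψ z ∂normal ≤ Real.exp (2 * ε) := by
    refine (integral_mono hψi hbi hψle).trans ?_
    rw [integral_add (integrable_const 1) (integrable_exp_sq_normal.const_mul _),
      integral_const_mul, integral_exp_sq_normal]
    have := Real.add_one_le_exp (2 * ε)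
    simp
    linarith
  have hexp : ∀ X : Fin m → Pt n,
      Real.exp (3 / 8 * ∑ i, max (inner ℝ u (X i) ^ 2 - 3 * L) 0) = ∏ i, ψ (inner ℝ u (X i)) := by
    intro X
    rw [Finset.mul_sum, Real.exp_sum]
  have hint : Integrable (fun X : Fin m → Pt n =>
      Real.exp (3 / 8 * ∑ i, max (inner ℝ u (X i) ^ 2 - 3 * L) 0)) (cleanLaw n m) := by
    simp only [hexp]
    exact Integrable.fintype_prod (f := fun (_ : Fin m) x => ψ (inner ℝ u x))
      fun _ => integrable_comp_inner hu hψi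
  refine (measure_ge_le_exp_mul_mgf (8 * ε * m) (t := 3 / 8) (by norm_num) hint).trans ?_
  have hmgf : mgf (fun X : Fin m → Pt n => ∑ i, max (inner ℝ u (X i) ^ 2 - 3 * L) 0)
      (cleanLaw n m) (3 / 8) ≤ Real.exp (2 * ε * m) := by
    rw [mgf]
    simp only [hexp]
    rw [cleanLaw, integral_fintype_prod_eq_pow (fun x => ψ (inner ℝ u x)),
      integral_comp_inner hu hψi.aestronglyMeasurable, Fintype.card_fin, mul_comm (2 * ε),
      Real.exp_nat_mul]
    exact pow_le_pow_left₀ (integral_nonneg fun z => (Real.exp_pos _).le) hψint _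
  calc _ ≤ Real.exp (-(3 / 8) * (8 * ε * m)) * Real.exp (2 * ε * m) := by gcongr
    _ = Real.exp (-(ε * m)) := by rw [← Real.exp_add]; congr 1; ring

end concentration

/-! ### The good event for the clean sample and its probability. -/

section cleanSample

open MeasureTheory ProbabilityTheory Set Filter Topology

variable {n m : ℕ} {ε : ℝ} {L : ℕ} {X : Fin m → Pt n}

/-- The label of `x` as a real number. -/
noncomputable def LTF.sgn (f : LTF n) (x : Pt n) : ℝ := ((f.label x : ℤ) : ℝ)

theorem LTF.sgn_eq (f : LTF n) (x : Pt n) :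
    f.sgn x = if 0 ≤ inner ℝ f.v x + f.θ then 1 else -1 := by
  unfold LTF.sgn LTF.label
  split_ifs <;> simp

theorem LTF.measurable_sgn (f : LTF n) : Measurable f.sgn := by
  simp only [funext f.sgn_eq]
  exact Measurable.ite (measurableSet_le measurable_const
    ((measurable_inner_left _).add_const _)) measurable_const measurable_const

theorem LTF.sgn_sq (f : LTF n) (x : Pt n) : f.sgn x ^ 2 = 1 := by
  rw [f.sgn_eq]
  split_ifs <;> norm_num

/-- The degree one Chow parameters. -/
noncomputable def LTF.chow (f : LTF n) (l : Fin n) : ℝ := ∫ x, f.sgn x * x l ∂(gauss n)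

/-- The probability of the label `-1`. -/
noncomputable def LTF.negProb (f : LTF n) : ℝ := (gauss n).real {x | f.label x = -1}

theorem LTF.label_eq_neg_one_iff (f : LTF n) (x : Pt n) :
    f.label x = -1 ↔ inner ℝ f.v x + f.θ < 0 := by
  unfold LTF.label
  split_ifs with h
  · simp [h]
  · simpa using h

theorem LTF.integral_neg (f : LTF n) : ∫ x, (1 - f.sgn x) / 2 ∂(gauss n) = f.negProb := by
  have hm : MeasurableSet {x | f.label x = -1} := by
    simp only [f.label_eq_neg_one_iff]
    exact measurableSet_lt ((measurable_inner_left _).add_const _) measurable_const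
  have h : ∀ x, (1 - f.sgn x) / 2 = {x | f.label x = -1}.indicator (fun _ => (1 : ℝ)) x := by
    intro x
    rw [f.sgn_eq]
    by_cases hx : inner ℝ f.v x + f.θ < 0
    · have hx' : x ∈ {x | f.label x = -1} := (f.label_eq_neg_one_iff x).2 hx
      rw [indicator_of_mem hx', if_neg (not_le.2 hx)]
      norm_num
    · have hx' : x ∉ {x | f.label x = -1} := fun h => hx ((f.label_eq_neg_one_iff x).1 h)
      rw [indicator_of_notMem hx', if_pos (not_lt.1 hx)]
      norm_num
  simp only [h]
  rw [integral_indicator_const _ hm]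
  simp [LTF.negProb]

/-- What the analysis needs to know about the clean sample. -/
structure CleanSample [NeZero n] (ε : ℝ) (L : ℕ) (f : LTF n) (s₁ s₂ : ℝ) (X : Fin m → Pt n) :
    Prop where
  moments : CleanMoments ε L X
  mean : ∀ u : Fin n → ℝ, |∑ i, f.sgn (X i) * (∑ l, X i l * u l) - m * ∑ l, f.chow l * u l| ≤
    ε * m * √(∑ l, u l * u l)
  label : |∑ i, (1 - f.sgn (X i)) / 2 - m * f.negProb| < ε / 2 * m
  cdf₁ : |∑ i, (Iio s₁).indicator (fun _ => (1 : ℝ)) (X i 0) - m * normalCDF s₁| < ε / 2 * m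
  cdf₂ : |∑ i, (Iio s₂).indicator (fun _ => (1 : ℝ)) (X i 0) - m * normalCDF s₂| < ε / 2 * m

/-- Entrywise accuracy ε/n is enough for all directions at once, because (∑|u_l|)² ≤ n∑u_l². -/
theorem abs_sum_sq_sub_le
    (h : ∀ k l, |∑ i, X i k * X i l - m * if k = l then 1 else 0| ≤ ε / n * m) (u : Fin n → ℝ) :
    |∑ i, (∑ l, X i l * u l) * (∑ l, X i l * u l) - m * ∑ l, u l * u l| ≤
      ε * m * ∑ l, u l * u l := by
  rcases Nat.eq_zero_or_pos n with rfl | hn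
  · simp
  have hn' : (0 : ℝ) < n := by exact_mod_cast hn
  have hεm : 0 ≤ ε / n * m := (abs_nonneg _).trans (h ⟨0, hn⟩ ⟨0, hn⟩)
  have h1 : ∑ i, (∑ l, X i l * u l) * (∑ l, X i l * u l) - m * ∑ l, u l * u l =
      ∑ k, ∑ l, u k * u l * (∑ i, X i k * X i l - m * if k = l then 1 else 0) := by
    simp only [mul_sub, Finset.sum_sub_distrib]
    congr 1
    · have h2 : ∀ i, (∑ l, X i l * u l) * (∑ l, X i l * u l) =
          ∑ k, ∑ l, u k * u l * (X i k * X i l) := fun i => by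
        rw [Finset.sum_mul_sum]
        exact Finset.sum_congr rfl fun k _ => Finset.sum_congr rfl fun l _ => by ring
      rw [Finset.sum_congr rfl fun i _ => h2 i, Finset.sum_comm]
      refine Finset.sum_congr rfl fun k _ => ?_
      rw [Finset.sum_comm]
      exact Finset.sum_congr rfl fun l _ => by rw [Finset.mul_sum]
    · rw [Finset.mul_sum]
      refine Finset.sum_congr rfl fun k _ => ?_
      simp only [mul_ite, mul_one, mul_zero, Finset.sum_ite_eq, Finset.mem_univ, if_true]
      ring
  rw [h1]
  calc _ ≤ ∑ k, ∑ l, |u k| * |u l| * (ε / n * m) := by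
        refine (Finset.abs_sum_le_sum_abs _ _).trans (Finset.sum_le_sum fun k _ =>
          (Finset.abs_sum_le_sum_abs _ _).trans (Finset.sum_le_sum fun l _ => ?_))
        rw [abs_mul, abs_mul]
        exact mul_le_mul_of_nonneg_left (h k l) (by positivity)
    _ = (∑ k, |u k|) ^ 2 * (ε / n * m) := by
        rw [sq, Finset.sum_mul_sum, Finset.sum_mul]
        exact Finset.sum_congr rfl fun k _ => by rw [Finset.sum_mul]
    _ ≤ (n * ∑ l, u l * u l) * (ε / n * m) := by
        refine mul_le_mul_of_nonneg_right ?_ hεm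
        have := sq_sum_le_card_mul_sum_sq (s := (Finset.univ : Finset (Fin n))) (f := fun k => |u k|)
        simpa [sq_abs, sq] using this
    _ = ε * m * ∑ l, u l * u l := by field_simp

theorem abs_sum_mul_sub_le {y : Fin m → ℝ} {c : Fin n → ℝ}
    (h : ∀ l, |∑ i, y i * X i l - m * c l| ≤ ε / n * m) (u : Fin n → ℝ) :
    |∑ i, y i * (∑ l, X i l * u l) - m * ∑ l, c l * u l| ≤ ε * m * √(∑ l, u l * u l) := by
  rcases Nat.eq_zero_or_pos n with rfl | hn
  · simp
  have hn' : (0 : ℝ) < n := by exact_mod_cast hn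
  have hεm : 0 ≤ ε / n * m := (abs_nonneg _).trans (h ⟨0, hn⟩)
  have h1 : ∑ i, y i * (∑ l, X i l * u l) - m * ∑ l, c l * u l =
      ∑ l, u l * (∑ i, y i * X i l - m * c l) := by
    simp only [mul_sub, Finset.sum_sub_distrib, Finset.mul_sum]
    congr 1
    · rw [Finset.sum_comm]
      exact Finset.sum_congr rfl fun l _ => Finset.sum_congr rfl fun i _ => by ring
    · exact Finset.sum_congr rfl fun l _ => by ring
  rw [h1]
  calc _ ≤ ∑ l, |u l| * (ε / n * m) := by
        refine (Finset.abs_sum_le_sum_abs _ _).trans (Finset.sum_le_sum fun l _ => ?_)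
        rw [abs_mul]
        exact mul_le_mul_of_nonneg_left (h l) (abs_nonneg _)
    _ ≤ ∑ _l : Fin n, √(∑ l, u l * u l) * (ε / n * m) := by
        refine Finset.sum_le_sum fun l _ => mul_le_mul_of_nonneg_right ?_ hεm
        refine Real.abs_le_sqrt ?_
        rw [sq]
        exact Finset.single_le_sum (f := fun l => u l * u l) (fun _ _ => mul_self_nonneg _)
          (Finset.mem_univ l)
    _ = ε * m * √(∑ l, u l * u l) := by
        rw [Finset.sum_const, Finset.card_univ, Fintype.card_fin, nsmul_eq_mul]
        field_simp

/-- Rounding towards 0, so that rounding the coordinates of a vector does not increase its norm. -/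
theorem exists_int_near (r : ℝ) : ∃ z : ℤ, |(z : ℝ)| ≤ |r| ∧ |r - z| ≤ 1 := by
  rcases le_total 0 r with h | h
  · refine ⟨⌊r⌋, ?_, ?_⟩
    · rw [abs_of_nonneg h, abs_of_nonneg (by exact_mod_cast Int.floor_nonneg.2 h)]
      exact Int.floor_le r
    · rw [abs_of_nonneg (by linarith [Int.floor_le r])]
      linarith [Int.lt_floor_add_one r]
  · refine ⟨⌈r⌉, ?_, ?_⟩
    · have : (⌈r⌉ : ℝ) ≤ 0 := by exact_mod_cast Int.ceil_le.2 (by simpa using h)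
      rw [abs_of_nonpos h, abs_of_nonpos this]
      linarith [Int.le_ceil r]
    · rw [abs_of_nonpos (by linarith [Int.le_ceil r])]
      linarith [Int.ceil_lt_add_one r]

/-- An integer vector as a point. -/
noncomputable def intPt (z : Fin n → ℤ) : Pt n := WithLp.toLp 2 fun l => (z l : ℝ)

theorem inner_eq_sum (x u : Pt n) : inner ℝ x u = ∑ l, u l * x l := by
  simp [PiLp.inner_apply]

/-- Small tails in the directions of a grid imply small tails in all directions. -/
theorem sum_tail_le {N : ℕ} (hε : 0 < ε) (hε1 : ε ≤ 1 / 2) (hn : 1 ≤ n) (hN : 2 * n / ε ≤ N)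
    (hup : ∀ u : Fin n → ℝ, ∑ i, (∑ l, X i l * u l) * ∑ l, X i l * u l ≤
      (1 + ε) * m * ∑ l, u l * u l)
    (d : (Fin n → ℤ) → Pt n) (hd : ∀ z x, inner ℝ (intPt z) x = ‖intPt z‖ * inner ℝ (d z) x)
    (ht : ∀ z ∈ Fintype.piFinset fun _ : Fin n => Finset.Icc (-N : ℤ) N,
      ∑ i, max (inner ℝ (d z) (X i) ^ 2 - 3 * L) 0 ≤ 8 * ε * m) (u : Fin n → ℝ) :
    ∑ i, max ((∑ l, X i l * u l) * (∑ l, X i l * u l) - 6 * L * ∑ l, u l * u l) 0 ≤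
      17 * ε * m * ∑ l, u l * u l := by
  have hn' : (1 : ℝ) ≤ n := by exact_mod_cast hn
  have hN0 : (0 : ℝ) < N := lt_of_lt_of_le (by positivity) hN
  have unit : ∀ u : Fin n → ℝ, ∑ l, u l * u l = 1 →
      ∑ i, max ((∑ l, X i l * u l) * (∑ l, X i l * u l) - 6 * L) 0 ≤ 17 * ε * m := by
    intro u hu
    choose z hz1 hz2 using fun l => exists_int_near (u l * N)
    have hzN : ∀ l, |(z l : ℝ)| ≤ N := by
      intro l
      refine (hz1 l).trans ?_
      rw [abs_mul, abs_of_pos hN0]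
      refine mul_le_of_le_one_left hN0.le ?_
      have h1 : u l * u l ≤ 1 := by
        rw [← hu]
        exact Finset.single_le_sum (f := fun l => u l * u l) (fun _ _ => mul_self_nonneg _)
          (Finset.mem_univ l)
      exact abs_le_one_iff_mul_self_le_one.2 h1
    have hzmem : z ∈ Fintype.piFinset fun _ : Fin n => Finset.Icc (-N : ℤ) N := by
      rw [Fintype.mem_piFinset]
      intro l
      have := abs_le.1 (hzN l)
      rw [Finset.mem_Icc]
      constructor
      · exact_mod_cast this.1
      · exact_mod_cast this.2
    have hnorm : ‖intPt z‖ ^ 2 ≤ N ^ 2 := by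
      rw [EuclideanSpace.real_norm_sq_eq]
      calc ∑ l, intPt z l ^ 2 ≤ ∑ l, (u l * u l) * N ^ 2 := by
            refine Finset.sum_le_sum fun l _ => ?_
            have := sq_le_sq.2 (hz1 l)
            simp only [intPt]
            nlinarith
        _ = N ^ 2 := by rw [← Finset.sum_mul, hu, one_mul]
    set e : Fin n → ℝ := fun l => u l - z l / N with he
    have he2 : ∑ l, e l * e l ≤ n / N ^ 2 := by
      calc ∑ l, e l * e l ≤ ∑ _l : Fin n, 1 / (N : ℝ) ^ 2 := by
            refine Finset.sum_le_sum fun l _ => ?_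
            have h1 : e l = (u l * N - z l) / N := by simp only [he]; field_simp
            rw [h1, div_mul_div_comm, ← sq, ← sq]
            refine div_le_div_of_nonneg_right ?_ (by positivity)
            rw [← sq_abs]
            exact pow_le_one₀ (abs_nonneg _) (hz2 l)
        _ = n / N ^ 2 := by simp [div_eq_mul_inv]
    -- Split u = z/N + e and use (p+b)² ≤ 2p² + 2b². This is why the cutoff doubles from 3L to 6L;
    -- the grid part contributes 16εm, and the rounding part at most εm by the second moment bound.
    have hterm : ∀ i, max ((∑ l, X i l * u l) * (∑ l, X i l * u l) - 6 * L) 0 ≤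
        2 * max (inner ℝ (d z) (X i) ^ 2 - 3 * L) 0 +
        2 * ((∑ l, X i l * e l) * ∑ l, X i l * e l) := by
      intro i
      set a := ∑ l, X i l * u l with ha
      set b := ∑ l, X i l * e l with hb
      have h1 : a = inner ℝ (intPt z) (X i) / N + b := by
        rw [inner_eq_sum, Finset.sum_div, ← Finset.sum_add_distrib]
        refine Finset.sum_congr rfl fun l _ => ?_
        simp only [intPt, he]
        ring
      have h2 : (inner ℝ (intPt z) (X i) / N) ^ 2 ≤ inner ℝ (d z) (X i) ^ 2 := by
        rw [hd, div_pow, mul_pow, div_le_iff₀ (by positivity), mul_comm]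
        exact mul_le_mul_of_nonneg_left hnorm (sq_nonneg _)
      have h3 := le_max_left (inner ℝ (d z) (X i) ^ 2 - 3 * (L : ℝ)) 0
      have h4 := le_max_right (inner ℝ (d z) (X i) ^ 2 - 3 * (L : ℝ)) 0
      refine max_le ?_ (by nlinarith [mul_self_nonneg b])
      rw [h1]
      nlinarith [sq_nonneg (inner ℝ (intPt z) (X i) / N - b)]
    have hsmall : (1 + ε) * (n / N ^ 2) ≤ ε / 2 := by
      have h1 : n / (N : ℝ) ^ 2 ≤ ε ^ 2 / (4 * n) := by
        rw [div_le_div_iff₀ (by positivity) (by positivity)]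
        rw [div_le_iff₀ hε] at hN
        nlinarith [mul_self_nonneg (n : ℝ)]
      have h2 : ε ^ 2 / (4 * n) ≤ ε ^ 2 / 4 := by
        refine div_le_div_of_nonneg_left (sq_nonneg _) (by norm_num) (by linarith)
      nlinarith
    calc _ ≤ ∑ i, (2 * max (inner ℝ (d z) (X i) ^ 2 - 3 * L) 0 +
          2 * ((∑ l, X i l * e l) * ∑ l, X i l * e l)) := Finset.sum_le_sum fun i _ => hterm i
      _ = 2 * ∑ i, max (inner ℝ (d z) (X i) ^ 2 - 3 * L) 0 +
          2 * ∑ i, ((∑ l, X i l * e l) * ∑ l, X i l * e l) := by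
          rw [Finset.sum_add_distrib, Finset.mul_sum, Finset.mul_sum]
      _ ≤ 2 * (8 * ε * m) + 2 * ((1 + ε) * m * (n / N ^ 2)) := by
          refine add_le_add (mul_le_mul_of_nonneg_left (ht z hzmem) zero_le_two)
            (mul_le_mul_of_nonneg_left ((hup e).trans ?_) zero_le_two)
          exact mul_le_mul_of_nonneg_left he2 (by positivity)
      _ ≤ 17 * ε * m := by
          have := mul_le_mul_of_nonneg_right hsmall (by positivity : (0 : ℝ) ≤ m)
          linarith
  set U := ∑ l, u l * u l with hU
  have hU0 : 0 ≤ U := Finset.sum_nonneg fun _ _ => mul_self_nonneg _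
  rcases hU0.eq_or_lt with h0 | h0
  · have hu0 : ∀ l, u l = 0 := fun l => by
      have := (Finset.sum_eq_zero_iff_of_nonneg fun l _ => mul_self_nonneg (u l)).1 h0.symm l
        (Finset.mem_univ l)
      simpa using this
    rw [← h0]
    simp [hu0]
  · have hs : √U * √U = U := Real.mul_self_sqrt hU0
    have hs0 : 0 < √U := Real.sqrt_pos.2 h0
    have h1 := unit (fun l => u l / √U) (by
      simp only [div_mul_div_comm, hs]
      rw [← Finset.sum_div, ← hU, div_self h0.ne'])
    have h2 : ∀ i, max ((∑ l, X i l * u l) * (∑ l, X i l * u l) - 6 * L * U) 0 =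
        U * max ((∑ l, X i l * (u l / √U)) * (∑ l, X i l * (u l / √U)) - 6 * L) 0 := by
      intro i
      rw [mul_max_of_nonneg _ _ hU0, mul_zero]
      congr 1
      simp only [← mul_div_assoc]
      rw [← Finset.sum_div, div_mul_div_comm, hs]
      field_simp
    simp only [h2]
    rw [← Finset.mul_sum, mul_comm]
    exact mul_le_mul_of_nonneg_right h1 hU0

/-- The grid contains the zero vector, for which any unit vector serves. -/
theorem exists_unit_direction [NeZero n] (w : Pt n) :
    ∃ d : Pt n, ‖d‖ = 1 ∧ ∀ x, inner ℝ w x = ‖w‖ * inner ℝ d x := by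
  by_cases hw : w = 0
  · exact ⟨EuclideanSpace.single 0 1, by simp, fun x => by simp [hw]⟩
  · have h : ‖w‖ ≠ 0 := norm_ne_zero_iff.2 hw
    refine ⟨‖w‖⁻¹ • w, by rw [norm_smul, norm_inv, norm_norm, inv_mul_cancel₀ h], fun x => ?_⟩
    rw [real_inner_smul_left, ← mul_assoc, mul_inv_cancel₀ h, one_mul]

/-- The clean sample is good with high probability. -/
theorem cleanLaw_not_cleanSample_le [NeZero n] (hε : 0 < ε) (hε1 : ε ≤ 1 / 2)
    (hm : 1000 * (n / ε) ^ 4 ≤ m) (hL : (1 / 2 : ℝ) ^ L ≤ ε) (f : LTF n) (s₁ s₂ : ℝ) :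
    (cleanLaw n m).real {X | ¬ CleanSample ε L f s₁ s₂ X} ≤ 1 / 10 := by
  have hn : 1 ≤ n := NeZero.one_le
  have hn' : (1 : ℝ) ≤ n := by exact_mod_cast hn
  have hq : 1 ≤ n / ε := by rw [le_div_iff₀ hε]; linarith
  have hm0 : (0 : ℝ) < m := lt_of_lt_of_le (by positivity) hm
  have hm1 : 0 < m := by exact_mod_cast hm0
  set N := ⌈2 * n / ε⌉₊ with hN
  have hNle : 2 * n / ε ≤ N := Nat.le_ceil _
  choose d hd1 hd2 using fun z : Fin n → ℤ => exists_unit_direction (intPt z)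
  set G := Fintype.piFinset fun _ : Fin n => Finset.Icc (-N : ℤ) N with hG
  set E1 : Fin n × Fin n → Set (Fin m → Pt n) := fun q =>
    {X | ε / n * m ≤ |∑ i, X i q.1 * X i q.2 - m * if q.1 = q.2 then 1 else 0|} with hE1
  set E2 : Fin n → Set (Fin m → Pt n) := fun l =>
    {X | ε / n * m ≤ |∑ i, f.sgn (X i) * X i l - m * f.chow l|} with hE2
  set E3 : (Fin n → ℤ) → Set (Fin m → Pt n) := fun z =>
    {X | 8 * ε * m ≤ ∑ i, max (inner ℝ (d z) (X i) ^ 2 - 3 * L) 0} with hE3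
  set E4 : Set (Fin m → Pt n) :=
    {X | ε / 2 * m ≤ |∑ i, (1 - f.sgn (X i)) / 2 - m * f.negProb|} with hE4
  set E5 : ℝ → Set (Fin m → Pt n) := fun s =>
    {X | ε / 2 * m ≤ |∑ i, (Iio s).indicator (fun _ => (1 : ℝ)) (X i 0) - m * normalCDF s|} with hE5
  have hsub : {X : Fin m → Pt n | ¬ CleanSample ε L f s₁ s₂ X} ⊆
      (⋃ q ∈ (Finset.univ : Finset (Fin n × Fin n)), E1 q) ∪
      ((⋃ l ∈ (Finset.univ : Finset (Fin n)), E2 l) ∪ ((⋃ z ∈ G, E3 z) ∪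
        (E4 ∪ (E5 s₁ ∪ E5 s₂)))) := by
    intro X hX
    by_contra h
    simp only [mem_union, mem_iUnion, not_or, not_exists, Finset.mem_univ, true_implies] at h
    obtain ⟨h1, h2, h3, h4, h5, h6⟩ := h
    have hq : ∀ u : Fin n → ℝ, |∑ i, (∑ l, X i l * u l) * (∑ l, X i l * u l) -
        m * ∑ l, u l * u l| ≤ ε * m * ∑ l, u l * u l :=
      abs_sum_sq_sub_le fun k l => (not_le.1 (h1 (k, l))).le
    have hup : ∀ u : Fin n → ℝ, ∑ i, (∑ l, X i l * u l) * ∑ l, X i l * u l ≤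
        (1 + ε) * m * ∑ l, u l * u l := fun u => by linarith [(abs_le.1 (hq u)).2]
    refine hX ⟨⟨fun u => by linarith [(abs_le.1 (hq u)).1], hup,
      sum_tail_le hε hε1 hn hNle hup d hd2 fun z hz => (not_le.1 (h3 z hz)).le⟩,
      abs_sum_mul_sub_le fun l => (not_le.1 (h2 l)).le, not_le.1 h4, not_le.1 h5, not_le.1 h6⟩
  have hεn : 0 < ε / n := by positivity
  have b1 : (cleanLaw n m).real (⋃ q ∈ (Finset.univ : Finset (Fin n × Fin n)), E1 q) ≤
      n * n * (29 / (m * (ε / n) ^ 2)) := by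
    refine (measureReal_biUnion_finset_le _ _).trans ?_
    refine (Finset.sum_le_card_nsmul _ _ _ fun q _ =>
      cleanLaw_coord_mul hεn hm1 q.1 q.2).trans (le_of_eq ?_)
    simp
  have b2 : (cleanLaw n m).real (⋃ l ∈ (Finset.univ : Finset (Fin n)), E2 l) ≤
      n * (1 / (m * (ε / n) ^ 2)) := by
    refine (measureReal_biUnion_finset_le _ _).trans ?_
    refine (Finset.sum_le_card_nsmul _ _ _ fun l _ =>
      cleanLaw_mul_coord hεn hm1 f.measurable_sgn f.sgn_sq l).trans (le_of_eq ?_)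
    simp
  have b3 : (cleanLaw n m).real (⋃ z ∈ G, E3 z) ≤ 1 / 100 := by
    refine (measureReal_biUnion_finset_le _ _).trans ?_
    refine (Finset.sum_le_card_nsmul _ _ _ fun z _ => cleanLaw_tail hL (hd1 z)).trans ?_
    -- The grid has (2N+1)^n points with N ≤ 3n/ε. The Chernoff bound exp(-εm) outweighs this number
    -- since εm is at least of order (n/ε)³n.
    have hcard : (G.card : ℝ) ≤ Real.exp (6 * n * (n / ε)) := by
      have h1 : G.card = (2 * N + 1) ^ n := by
        rw [hG, Fintype.card_piFinset]
        simp only [Int.card_Icc, Finset.prod_const, Finset.card_univ, Fintype.card_fin]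
        congr 1
        omega
      have h2 : (N : ℝ) ≤ 3 * (n / ε) := by
        have := (Nat.ceil_lt_add_one (by positivity : 0 ≤ 2 * n / ε)).le
        rw [← hN, mul_div_assoc] at this
        linarith
      rw [h1]
      push_cast
      calc (2 * (N : ℝ) + 1) ^ n ≤ Real.exp (6 * (n / ε)) ^ n := by
            refine pow_le_pow_left₀ (by positivity) ?_ _
            exact (Real.add_one_le_exp _).trans (Real.exp_le_exp.2 (by linarith))
        _ = Real.exp (6 * n * (n / ε)) := by
            rw [← Real.exp_nat_mul]
            congr 1
            ring
    have hexp : 100 + 6 * n * (n / ε) ≤ ε * m := by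
      have h1 : 1000 * (n / ε) ^ 3 * n ≤ ε * m := by
        calc 1000 * (n / ε) ^ 3 * n = ε * (1000 * (n / ε) ^ 4) := by field_simp
          _ ≤ ε * m := by gcongr
      have h2 : n / ε ≤ (n / ε) ^ 3 := le_self_pow₀ hq (by norm_num)
      have h3 : (n / ε) * n ≤ (n / ε) ^ 3 * n := by gcongr
      have h4 : 1 ≤ (n / ε) * n := one_le_mul_of_one_le_of_one_le hq hn'
      linarith
    rw [nsmul_eq_mul]
    calc (G.card : ℝ) * Real.exp (-(ε * m)) ≤
          Real.exp (6 * n * (n / ε)) * Real.exp (-(ε * m)) := by gcongr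
      _ = Real.exp (6 * n * (n / ε) + -(ε * m)) := (Real.exp_add _ _).symm
      _ ≤ Real.exp (-100) := Real.exp_le_exp.2 (by linarith)
      _ ≤ 1 / 100 := by
          rw [Real.exp_neg, one_div]
          refine inv_anti₀ (by norm_num) ?_
          linarith [Real.add_one_le_exp 100]
  have b4 : (cleanLaw n m).real E4 ≤ 1 / (m * (ε / 2) ^ 2) := by
    have := cleanLaw_bounded (n := n) (m := m) (half_pos hε) hm1 (g := fun x => (1 - f.sgn x) / 2)
      ((f.measurable_sgn.const_sub 1).div_const 2) fun x => by
        rw [f.sgn_eq]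
        split_ifs <;> norm_num
    rwa [f.integral_neg] at this
  have b5 : ∀ s, (cleanLaw n m).real (E5 s) ≤ 1 / (m * (ε / 2) ^ 2) := by
    intro s
    have hu : ‖EuclideanSpace.single (0 : Fin n) (1 : ℝ)‖ = 1 := by simp
    have := cleanLaw_bounded (n := n) (m := m) (half_pos hε) hm1
      (g := fun x => (Iio s).indicator (fun _ => (1 : ℝ)) (x 0))
      ((measurable_const.indicator measurableSet_Iio).comp (measurable_coord 0)) fun x => by
        by_cases hx : x 0 ∈ Iio s <;> simp [hx]
    have h2 := integral_comp_inner hu (g := (Iio s).indicator (fun _ => (1 : ℝ)))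
      (measurable_const.indicator measurableSet_Iio).aestronglyMeasurable
    simp only [inner_basis] at h2
    rw [h2, integral_indicator_const _ measurableSet_Iio, smul_eq_mul, mul_one] at this
    exact this
  refine (measureReal_mono hsub).trans ?_
  refine (measureReal_union_le _ _).trans ?_
  refine (add_le_add b1 ((measureReal_union_le _ _).trans (add_le_add b2
    ((measureReal_union_le _ _).trans (add_le_add b3 ((measureReal_union_le _ _).trans
    (add_le_add b4 ((measureReal_union_le _ _).trans (add_le_add (b5 s₁) (b5 s₂)))))))))).trans ?_
  have hmε : 1000 * n ^ 4 ≤ m * ε ^ 2 := by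
    have h1 : 1000 * (n : ℝ) ^ 4 ≤ m * ε ^ 4 := by
      have := mul_le_mul_of_nonneg_right hm (by positivity : 0 ≤ ε ^ 4)
      rwa [div_pow, mul_assoc, div_mul_cancel₀ _ (by positivity)] at this
    have h2 : (m : ℝ) * ε ^ 4 ≤ m * ε ^ 2 :=
      mul_le_mul_of_nonneg_left (pow_le_pow_of_le_one hε.le (by linarith) (by norm_num)) hm0.le
    linarith
  have hmε0 : 0 < m * ε ^ 2 := by positivity
  have e1 : (n : ℝ) * n * (29 / (m * (ε / n) ^ 2)) = 29 * n ^ 4 / (m * ε ^ 2) := by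
    field_simp
  have e2 : (n : ℝ) * (1 / (m * (ε / n) ^ 2)) = n ^ 3 / (m * ε ^ 2) := by
    field_simp
  have e3 : 1 / (m * (ε / 2) ^ 2) = 4 / (m * ε ^ 2) := by
    field_simp
    norm_num
  rw [e1, e2, e3]
  have hn4 : (1 : ℝ) ≤ n ^ 4 := one_le_pow₀ hn'
  have hn3 : (n : ℝ) ^ 3 ≤ n ^ 4 := pow_le_pow_right₀ hn' (by norm_num)
  -- In thousandths, the failure probabilities are 29 for second moments, 1 for Chow parameters, 10
  -- for tails and 4 for each of three frequencies.
  have c1 : 29 * (n : ℝ) ^ 4 / (m * ε ^ 2) ≤ 29 / 1000 := by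
    rw [div_le_div_iff₀ hmε0 (by norm_num)]
    linarith
  have c2 : (n : ℝ) ^ 3 / (m * ε ^ 2) ≤ 1 / 1000 := by
    rw [div_le_div_iff₀ hmε0 (by norm_num)]
    linarith
  have c3 : 4 / (m * ε ^ 2) ≤ 4 / 1000 := by
    rw [div_le_div_iff₀ hmε0 (by norm_num)]
    linarith
  linarith

end cleanSample

/-! ### From approximate Chow parameters and an approximate quantile to a hypothesis -/

/-- A Newton step turns the error s - √q into (s-√q)²/(2s): it is never negative, and it is at most
half the old error as long as s ≥ √q. The start 1 + q lies above √q. -/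
theorem newtonSqrt_bounds {q : ℝ} (hq : 0 ≤ q) (k : ℕ) :
    0 < newtonSqrt q k ∧ √q ≤ newtonSqrt q k ∧ newtonSqrt q k - √q ≤ (1 / 2) ^ k * (1 + q) := by
  have hs := Real.sq_sqrt hq
  have h0 := Real.sqrt_nonneg q
  induction k with
  | zero =>
    simp only [newtonSqrt, Function.iterate_zero, id, pow_zero, one_mul]
    refine ⟨by linarith, ?_, by linarith⟩
    nlinarith [sq_nonneg (√q - 1)]
  | succ k ih =>
    obtain ⟨hp, hle, hub⟩ := ih
    have e : newtonSqrt q (k + 1) = (newtonSqrt q k + q / newtonSqrt q k) / 2 := by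
      rw [newtonSqrt, newtonSqrt, Function.iterate_succ_apply']
    set s := newtonSqrt q k
    have e2 : (s + q / s) / 2 - √q = (s - √q) ^ 2 / (2 * s) := by
      rw [eq_div_iff (by positivity)]
      have : q / s * s = q := div_mul_cancel₀ q hp.ne'
      linear_combination this - hs
    rw [e]
    refine ⟨by positivity, ?_, ?_⟩
    · have : 0 ≤ (s - √q) ^ 2 / (2 * s) := by positivity
      linarith
    · rw [e2, div_le_iff₀ (by positivity), pow_succ]
      have : (s - √q) ^ 2 ≤ (s - √q) * s := by nlinarith
      have h2 := mul_le_mul_of_nonneg_right hub hp.le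
      linear_combination this + h2

section hypothesis

open MeasureTheory ProbabilityTheory Set

variable {n : ℕ} {f h : LTF n}

theorem LTF.label_eq_one_iff (f : LTF n) (x : Pt n) :
    f.label x = 1 ↔ 0 ≤ inner ℝ f.v x + f.θ := by
  unfold LTF.label
  split_ifs with h <;> simp [h]

theorem LTF.label_eq_or (f : LTF n) (x : Pt n) : f.label x = 1 ∨ f.label x = -1 :=
  Int.units_eq_one_or _

theorem LTF.label_ne_iff (f h : LTF n) (x : Pt n) :
    h.label x ≠ f.label x ↔ ¬(h.label x = 1 ↔ f.label x = 1) := by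
  rcases f.label_eq_or x with h1 | h1 <;> rcases h.label_eq_or x with h2 | h2 <;> simp [h1, h2]

theorem inner_smul_inv_norm {v : Pt n} (hv : v ≠ 0) (x : Pt n) :
    inner ℝ v x = ‖v‖ * inner ℝ (‖v‖⁻¹ • v) x := by
  rw [real_inner_smul_left, ← mul_assoc, mul_inv_cancel₀ (norm_ne_zero_iff.2 hv), one_mul]

theorem norm_smul_inv_norm_pt {v : Pt n} (hv : v ≠ 0) : ‖‖v‖⁻¹ • v‖ = 1 := by
  rw [norm_smul, norm_inv, norm_norm, inv_mul_cancel₀ (norm_ne_zero_iff.2 hv)]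

theorem LTF.label_eq_one_iff_of_ne_zero (f : LTF n) (hv : f.v ≠ 0) (x : Pt n) :
    f.label x = 1 ↔ -f.θ / ‖f.v‖ ≤ inner ℝ (‖f.v‖⁻¹ • f.v) x := by
  rw [f.label_eq_one_iff, inner_smul_inv_norm hv, div_le_iff₀ (norm_pos_iff.2 hv)]
  constructor <;> intro h <;> linarith

theorem LTF.negProb_eq (f : LTF n) (hv : f.v ≠ 0) : f.negProb = normalCDF (-f.θ / ‖f.v‖) := by
  rw [LTF.negProb, ← gauss_halfspace (norm_smul_inv_norm_pt hv)]
  congr 1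
  ext x
  have := f.label_eq_one_iff_of_ne_zero hv x
  rcases f.label_eq_or x with h1 | h1 <;> simp_all

/-- The label is twice the indicator of the halfspace minus 1, and coordinates have mean 0, so this
is twice the mean of a coordinate over the halfspace. -/
theorem LTF.chow_eq (f : LTF n) (hv : f.v ≠ 0) (l : Fin n) :
    f.chow l = 2 * normalPDF (-f.θ / ‖f.v‖) * (‖f.v‖⁻¹ • f.v) l := by
  set θ := -f.θ / ‖f.v‖
  set v := ‖f.v‖⁻¹ • f.v with hvdef
  have h1 : ∀ x : Pt n, f.sgn x * x l =
      2 * {x | θ ≤ inner ℝ v x}.indicator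
        (fun x => inner ℝ (EuclideanSpace.single l (1 : ℝ)) x) x -
      inner ℝ (EuclideanSpace.single l (1 : ℝ)) x := by
    intro x
    rw [inner_basis]
    have hl := f.label_eq_one_iff_of_ne_zero hv x
    rw [f.label_eq_one_iff] at hl
    rw [f.sgn_eq]
    by_cases hx : θ ≤ inner ℝ v x
    · have hx' : x ∈ {x | θ ≤ inner ℝ v x} := hx
      rw [indicator_of_mem hx', if_pos (hl.2 hx), inner_basis]
      ring
    · have hx' : x ∉ {x | θ ≤ inner ℝ v x} := hx
      rw [indicator_of_notMem hx', if_neg fun h => hx (hl.1 h)]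
      ring
  have hm : MeasurableSet {x : Pt n | θ ≤ inner ℝ v x} :=
    measurableSet_le measurable_const (measurable_inner_left _)
  have hi := integrable_inner (EuclideanSpace.single l (1 : ℝ))
  have h0 : ∫ x, inner ℝ (EuclideanSpace.single l (1 : ℝ)) x ∂(gauss n) = 0 := by
    have := integral_comp_inner (u := EuclideanSpace.single l (1 : ℝ)) (by simp) (g := fun z => z)
      measurable_id.aestronglyMeasurable
    simpa using this
  rw [LTF.chow]
  simp only [h1]
  rw [integral_sub ((hi.indicator hm).const_mul 2) hi, integral_const_mul,
    integral_indicator_halfspace (norm_smul_inv_norm_pt hv), h0, real_inner_comm, inner_basis]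
  ring

theorem LTF.negProb_nonneg (f : LTF n) : 0 ≤ f.negProb := measureReal_nonneg

theorem LTF.negProb_le_one (f : LTF n) : f.negProb ≤ 1 := measureReal_le_one

theorem LTF.err_le_one (h f : LTF n) : h.err f ≤ 1 := measureReal_le_one

theorem LTF.posProb_eq (f : LTF n) : (gauss n).real {x | f.label x = 1} = 1 - f.negProb := by
  have hm : MeasurableSet {x | f.label x = -1} := by
    simp only [f.label_eq_neg_one_iff]
    exact measurableSet_lt ((measurable_inner_left _).add_const _) measurable_const
  rw [LTF.negProb, ← probReal_compl_eq_one_sub hm]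
  congr 1
  ext x
  rcases f.label_eq_or x with h1 | h1 <;> simp [h1]

theorem LTF.err_le_negProb_add (h f : LTF n) : h.err f ≤ h.negProb + f.negProb := by
  refine (measureReal_mono ?_).trans (measureReal_union_le {x | h.label x = -1} {x | f.label x = -1})
  intro x hx
  rcases f.label_eq_or x with h1 | h1 <;> rcases h.label_eq_or x with h2 | h2 <;> simp_all

theorem LTF.err_le_posProb_add (h f : LTF n) :
    h.err f ≤ (1 - h.negProb) + (1 - f.negProb) := by
  rw [← LTF.posProb_eq, ← LTF.posProb_eq]
  refine (measureReal_mono ?_).trans (measureReal_union_le {x | h.label x = 1} {x | f.label x = 1})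
  intro x hx
  rcases f.label_eq_or x with h1 | h1 <;> rcases h.label_eq_or x with h2 | h2 <;> simp_all

/-- Overestimating the norm of the normal vector makes the threshold more extreme. -/
theorem LTF.negProb_le_of_neg {s τ : ℝ} (hθ : h.θ = -(s * τ)) (hs0 : 0 < s) (hs : ‖h.v‖ ≤ s)
    (hτ : τ < 0) : h.negProb ≤ normalCDF τ := by
  by_cases hv : h.v = 0
  · have : {x | h.label x = -1} = ∅ := by
      ext x
      have : 0 < -(s * τ) := by nlinarith
      simp [h.label_eq_neg_one_iff, hv, hθ]
      nlinarith
    rw [LTF.negProb, this, measureReal_empty]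
    exact measureReal_nonneg
  · have hv0 := norm_pos_iff.2 hv
    rw [h.negProb_eq hv]
    refine normalCDF_mono ?_
    rw [hθ, neg_neg, div_le_iff₀ hv0]
    nlinarith

theorem LTF.le_negProb_of_pos {s τ : ℝ} (hθ : h.θ = -(s * τ)) (hs0 : 0 < s) (hs : ‖h.v‖ ≤ s)
    (hτ : 0 < τ) : normalCDF τ ≤ h.negProb := by
  by_cases hv : h.v = 0
  · have : {x | h.label x = -1} = univ := by
      ext x
      have : 0 < s * τ := by positivity
      simp [h.label_eq_neg_one_iff, hv, hθ, hs0, hτ]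
    rw [LTF.negProb, this, probReal_univ]
    exact measureReal_le_one
  · have hv0 := norm_pos_iff.2 hv
    rw [h.negProb_eq hv]
    refine normalCDF_mono ?_
    rw [hθ, neg_neg, le_div_iff₀ hv0]
    nlinarith

/-- A hypothesis with nearly the Chow parameters of `f` and nearly the right threshold, for a
target that is far from constant. -/
theorem LTF.err_le_of_far {s τ δ ε : ℝ} (hε : 0 < ε) (hεδ : ε ≤ δ) (hv : f.v ≠ 0)
    (hδ : 2 * δ ≤ normalPDF (-f.θ / ‖f.v‖)) (hchow : ‖h.v - WithLp.toLp 2 f.chow‖ ≤ δ)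
    (hτ : |normalCDF τ - f.negProb| ≤ 4 * ε) (hθ : h.θ = -(s * τ))
    (hs : ‖h.v‖ ≤ s) (hs' : s - ‖h.v‖ ≤ ε ^ 2 / 5 * (1 + ‖h.v‖ ^ 2)) :
    h.err f ≤ 5 * ε + 7 * δ := by
  set θ := -f.θ / ‖f.v‖ with hθdef
  set v := ‖f.v‖⁻¹ • f.v with hvdef
  set φ := normalPDF θ with hφ
  have hφ1 : φ ≤ 1 / 2 := (normalPDF_le_zero θ).trans normalPDF_zero_le
  have hδ0 : 0 < δ := hε.trans_le hεδ
  have hv1 : ‖v‖ = 1 := norm_smul_inv_norm_pt hv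
  have hμ : (WithLp.toLp 2 f.chow : Pt n) = (2 * φ) • v := by
    ext l
    rw [PiLp.smul_apply, smul_eq_mul]
    exact f.chow_eq hv l
  rw [hμ] at hchow
  have hμn : ‖(2 * φ) • v‖ = 2 * φ := by
    rw [norm_smul, hv1, mul_one, Real.norm_of_nonneg (by linarith)]
  have hd := abs_le.1 ((abs_norm_sub_norm_le h.v ((2 * φ) • v)).trans hchow)
  rw [hμn] at hd
  have hh0 : 0 < ‖h.v‖ := by linarith
  have hhv : h.v ≠ 0 := norm_pos_iff.1 hh0
  set u := ‖h.v‖⁻¹ • h.v with hu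
  have hu1 : ‖u‖ = 1 := norm_smul_inv_norm_pt hhv
  -- One δ for the error of the vector, another for the error of its length. The factor φ stays on
  -- the left, as the tilting bound needs it.
  have huv : 2 * φ * ‖u - v‖ ≤ 2 * δ := by
    have e : (2 * φ) • (u - v) = (2 * φ - ‖h.v‖) • u + (h.v - (2 * φ) • v) := by
      have : h.v = ‖h.v‖ • u := by rw [hu, smul_smul, mul_inv_cancel₀ hh0.ne', one_smul]
      rw [smul_sub, sub_smul, ← this]
      abel
    have h2 : ‖(2 * φ) • (u - v)‖ = 2 * φ * ‖u - v‖ := by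
      rw [norm_smul, Real.norm_of_nonneg (by linarith)]
    rw [← h2, e]
    refine (norm_add_le _ _).trans ?_
    rw [norm_smul, hu1, mul_one, Real.norm_eq_abs]
    have : |2 * φ - ‖h.v‖| ≤ δ := abs_le.2 ⟨by linarith, by linarith⟩
    linarith
  set κ := s / ‖h.v‖ - 1 with hκ
  have hκ0 : 0 ≤ κ := by
    rw [hκ, sub_nonneg, le_div_iff₀ hh0]
    linarith
  -- Here ε ≤ ‖h.v‖ ≤ 2, because ‖h.v‖ is within δ of 2φ ≤ 1 and φ ≥ 2δ.
  have hκ1 : κ ≤ ε := by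
    rw [hκ, sub_le_iff_le_add, div_le_iff₀ hh0]
    have : ε ^ 2 / 5 * (1 + ‖h.v‖ ^ 2) ≤ ε ^ 2 / 5 * 5 := by
      refine mul_le_mul_of_nonneg_left ?_ (by positivity)
      nlinarith
    nlinarith
  have hτ' : -h.θ / ‖h.v‖ = τ * (1 + κ) := by
    rw [hκ, hθ]
    field_simp
    ring
  have hf := f.label_eq_one_iff_of_ne_zero hv
  have hh := h.label_eq_one_iff_of_ne_zero hhv
  calc h.err f ≤ (gauss n).real {x | ¬(τ * (1 + κ) ≤ inner ℝ u x ↔ θ ≤ inner ℝ u x)} +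
        (gauss n).real {x | ¬(θ ≤ inner ℝ u x ↔ θ ≤ inner ℝ v x)} := by
        refine (measureReal_mono ?_).trans (measureReal_union_le _ _)
        intro x hx
        have hx : ¬(h.label x = 1 ↔ f.label x = 1) := (f.label_ne_iff h x).1 hx
        rw [hf x, hh x, hτ'] at hx
        by_contra hc
        simp only [mem_union, mem_ofPred_eq, not_or, not_not] at hc
        exact hx (hc.1.trans hc.2)
    _ ≤ |normalCDF (τ * (1 + κ)) - normalCDF θ| + 7 * (φ * ‖u - v‖) :=
        add_le_add (gauss_parallel_halfspaces hu1 _ _) (gauss_tilted_halfspaces hu1 hv1 θ)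
    _ ≤ 5 * ε + 7 * δ := by
        have h1 := abs_normalCDF_mul_sub_le hκ0 τ
        rw [f.negProb_eq hv] at hτ
        have := abs_sub_le (normalCDF (τ * (1 + κ))) (normalCDF τ) (normalCDF θ)
        linarith

/-- For δ ≥ 1/30 the bound is trivial. If one label has probability at most 10δ, then Φ(τ) or 1 -
Φ(τ) is at most 14δ < 1/2, which fixes the sign of τ; the hypothesis is then as biased as τ says,
and the error is at most 24δ. Otherwise min(p, 1-p) > 10δ gives φ ≥ 2δ, and the estimate for targets
far from constant yields 12δ. -/
theorem LTF.err_le {s τ δ ε : ℝ} (hε : 0 < ε) (hεδ : ε ≤ δ)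
    (hchow : ‖h.v - WithLp.toLp 2 f.chow‖ ≤ δ)
    (hτ : |normalCDF τ - f.negProb| ≤ 4 * ε) (hθ : h.θ = -(s * τ)) (hs0 : 0 < s)
    (hs : ‖h.v‖ ≤ s) (hs' : s - ‖h.v‖ ≤ ε ^ 2 / 5 * (1 + ‖h.v‖ ^ 2)) :
    h.err f ≤ 30 * δ := by
  rcases le_or_gt (1 / 2) (15 * δ) with hδ | hδ
  · have := h.err_le_one f
    linarith
  have hτ2 := abs_le.1 hτ
  rcases le_or_gt f.negProb (10 * δ) with hp | hp
  · have hτ0 : τ < 0 := by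
      by_contra hc
      have := normalCDF_mono (not_lt.1 hc)
      rw [normalCDF_zero] at this
      linarith
    have h1 := LTF.negProb_le_of_neg hθ hs0 hs hτ0
    have h2 := h.err_le_negProb_add f
    linarith
  rcases le_or_gt (1 - f.negProb) (10 * δ) with hp' | hp'
  · have hτ0 : 0 < τ := by
      by_contra hc
      have := normalCDF_mono (not_lt.1 hc)
      rw [normalCDF_zero] at this
      linarith
    have h1 := LTF.le_negProb_of_pos hθ hs0 hs hτ0
    have h2 := h.err_le_posProb_add f
    linarith
  have hv : f.v ≠ 0 := by
    intro hv
    rcases le_or_gt 0 f.θ with h0 | h0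
    · have : {x | f.label x = -1} = ∅ := by
        ext x
        simp [f.label_eq_neg_one_iff, hv, h0]
      rw [LTF.negProb, this, measureReal_empty] at hp
      linarith
    · have : {x | f.label x = -1} = univ := by
        ext x
        simp [f.label_eq_neg_one_iff, hv, h0]
      rw [LTF.negProb, this, probReal_univ] at hp'
      linarith
  have hmin := min_normalCDF_le (-f.θ / ‖f.v‖)
  rw [← f.negProb_eq hv] at hmin
  have := lt_min hp hp'
  have := LTF.err_le_of_far hε hεδ hv (by linarith) hchow hτ hθ hs hs'
  linarith

end hypothesis

/-! ### The learner succeeds on every corruption of a clean sample -/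

section quantile

variable {n m : ℕ} [NeZero n]

/-- Take the largest value with at most `c` values strictly below it. If fewer than `c` values were
at most this one, the next larger value would qualify too. -/
theorem exists_isQuantile (hm : 0 < m) (S : Fin m → Example n) : ∃ i, IsQuantile S i := by
  classical
  have : Nonempty (Fin m) := ⟨⟨0, hm⟩⟩
  unfold IsQuantile
  set c : ℝ := ∑ k, (1 - (((S k).2 : ℤ) : ℝ)) / 2 with hc
  have hy : ∀ k, (((S k).2 : ℤ) : ℝ) = 1 ∨ (((S k).2 : ℤ) : ℝ) = -1 := fun k => by
    rcases Int.units_eq_one_or (S k).2 with h | h <;> simp [h]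
  have hc0 : 0 ≤ c := Finset.sum_nonneg fun k _ => by rcases hy k with h | h <;> rw [h] <;> norm_num
  have hcm : c ≤ m := by
    refine (Finset.sum_le_sum (g := fun _ => (1 : ℝ)) fun k _ => ?_).trans (by simp)
    rcases hy k with h | h <;> rw [h] <;> norm_num
  set x : Fin m → ℝ := fun k => (S k).1 0
  set T : Finset (Fin m) :=
    Finset.univ.filter fun i => ((Finset.univ.filter fun k => x k < x i).card : ℝ) ≤ c with hT
  obtain ⟨i₀, -, h₀⟩ := Finset.exists_min_image Finset.univ x Finset.univ_nonempty
  have hT0 : T.Nonempty := by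
    refine ⟨i₀, Finset.mem_filter.2 ⟨Finset.mem_univ _, ?_⟩⟩
    rw [Finset.filter_false_of_mem fun k hk => not_lt.2 (h₀ k hk)]
    simpa using hc0
  obtain ⟨i, hi, hmax⟩ := Finset.exists_max_image T x hT0
  refine ⟨i, (Finset.mem_filter.1 hi).2, ?_⟩
  by_contra! hlt
  have hne : (Finset.univ.filter fun k => x i < x k).Nonempty := by
    by_contra hemp
    rw [Finset.not_nonempty_iff_eq_empty, Finset.filter_eq_empty_iff] at hemp
    rw [Finset.filter_true_of_mem fun k hk => not_lt.1 (hemp hk)] at hlt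
    simp only [Finset.card_univ, Fintype.card_fin] at hlt
    linarith
  obtain ⟨k, hk, hmin⟩ := Finset.exists_min_image _ x hne
  have hik := (Finset.mem_filter.1 hk).2
  have hkT : k ∈ T := by
    refine Finset.mem_filter.2 ⟨Finset.mem_univ _, le_trans ?_ hlt.le⟩
    refine Nat.cast_le.2 (Finset.card_le_card fun j hj => ?_)
    have hj := (Finset.mem_filter.1 hj).2
    refine Finset.mem_filter.2 ⟨Finset.mem_univ _, ?_⟩
    by_contra hji
    exact (hmin j (Finset.mem_filter.2 ⟨Finset.mem_univ _, not_le.1 hji⟩)).not_gt hj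
  exact (hmax k hkT).not_gt hik

theorem abs_sum_sub_sum_le_card {B : Finset (Fin m)} {a b : Fin m → ℝ} (h : ∀ i ∉ B, a i = b i)
    (h1 : ∀ i, |a i - b i| ≤ 1) : |∑ i, a i - ∑ i, b i| ≤ B.card := by
  rw [← Finset.sum_sub_distrib]
  refine (Finset.abs_sum_le_sum_abs _ _).trans ?_
  rw [← Finset.sum_subset (Finset.subset_univ B) fun i _ hi => by rw [h i hi, sub_self, abs_zero]]
  refine (Finset.sum_le_sum fun i _ => h1 i).trans (by simp)

theorem card_filter_lt_eq (x : Fin m → ℝ) (s : ℝ) :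
    ((Finset.univ.filter fun k => x k < s).card : ℝ) =
      ∑ k, (Set.Iio s).indicator (fun _ => (1 : ℝ)) (x k) := by
  rw [Finset.card_filter, Nat.cast_sum]
  exact Finset.sum_congr rfl fun k _ => by by_cases h : x k < s <;> simp [h]

/-- By monotonicity it suffices to control the empirical distribution function at two points fixed
in advance, those where Φ equals p ± 4ε (if they exist); no uniform convergence is needed. Label
frequency and empirical distribution function are each off by less than 3ε/2, namely ε for the
corruption and ε/2 for the sampling, and 3ε < 4ε. -/
theorem IsQuantile.abs_normalCDF_sub_le {ε s₁ s₂ : ℝ} {L : ℕ} {f : LTF n} {X : Fin m → Pt n}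
    {S : Fin m → Example n} {B : Finset (Fin m)} (hm : 0 < m) (hε : 0 < ε)
    (hX : CleanSample ε L f s₁ s₂ X) (hS : ∀ i ∉ B, S i = (X i, f.label (X i)))
    (hB : (B.card : ℝ) ≤ ε * m)
    (h₁ : f.negProb + 4 * ε < 1 → normalCDF s₁ = f.negProb + 4 * ε)
    (h₂ : 0 < f.negProb - 4 * ε → normalCDF s₂ = f.negProb - 4 * ε)
    {i : Fin m} (hi : IsQuantile S i) : |normalCDF ((S i).1 0) - f.negProb| ≤ 4 * ε := by
  classical
  have hm' : (0 : ℝ) < m := by exact_mod_cast hm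
  have hεm : 0 < ε * m := by positivity
  obtain ⟨hlo, hhi⟩ := hi
  have hy : ∀ y : ℤˣ, ((y : ℤ) : ℝ) = 1 ∨ ((y : ℤ) : ℝ) = -1 := fun y => by
    rcases Int.units_eq_one_or y with h | h <;> simp [h]
  have hlab : |∑ k, (1 - (((S k).2 : ℤ) : ℝ)) / 2 - ∑ k, (1 - f.sgn (X k)) / 2| ≤ B.card := by
    refine abs_sum_sub_sum_le_card (fun k hk => by rw [hS k hk, LTF.sgn]) fun k => ?_
    rw [LTF.sgn]
    rcases hy (S k).2 with h | h <;> rcases hy (f.label (X k)) with h' | h' <;> rw [h, h'] <;>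
      norm_num
  have hcnt : ∀ s, |∑ k, (Set.Iio s).indicator (fun _ => (1 : ℝ)) ((S k).1 0) -
      ∑ k, (Set.Iio s).indicator (fun _ => (1 : ℝ)) (X k 0)| ≤ B.card := fun s => by
    refine abs_sum_sub_sum_le_card (fun k hk => by rw [hS k hk]) fun k => ?_
    by_cases h : (S k).1 0 < s <;> by_cases h' : X k 0 < s <;> simp [h, h']
  have hl := abs_le.1 hlab
  have hl' := abs_lt.1 hX.label
  set τ := (S i).1 0
  rw [abs_le]
  constructor
  · by_contra! hlt
    have h0 : 0 < f.negProb - 4 * ε := by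
      have : 0 ≤ normalCDF τ := MeasureTheory.measureReal_nonneg
      linarith
    have hs := h₂ h0
    have hτs : τ < s₂ := by
      by_contra hc
      have := normalCDF_mono (not_lt.1 hc)
      linarith
    have hc := abs_le.1 (hcnt s₂)
    have hc' := abs_lt.1 hX.cdf₂
    rw [← card_filter_lt_eq fun k => (S k).1 0] at hc
    have hcard : ((Finset.univ.filter fun k => (S k).1 0 ≤ τ).card : ℝ) ≤
        (Finset.univ.filter fun k => (S k).1 0 < s₂).card :=
      Nat.cast_le.2 (Finset.card_le_card (Finset.monotone_filter_right _ fun k _ hk =>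
        lt_of_le_of_lt hk hτs))
    rw [hs, mul_sub] at hc'
    have : ∑ k, (1 - (((S k).2 : ℤ) : ℝ)) / 2 ≤
        (Finset.univ.filter fun k => (S k).1 0 ≤ τ).card := by convert hhi
    linarith [hc.2, hc'.2, hl.1, hl'.1]
  · by_contra! hlt
    have h1 : f.negProb + 4 * ε < 1 := by
      have : normalCDF τ ≤ 1 := MeasureTheory.measureReal_le_one
      linarith
    have hs := h₁ h1
    have hτs : s₁ < τ := by
      by_contra hc
      have := normalCDF_mono (not_lt.1 hc)
      linarith
    have hc := abs_le.1 (hcnt s₁)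
    have hc' := abs_lt.1 hX.cdf₁
    rw [← card_filter_lt_eq fun k => (S k).1 0] at hc
    have hcard : ((Finset.univ.filter fun k => (S k).1 0 < s₁).card : ℝ) ≤
        (Finset.univ.filter fun k => (S k).1 0 < τ).card :=
      Nat.cast_le.2 (Finset.card_le_card (Finset.monotone_filter_right _ fun k _ hk =>
        lt_trans hk hτs))
    rw [hs, mul_add] at hc'
    have : ((Finset.univ.filter fun k => (S k).1 0 < τ).card : ℝ) ≤
        ∑ k, (1 - (((S k).2 : ℤ) : ℝ)) / 2 := by convert hlo
    linarith [hc.1, hc'.1, hl.2, hl'.2]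

end quantile

/-! ### The error of a learned hypothesis. -/

section learned

variable {n m : ℕ} [NeZero n] {ε s₁ s₂ : ℝ} {L : ℕ} {f : LTF n} {X : Fin m → Pt n}
  {S : Fin m → Example n}

/-- Disposes of the adversary's freedom to reorder: afterwards sample and clean points can be
compared index by index. -/
theorem CleanSample.comp_perm (hX : CleanSample ε L f s₁ s₂ X) (σ : Equiv.Perm (Fin m)) :
    CleanSample ε L f s₁ s₂ fun i => X (σ i) where
  moments :=
    { lower := fun u => by
        rw [Equiv.sum_comp σ fun i => (∑ l, X i l * u l) * ∑ l, X i l * u l]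
        exact hX.moments.lower u
      upper := fun u => by
        rw [Equiv.sum_comp σ fun i => (∑ l, X i l * u l) * ∑ l, X i l * u l]
        exact hX.moments.upper u
      tail := fun u => by
        rw [Equiv.sum_comp σ fun i => max ((∑ l, X i l * u l) * (∑ l, X i l * u l) -
          6 * L * ∑ l, u l * u l) 0]
        exact hX.moments.tail u }
  mean u := by
    rw [Equiv.sum_comp σ fun i => f.sgn (X i) * ∑ l, X i l * u l]
    exact hX.mean u
  label := by
    rw [Equiv.sum_comp σ fun i => (1 - f.sgn (X i)) / 2]
    exact hX.label
  cdf₁ := by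
    rw [Equiv.sum_comp σ fun i => (Set.Iio s₁).indicator (fun _ => (1 : ℝ)) (X i 0)]
    exact hX.cdf₁
  cdf₂ := by
    rw [Equiv.sum_comp σ fun i => (Set.Iio s₂).indicator (fun _ => (1 : ℝ)) (X i 0)]
    exact hX.cdf₂

theorem norm_sq_eq_sum_mul {n : ℕ} (v : Pt n) : ∑ l, v l * v l = ‖v‖ ^ 2 := by
  rw [← real_inner_self_eq_norm_sq, inner_eq_sum]

theorem norm_sub_chow_le {h : LTF n} {w : Fin m → ℝ} {B : Finset (Fin m)} (hm : 0 < m)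
    (hL : 1 ≤ L) (hε : 0 < ε) (hε1 : ε ≤ 1 / 2) (hmn : 1000 * ((n : ℝ) / ε) ^ 4 ≤ m)
    (hX : CleanSample ε L f s₁ s₂ X) (hS : ∀ i ∉ B, S i = (X i, f.label (X i)))
    (hB : (B.card : ℝ) ≤ ε * m)
    (hr : FilterReach (fun i => (S i).1) m (6 * L) (24 * L * ε) m w)
    (hv : ∀ l, h.v l = ∑ i, w i * ((S i).2 : ℤ) * (S i).1 l / m) :
    ‖h.v - WithLp.toLp 2 f.chow‖ ≤ 18 * ε * √L := by
  have hm' : (0 : ℝ) < m := by exact_mod_cast hm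
  have hn : (1 : ℝ) ≤ n := by exact_mod_cast NeZero.one_le
  have hL' : (1 : ℝ) ≤ L := by exact_mod_cast hL
  have hxX : ∀ i ∉ B, (S i).1 = X i := fun i hi => by rw [hS i hi]
  obtain ⟨hw, hnv⟩ := hr.good hL hε hX.moments hxX hB
  have hη : 0 < 24 * L * ε := by positivity
  -- The exponent K = m is large enough since η/(1+η) ≥ ε and m²ε³ ≥ mε⁴ ≥ 1000n⁴.
  have hK : (n : ℝ) < (m : ℝ) ^ 2 * (24 * L * ε / (1 + 24 * L * ε)) ^ 3 := by
    have h1 : ε ≤ 24 * L * ε / (1 + 24 * L * ε) := by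
      rw [le_div_iff₀ (by positivity)]
      have : 1 * ε ≤ L * ε := mul_le_mul_of_nonneg_right hL' hε.le
      nlinarith
    have h2 : ε ^ 3 ≤ (24 * L * ε / (1 + 24 * L * ε)) ^ 3 := pow_le_pow_left₀ hε.le h1 3
    have h3 : 1000 * (n : ℝ) ^ 4 ≤ m * ε ^ 4 := by
      have := mul_le_mul_of_nonneg_right hmn (by positivity : 0 ≤ ε ^ 4)
      rwa [div_pow, mul_assoc, div_mul_cancel₀ _ (by positivity)] at this
    have h4 : (n : ℝ) ≤ n ^ 4 := le_self_pow₀ hn (by norm_num)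
    have h5 : (m : ℝ) * ε ^ 4 ≤ m * ε ^ 3 :=
      mul_le_mul_of_nonneg_left (pow_le_pow_of_le_one hε.le (by linarith) (by norm_num)) hm'.le
    have h6 : (1 : ℝ) ≤ m := by exact_mod_cast hm
    have h7 : 1 * (m * ε ^ 3) ≤ m * (m * ε ^ 3) := mul_le_mul_of_nonneg_right h6 (by positivity)
    have h8 := mul_le_mul_of_nonneg_left h2 (by positivity : 0 ≤ (m : ℝ) ^ 2)
    nlinarith
  -- Testing in the direction of the error itself gives m‖d‖² ≤ (17+1)ε√L·m‖d‖, where the 1 is the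
  -- sampling error of the clean mean.
  set d : Pt n := h.v - WithLp.toLp 2 f.chow with hd
  have hbound := abs_sum_sub_sum_le hL hε hX.moments hxX hB hw
    (y := fun i => (((S i).2 : ℤ) : ℝ)) (Y := fun i => f.sgn (X i))
    (fun i hi => by rw [hS i hi, LTF.sgn])
    (fun i => by rcases Int.units_eq_one_or (S i).2 with h | h <;> simp [h])
    (fun i => by rcases Int.units_eq_one_or (f.label (X i)) with h | h <;> simp [LTF.sgn, h])
    d (sum_mul_sq_le_of_not_violated hm hw.nonneg hη hK hnv d)
  have hmean := hX.mean d
  have e1 : ∑ i, w i * (((S i).2 : ℤ) : ℝ) * ∑ l, (S i).1 l * d l = m * ∑ l, h.v l * d l := by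
    simp only [hv, Finset.mul_sum, Finset.sum_mul]
    rw [Finset.sum_comm]
    refine Finset.sum_congr rfl fun l _ => Finset.sum_congr rfl fun i _ => ?_
    field_simp
  rw [e1] at hbound
  have e2 : m * ∑ l, h.v l * d l - m * ∑ l, f.chow l * d l = m * ‖d‖ ^ 2 := by
    rw [← norm_sq_eq_sum_mul, ← mul_sub, ← Finset.sum_sub_distrib]
    refine congrArg _ (Finset.sum_congr rfl fun l _ => ?_)
    rw [← sub_mul]
    rfl
  rw [norm_sq_eq_sum_mul, Real.sqrt_sq (norm_nonneg _)] at hbound hmean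
  have h1 := (abs_le.1 hbound).2
  have h2 := (abs_le.1 hmean).2
  have hsL : 1 ≤ √(L : ℝ) := Real.one_le_sqrt.2 hL'
  have h3 : ε * m * ‖d‖ ≤ ε * √L * m * ‖d‖ := by
    refine mul_le_mul_of_nonneg_right ?_ (norm_nonneg _)
    refine mul_le_mul_of_nonneg_right ?_ hm'.le
    nlinarith
  have h4 : m * ‖d‖ ^ 2 ≤ m * ‖d‖ * (18 * ε * √L) := by linarith
  rcases (norm_nonneg d).eq_or_lt with h0 | h0
  · rw [← h0]
    positivity
  · refine le_of_mul_le_mul_left ?_ (mul_pos hm' h0)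
    linarith

theorem IsLearned.err_le {h : LTF n} (hL : 1 ≤ L) (hε : 0 < ε) (hε1 : ε ≤ 1 / 2)
    (hLε : (1 / 2) ^ L ≤ ε) (hLmin : ∀ k < L, ε < (1 / 2) ^ k)
    (hmn : 1000 * ((n : ℝ) / ε) ^ 4 ≤ m) (hX : CleanSample ε L f s₁ s₂ X)
    (h₁ : f.negProb + 4 * ε < 1 → normalCDF s₁ = f.negProb + 4 * ε)
    (h₂ : 0 < f.negProb - 4 * ε → normalCDF s₂ = f.negProb - 4 * ε)
    (hS : IsNastySample ε f X S) (hh : IsLearned ε S h) : h.err f ≤ 540 * (ε * √L) := by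
  classical
  have hn : (1 : ℝ) ≤ n := by exact_mod_cast NeZero.one_le
  have hmε : 1000 ≤ m * ε ^ 4 := by
    have := mul_le_mul_of_nonneg_right hmn (by positivity : 0 ≤ ε ^ 4)
    rw [div_pow, mul_assoc, div_mul_cancel₀ _ (by positivity)] at this
    have h4 : (1 : ℝ) ≤ n ^ 4 := one_le_pow₀ hn
    linarith
  have hm' : (0 : ℝ) < m := by
    by_contra hc
    have : (m : ℝ) * ε ^ 4 ≤ 0 := mul_nonpos_of_nonpos_of_nonneg (not_lt.1 hc) (by positivity)
    linarith
  have hm : 0 < m := by exact_mod_cast hm'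
  have hpow : (1 / 2 : ℝ) ^ m ≤ ε ^ 2 / 5 := by
    rw [one_div, inv_pow, inv_le_iff_one_le_mul₀ (by positivity)]
    have h1 : (m : ℝ) ≤ 2 ^ m := by exact_mod_cast (Nat.lt_two_pow_self (n := m)).le
    have h2 : (m : ℝ) * ε ^ 4 ≤ m * ε ^ 2 :=
      mul_le_mul_of_nonneg_left (pow_le_pow_of_le_one hε.le (by linarith) (by norm_num)) hm'.le
    have h3 := mul_le_mul_of_nonneg_right h1 (by positivity : 0 ≤ ε ^ 2 / 5)
    linarith
  obtain ⟨L', w, τ, hL', hL'min, hr, hv, hτ, hθ⟩ := hh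
  -- The sample is so large that 2^(-m) ≤ ε²/5, so the program's count `L'` has reached ε even if it
  -- equals `m`; minimality then gives `L' = L`. The same bound controls the Newton error.
  have hL'ε : (1 / 2 : ℝ) ^ L' ≤ ε := by
    rcases hL' with rfl | h
    · refine hpow.trans ?_
      nlinarith
    · exact h
  obtain rfl : L' = L := by
    refine le_antisymm (not_lt.1 fun h => ?_) (not_lt.1 fun h => ?_)
    · exact absurd (hL'min L h) (not_lt.2 hLε)
    · exact absurd (hLmin L' h) (not_lt.2 hL'ε)
  obtain ⟨σ, hσ⟩ := hS
  set B : Finset (Fin m) := Finset.univ.filter fun i => S i ≠ (X (σ i), f.label (X (σ i)))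
  have hB : (B.card : ℝ) ≤ ε * m := by convert hσ
  have hSB : ∀ i ∉ B, S i = (X (σ i), f.label (X (σ i))) := fun i hi => by
    by_contra hc
    exact hi (Finset.mem_filter.2 ⟨Finset.mem_univ _, hc⟩)
  have hX' := hX.comp_perm σ
  have hchow := norm_sub_chow_le hm hL hε hε1 hmn hX' hSB hB hr hv
  obtain ⟨i, hi, rfl⟩ := hτ (exists_isQuantile hm S)
  have hτ' := hi.abs_normalCDF_sub_le hm hε hX' hSB hB h₁ h₂
  rw [norm_sq_eq_sum_mul] at hθ
  obtain ⟨hs0, hs1, hs2⟩ := newtonSqrt_bounds (sq_nonneg ‖h.v‖) m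
  rw [Real.sqrt_sq (norm_nonneg _)] at hs1 hs2
  have hsL : 1 ≤ √(L' : ℝ) := Real.one_le_sqrt.2 (by exact_mod_cast hL)
  have hεδ : ε ≤ 18 * ε * √L' := by nlinarith
  have := LTF.err_le hε hεδ hchow hτ' hθ hs0 hs1
    (hs2.trans (mul_le_mul_of_nonneg_right hpow (by positivity)))
  linarith

end learned

/-! ### The error in terms of log(1/ε), and the assembly. -/

theorem sqrt_le_of_lt_half_pow {ε : ℝ} {L : ℕ} (hε : 0 < ε) (hε1 : ε ≤ 1 / 2) (hL : 1 ≤ L)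
    (h : ε < (1 / 2) ^ (L - 1)) : √L ≤ 2 * √(Real.log (1 / ε)) := by
  have h2 : 1 / 2 ≤ Real.log 2 := by linarith [Real.log_two_gt_d9]
  have hlog : Real.log (1 / ε) = -Real.log ε := by rw [one_div, Real.log_inv]
  have h3 : Real.log 2 ≤ Real.log (1 / ε) := by
    refine Real.log_le_log (by norm_num) ?_
    rw [le_div_iff₀ hε]
    linarith
  have h4 := Real.log_lt_log hε h
  rw [Real.log_pow, one_div, Real.log_inv, Nat.cast_sub hL, Nat.cast_one] at h4
  -- L·log 2 is (L-1)·log 2 + log 2, and both summands are at most log(1/ε); moreover log 2 ≥ 1/2.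
  have h5 : (L : ℝ) ≤ 2 ^ 2 * Real.log (1 / ε) := by
    have hL' : (1 : ℝ) ≤ L := by exact_mod_cast hL
    have := mul_le_mul_of_nonneg_left h2 (by linarith : 0 ≤ (L : ℝ))
    nlinarith
  refine (Real.sqrt_le_sqrt h5).trans ?_
  rw [Real.sqrt_mul (by norm_num), Real.sqrt_sq (by norm_num)]

/-- There are one program and constants such that, for all dimensions `n ≥ 1`, noise rates
`0 < ε ≤ 1/2` and with `m = ⌈a (n / ε) ^ k⌉` samples, the program halts in time `b (n / ε) ^ l`
on every sample, and for every target `f`, with probability at least `9/10` over the `m` clean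
points, whatever the adversary does, its hypothesis has error `≤ c ε √(log (1/ε))`. -/
theorem mainTheorem8 :
    ∃ (p : RealRAM.Prog) (a k b l : ℕ) (c : ℝ),
      ∀ (n : ℕ) (ε : ℝ), 1 ≤ n → 0 < ε → ε ≤ 1 / 2 →
        (∀ S : Fin (sampleSize a k n ε) → Example n,
          ∃ (t : ℕ) (h : LTF n), RealRAM.Returns p ε S t h ∧ (t : ℝ) ≤ b * (n / ε) ^ l) ∧
        ∀ f : LTF n,
          cleanLaw n (sampleSize a k n ε)
            {X | ∃ S : Fin (sampleSize a k n ε) → Example n, IsNastySample ε f X S ∧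
              ∃ (t : ℕ) (h : LTF n), RealRAM.Returns p ε S t h ∧
                c * (ε * √(Real.log (1 / ε))) < h.err f} ≤ 1 / 10 := by
  -- The running time is 2000(n+m)^5 with n + m ≤ 1002(n/ε)^4. The error constant is 1080 = 2·540
  -- with 540 = 30·18: 18ε√L for the Chow vector, the factor 30 of `LTF.err_le`, and √L ≤
  -- 2√log(1/ε).
  refine ⟨RealRAM.learnP, 1000, 4, 2000 * 1002 ^ 5, 20, 1080, fun n ε hn hε hε1 => ?_⟩
  have : NeZero n := ⟨by omega⟩
  have hn' : (1 : ℝ) ≤ n := by exact_mod_cast hn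
  set m := sampleSize 1000 4 n ε with hm
  have hmn : 1000 * ((n : ℝ) / ε) ^ 4 ≤ m := by
    rw [hm, sampleSize]
    exact_mod_cast Nat.le_ceil _
  have hr1 : (n : ℝ) ≤ n / ε := by
    rw [le_div_iff₀ hε]
    nlinarith
  have hr4 : (n : ℝ) / ε ≤ (n / ε) ^ 4 := le_self_pow₀ (hn'.trans hr1) (by norm_num)
  refine ⟨fun S => ?_, fun f => ?_⟩
  · obtain ⟨t, h, hR, ht, -⟩ := RealRAM.learnP_returns ε S
    refine ⟨t, h, hR, ?_⟩
    have hmlt : (m : ℝ) ≤ 1000 * ((n : ℝ) / ε) ^ 4 + 1 := by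
      rw [hm, sampleSize]
      have := (Nat.ceil_lt_add_one (by positivity : 0 ≤ ((1000 : ℕ) : ℝ) * ((n : ℝ) / ε) ^ 4)).le
      exact_mod_cast this
    calc (t : ℝ) ≤ 2000 * ((n : ℝ) + m) ^ 5 := by exact_mod_cast ht
      _ ≤ 2000 * (1002 * ((n : ℝ) / ε) ^ 4) ^ 5 := by gcongr; linarith
      _ = _ := by push_cast; ring
  · have hex : ∃ L : ℕ, (1 / 2 : ℝ) ^ L ≤ ε :=
      (exists_pow_lt_of_lt_one hε (by norm_num)).imp fun _ h => h.le
    classical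
    obtain ⟨L, hLε, hLmin⟩ : ∃ L : ℕ, (1 / 2 : ℝ) ^ L ≤ ε ∧ ∀ k < L, ε < (1 / 2) ^ k :=
      ⟨Nat.find hex, Nat.find_spec hex, fun k hk => not_le.1 (Nat.find_min hex hk)⟩
    have hL : 1 ≤ L := by
      rcases Nat.eq_zero_or_pos L with rfl | h
      · norm_num at hLε
        linarith
      · exact h
    obtain ⟨s₁, h₁⟩ : ∃ s, f.negProb + 4 * ε < 1 → normalCDF s = f.negProb + 4 * ε := by
      by_cases h : f.negProb + 4 * ε < 1
      · obtain ⟨s, hs⟩ := exists_normalCDF_eq (by linarith [f.negProb_nonneg]) h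
        exact ⟨s, fun _ => hs⟩
      · exact ⟨0, fun h' => absurd h' h⟩
    obtain ⟨s₂, h₂⟩ : ∃ s, 0 < f.negProb - 4 * ε → normalCDF s = f.negProb - 4 * ε := by
      by_cases h : 0 < f.negProb - 4 * ε
      · obtain ⟨s, hs⟩ := exists_normalCDF_eq h (by linarith [f.negProb_le_one])
        exact ⟨s, fun _ => hs⟩
      · exact ⟨0, fun h' => absurd h' h⟩
    have hP := cleanLaw_not_cleanSample_le (m := m) hε hε1 hmn hLε f s₁ s₂
    refine (MeasureTheory.measure_mono (t := {X | ¬CleanSample ε L f s₁ s₂ X}) ?_).trans ?_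
    · rintro X ⟨S, hS, t, h, ⟨s, hs, rfl⟩, herr⟩ hX
      obtain ⟨t', h', ⟨s', hs', rfl⟩, -, hlearn⟩ := RealRAM.learnP_returns ε S
      -- By determinism the bad run in the event is the run that has been analysed.
      obtain ⟨-, rfl⟩ := hs.det hs'
      have h1 := hlearn.err_le hL hε hε1 hLε hLmin hmn hX h₁ h₂ hS
      have h2 := mul_le_mul_of_nonneg_left
        (sqrt_le_of_lt_half_pow hε hε1 hL (hLmin (L - 1) (by omega))) hε.le
      linarith
    · rw [← MeasureTheory.ofReal_measureReal]
      refine (ENNReal.ofReal_le_ofReal hP).trans ?_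
      rw [ENNReal.ofReal_div_of_pos (by norm_num)]
      simp
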